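/- Let $M,K\ge 1$ be integers and let $P\ge 0$ be a real number. For $k=1,\dots,K$ and $i=1,2,3$ let $\mathbf H_{k,i}\in\mathbb C^{2M\times M}$ be random matrices, all of whose entries (over all $k$, $i$ and all positions) are i.i.d. circularly symmetric complex Gaussian random variables with zero mean and unit variance. For a matrix $\mathbf F\in\mathbb C^{M\times 2M}$ with $\mathbf F\mathbf F^\dagger=\mathbf I_M$ put $$R_k^-(\mathbf F)=\log_2\det\Big(\mathbf I_M+\frac PM\sum_{i=2}^{3}\mathbf F\mathbf H_{k,i}\mathbf H_{k,i}^\dagger\mathbf F^\dagger\Big).$$ For $i=2,3$ let $\tilde{\mathbf H}_{k,i}\in\mathbb C^{2M\times M}$ be, almost surely, an arbitrary generator matrix of the column space of $\mathbf H_{k,i}$, that is, a matrix whose columns are orthonormal and span that space. For two $M$-dimensional subspaces $\mathcal A,\mathcal B$ of $\mathbb C^{2M}$ with principal angles $\theta_1,\dots,\theta_M\in[0,\pi/2]$ (defined recursively: $\cos\theta_m$ is the maximum of $|\mathbf a^\dagger\mathbf b|$ over unit vectors $\mathbf a\in\mathcal A$, $\mathbf b\in\mathcal B$ orthogonal to the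 maximizers $\mathbf a_n$, respectively $\mathbf b_n$, chosen at the steps $n<m$), let $d_c(\mathcal A,\mathcal B)=\big(\sum_{m=1}^M\sin^2\theta_m\big)^{1/2}$ be the chordal distance, and write $d_c(\tilde{\mathbf H}_{k,2},\tilde{\mathbf H}_{k,3})$ for the chordal distance of the column spaces. Then the minimum of $R_k^-(\mathbf F)$ over all $k\in\{1,\dots,K\}$ and all $\mathbf F$ with $\mathbf F\mathbf F^\dagger=\mathbf I_M$ is attained, both expectations below are finite, and $$\mathbb E\Big[\min_{k,\;\mathbf F\mathbf F^\dagger=\mathbf I_M}R_k^-(\mathbf F)\Big]\le\mathbb E\Big[\min_{1\le k\le K}M\log_2\Big(1+\frac PM\,d_c^2(\tilde{\mathbf H}_{k,2},\tilde{\mathbf H}_{k,3})\Big)\Big].$$ -/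

import Mathlib

open MeasureTheory ProbabilityTheory Matrix

/-- The circularly symmetric complex Gaussian law `CN(0, 1)`: independent real and imaginary
parts, each centred Gaussian of variance `1/2`. -/
noncomputable def stdComplexGaussian : Measure ℂ :=
  ((gaussianReal 0 (1 / 2)).prod (gaussianReal 0 (1 / 2))).map
    (fun p : ℝ × ℝ => (⟨p.1, p.2⟩ : ℂ))

/-- All entries of all the channel matrices `H k i` (user `k`, transmitter `i`) are i.i.d.
`CN(0, 1)` random variables. -/
structure IsIIDGaussianChannel {Ω : Type*} [MeasurableSpace Ω] (μ : Measure Ω) {K M : ℕ}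
    (H : Fin K → Fin 3 → Ω → Matrix (Fin (2 * M)) (Fin M) ℂ) : Prop where
  hasLaw : ∀ k i r c, HasLaw (fun ω => H k i ω r c) stdComplexGaussian μ
  indep : iIndepFun
    (fun (q : Fin K × Fin 3 × Fin (2 * M) × Fin M) (ω : Ω) => H q.1 q.2.1 ω q.2.2.1 q.2.2.2) μ

/-- The rate loss `log₂ det (I + (P/M) ∑ᵢ F Hᵢ Hᵢᴴ Fᴴ)`, the sum running over the interfering
transmitters, that is over the indices `1` and `2` of `Fin 3` (index `0` is the desired
transmitter). The determinant is that of a positive definite Hermitian matrix, hence a positive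
real number, which `re` reads off. -/
noncomputable def rateLoss {M : ℕ} (P : ℝ) (F : Matrix (Fin M) (Fin (2 * M)) ℂ)
    (H : Fin 3 → Matrix (Fin (2 * M)) (Fin M) ℂ) : ℝ :=
  Real.logb 2
    (1 + ((P / M : ℝ) : ℂ) • ∑ i ∈ ({1, 2} : Finset (Fin 3)), F * H i * (H i)ᴴ * Fᴴ).det.re

/-- The values of the rate loss over all users `k` and all admissible postprocessing matrices
(`F Fᴴ = I`). -/
def rateLossValues {K M : ℕ} (P : ℝ) (H : Fin K → Fin 3 → Matrix (Fin (2 * M)) (Fin M) ℂ) :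
    Set ℝ :=
  {x | ∃ (k : Fin K) (F : Matrix (Fin M) (Fin (2 * M)) ℂ), F * Fᴴ = 1 ∧ rateLoss P F (H k) = x}

/-- The subspace spanned by the columns of a matrix. -/
noncomputable def colSpan {m n : ℕ} (A : Matrix (Fin n) (Fin m) ℂ) :
    Submodule ℂ (EuclideanSpace ℂ (Fin n)) :=
  Submodule.span ℂ (Set.range fun j => WithLp.toLp 2 (fun r => A r j))

/-- `A` is a generator matrix of the subspace `S`: its columns are orthonormal and span `S`. -/
def IsGenerator {m n : ℕ} (A : Matrix (Fin n) (Fin m) ℂ)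
    (S : Submodule ℂ (EuclideanSpace ℂ (Fin n))) : Prop :=
  Aᴴ * A = 1 ∧ colSpan A = S

section PrincipalAngles

variable {E : Type*} [NormedAddCommGroup E] [InnerProductSpace ℂ E]

/-- `a`, `b` are principal vectors and `θ` the principal angles of the subspaces `A`, `B`:
recursively, `cos θₘ` is the maximum of `|⟨x, y⟩|` over unit vectors `x ∈ A`, `y ∈ B` orthogonal
to the earlier `aₙ`, respectively `bₙ`, and it is attained at `(aₘ, bₘ)`. -/
structure IsPrincipalSystem (A B : Submodule ℂ E) {M : ℕ} (a b : Fin M → E) (θ : Fin M → ℝ) :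
    Prop where
  angle_mem : ∀ m, θ m ∈ Set.Icc 0 (Real.pi / 2)
  left_mem : ∀ m, a m ∈ A
  right_mem : ∀ m, b m ∈ B
  left_norm : ∀ m, ‖a m‖ = 1
  right_norm : ∀ m, ‖b m‖ = 1
  left_orth : ∀ m n, n < m → inner ℂ (a n) (a m) = 0
  right_orth : ∀ m n, n < m → inner ℂ (b n) (b m) = 0
  cos_eq : ∀ m, Real.cos (θ m) = ‖inner ℂ (a m) (b m)‖
  le_cos : ∀ m, ∀ x ∈ A, ∀ y ∈ B, ‖x‖ = 1 → ‖y‖ = 1 →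
    (∀ n < m, inner ℂ (a n) x = 0) → (∀ n < m, inner ℂ (b n) y = 0) →
    ‖inner ℂ x y‖ ≤ Real.cos (θ m)

/-- `θ` is the list of the principal angles between `A` and `B`. -/
def ArePrincipalAngles (A B : Submodule ℂ E) {M : ℕ} (θ : Fin M → ℝ) : Prop :=
  ∃ a b : Fin M → E, IsPrincipalSystem A B a b θ

open Classical in
/-- The chordal distance `√(∑ₘ sin² θₘ)` between two `M`-dimensional subspaces, where the `θₘ` are
the principal angles. The angles exist (`exists_principalAngles`) and their choice does not matter
(`chordalDist_eq`) when both subspaces have dimension `M`. -/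
noncomputable def chordalDist (M : ℕ) (A B : Submodule ℂ E) : ℝ :=
  if h : ∃ θ : Fin M → ℝ, ArePrincipalAngles A B θ then
    √(∑ m, Real.sin (h.choose m) ^ 2)
  else 0

theorem exists_max_inner [FiniteDimensional ℂ E] (A B : Submodule ℂ E)
    (hA : A ≠ ⊥) (hB : B ≠ ⊥) :
    ∃ a ∈ A, ∃ b ∈ B, ‖a‖ = 1 ∧ ‖b‖ = 1 ∧
      ∀ x ∈ A, ∀ y ∈ B, ‖x‖ = 1 → ‖y‖ = 1 → ‖inner ℂ x y‖ ≤ ‖inner ℂ a b‖ := by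
  have : ProperSpace E := FiniteDimensional.proper ℂ E
  have key : ∀ S : Submodule ℂ E, S ≠ ⊥ →
      IsCompact ((S : Set E) ∩ Metric.sphere 0 1) ∧ ((S : Set E) ∩ Metric.sphere 0 1).Nonempty := by
    intro S hS
    refine ⟨(isCompact_sphere 0 1).inter_left S.closed_of_finiteDimensional, ?_⟩
    obtain ⟨x, hx, hx0⟩ := Submodule.exists_mem_ne_zero_of_ne_bot hS
    refine ⟨((‖x‖⁻¹ : ℝ) : ℂ) • x, S.smul_mem _ hx, ?_⟩
    simp [norm_smul, hx0]
  obtain ⟨cA, nA⟩ := key A hA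
  obtain ⟨cB, nB⟩ := key B hB
  obtain ⟨⟨a, b⟩, ⟨ha, hb⟩, hmax⟩ := (cA.prod cB).exists_isMaxOn (nA.prod nB)
    (f := fun p : E × E => ‖inner ℂ p.1 p.2‖) (by fun_prop)
  refine ⟨a, ha.1, b, hb.1, by simpa using ha.2, by simpa using hb.2, ?_⟩
  intro x hx y hy hx1 hy1
  exact hmax (show (x, y) ∈ _ from ⟨⟨hx, by simpa using hx1⟩, ⟨hy, by simpa using hy1⟩⟩)

theorem exists_principalAngles [FiniteDimensional ℂ E] (M : ℕ) : ∀ (A B : Submodule ℂ E),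
    Module.finrank ℂ A = M → Module.finrank ℂ B = M →
    ∃ θ : Fin M → ℝ, ArePrincipalAngles A B θ := by
  induction M with
  | zero =>
    intro A B _ _
    exact ⟨Fin.elim0, Fin.elim0, Fin.elim0, by constructor <;> exact fun m => m.elim0⟩
  | succ M ih =>
    intro A B hA hB
    obtain ⟨a, ha, b, hb, na, nb, hmax⟩ := exists_max_inner A B
      (by rintro rfl; simp at hA) (by rintro rfl; simp at hB)
    have key : ∀ (S : Submodule ℂ E) (v : E), v ∈ S → ‖v‖ = 1 → Module.finrank ℂ S = M + 1 →
        Module.finrank ℂ ((ℂ ∙ v)ᗮ ⊓ S : Submodule ℂ E) = M := by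
      intro S v hv nv hS
      have h := Submodule.finrank_add_inf_finrank_orthogonal
        (K₁ := (ℂ ∙ v)) (K₂ := S) ((Submodule.span_singleton_le_iff_mem v S).2 hv)
      rw [finrank_span_singleton (by rintro rfl; simp at nv), hS] at h
      omega
    obtain ⟨θ, as, bs, h⟩ := ih _ _ (key A a ha na hA) (key B b hb nb hB)
    have memA : ∀ x, x ∈ ((ℂ ∙ a)ᗮ ⊓ A : Submodule ℂ E) ↔ inner ℂ a x = 0 ∧ x ∈ A := fun x => by
      rw [Submodule.mem_inf, Submodule.mem_orthogonal_singleton_iff_inner_right]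
    have memB : ∀ x, x ∈ ((ℂ ∙ b)ᗮ ⊓ B : Submodule ℂ E) ↔ inner ℂ b x = 0 ∧ x ∈ B := fun x => by
      rw [Submodule.mem_inf, Submodule.mem_orthogonal_singleton_iff_inner_right]
    have hle : ‖inner ℂ a b‖ ≤ 1 := by simpa [na, nb] using norm_inner_le_norm (𝕜 := ℂ) a b
    have hcos : Real.cos (Real.arccos ‖inner ℂ a b‖) = ‖inner ℂ a b‖ :=
      Real.cos_arccos (by linarith [norm_nonneg (inner ℂ a b)]) hle
    refine ⟨Fin.cons (Real.arccos ‖inner ℂ a b‖) θ, Fin.cons a as, Fin.cons b bs, ?_⟩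
    constructor
    · intro m
      refine Fin.cases ?_ (fun m => ?_) m
      · exact ⟨Real.arccos_nonneg _, Real.arccos_le_pi_div_two.2 (norm_nonneg _)⟩
      · simpa using h.angle_mem m
    · intro m
      refine Fin.cases (by simpa using ha) (fun m => ?_) m
      simpa using ((memA _).1 (h.left_mem m)).2
    · intro m
      refine Fin.cases (by simpa using hb) (fun m => ?_) m
      simpa using ((memB _).1 (h.right_mem m)).2
    · intro m
      exact Fin.cases (by simpa using na) (fun m => by simpa using h.left_norm m) m
    · intro m
      exact Fin.cases (by simpa using nb) (fun m => by simpa using h.right_norm m) m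
    · intro m n
      refine Fin.cases (by simp) (fun m => ?_) m
      refine Fin.cases (fun _ => ?_) (fun n hn => ?_) n
      · simpa using ((memA _).1 (h.left_mem m)).1
      · simpa using h.left_orth m n (by simpa using hn)
    · intro m n
      refine Fin.cases (by simp) (fun m => ?_) m
      refine Fin.cases (fun _ => ?_) (fun n hn => ?_) n
      · simpa using ((memB _).1 (h.right_mem m)).1
      · simpa using h.right_orth m n (by simpa using hn)
    · intro m
      refine Fin.cases (by simpa using hcos) (fun m => by simpa using h.cos_eq m) m
    · intro m
      refine Fin.cases ?_ (fun m => ?_) m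
      · intro x hx y hy nx ny _ _
        simpa [hcos] using hmax x hx y hy nx ny
      · intro x hx y hy nx ny ox oy
        have := h.le_cos m x ((memA _).2 ⟨by simpa using ox 0 (by simp), hx⟩)
          y ((memB _).2 ⟨by simpa using oy 0 (by simp), hy⟩) nx ny
          (fun n hn => by simpa using ox n.succ (by simpa using hn))
          (fun n hn => by simpa using oy n.succ (by simpa using hn))
        simpa using this

namespace IsPrincipalSystem

variable {A B : Submodule ℂ E} {M : ℕ} {a b : Fin M → E} {θ : Fin M → ℝ}

theorem symm (h : IsPrincipalSystem A B a b θ) : IsPrincipalSystem B A b a θ where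
  angle_mem := h.angle_mem
  left_mem := h.right_mem
  right_mem := h.left_mem
  left_norm := h.right_norm
  right_norm := h.left_norm
  left_orth := h.right_orth
  right_orth := h.left_orth
  cos_eq m := by rw [h.cos_eq, norm_inner_symm]
  le_cos m x hx y hy nx ny ox oy := by
    rw [norm_inner_symm]
    exact h.le_cos m y hy x hx ny nx oy ox

theorem left_orthonormal (h : IsPrincipalSystem A B a b θ) : Orthonormal ℂ a := by
  refine ⟨h.left_norm, fun i j hij => ?_⟩
  rcases lt_or_gt_of_ne hij with hl | hl
  · exact h.left_orth j i hl
  · exact inner_eq_zero_symm.1 (h.left_orth i j hl)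

/-- Maximality at step `i` forces the later `bⱼ` to be orthogonal to `aᵢ`. -/
theorem inner_of_lt (h : IsPrincipalSystem A B a b θ) {i j : Fin M} (hij : i < j) :
    inner ℂ (a i) (b j) = 0 := by
  set x : ℂ := inner ℂ (a i) (b i) with hx
  set y : ℂ := inner ℂ (a i) (b j) with hy
  by_contra hne
  have hpos : 0 < ‖x‖ ^ 2 + ‖y‖ ^ 2 := by positivity
  set v : E := (starRingEnd ℂ x) • b i + (starRingEnd ℂ y) • b j with hv
  have hbb : inner ℂ (b i) (b j) = 0 := h.right_orth j i hij
  have hvn : ‖v‖ ^ 2 = ‖x‖ ^ 2 + ‖y‖ ^ 2 := by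
    have := norm_add_sq_eq_norm_sq_add_norm_sq_of_inner_eq_zero
      ((starRingEnd ℂ x) • b i) ((starRingEnd ℂ y) • b j)
      (by rw [inner_smul_left, inner_smul_right, hbb]; simp)
    rw [hv, sq, this]
    simp [norm_smul, h.right_norm, sq]
  have hvi : inner ℂ (a i) v = ((‖x‖ ^ 2 + ‖y‖ ^ 2 : ℝ) : ℂ) := by
    rw [hv, inner_add_right, inner_smul_right, inner_smul_right, ← hx, ← hy, Complex.conj_mul',
      Complex.conj_mul']
    push_cast; ring
  have hv0 : 0 < ‖v‖ := by
    rcases (norm_nonneg v).eq_or_lt with h0 | h0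
    · rw [← h0] at hvn; simp at hvn; linarith
    · exact h0
  have hmax := h.le_cos i (a i) (h.left_mem i) (((‖v‖⁻¹ : ℝ) : ℂ) • v)
    (B.smul_mem _ (B.add_mem (B.smul_mem _ (h.right_mem i)) (B.smul_mem _ (h.right_mem j))))
    (h.left_norm i) (by rw [norm_smul]; simp [hv0.ne'])
    (fun n hn => h.left_orth i n hn)
    (fun n hn => by
      rw [inner_smul_right, hv, inner_add_right, inner_smul_right, inner_smul_right,
        h.right_orth i n hn, h.right_orth j n (hn.trans hij)]
      simp)
  rw [h.cos_eq, inner_smul_right, hvi, ← hvn, ← hx, norm_mul, Complex.norm_real,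
    Complex.norm_real, Real.norm_of_nonneg (by positivity), Real.norm_of_nonneg (by positivity),
    sq, inv_mul_cancel_left₀ hv0.ne'] at hmax
  have hy0 : 0 < ‖y‖ := norm_pos_iff.2 hne
  nlinarith [norm_nonneg x]

theorem inner_of_ne (h : IsPrincipalSystem A B a b θ) {i j : Fin M} (hij : i ≠ j) :
    inner ℂ (a i) (b j) = 0 := by
  rcases lt_or_gt_of_ne hij with hl | hl
  · exact h.inner_of_lt hl
  · exact inner_eq_zero_symm.1 (h.symm.inner_of_lt hl)

theorem sum_cos_sq (h : IsPrincipalSystem A B a b θ) :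
    ∑ m, Real.cos (θ m) ^ 2 = ∑ i, ∑ j, ‖inner ℂ (a i) (b j)‖ ^ 2 := by
  refine Finset.sum_congr rfl fun i _ => ?_
  rw [Finset.sum_eq_single i (fun j _ hj => by rw [h.inner_of_ne hj.symm]; simp) (by simp),
    h.cos_eq]

end IsPrincipalSystem

/-- The sum of squared inner products with an orthonormal basis of `A` does not depend on the
basis. -/
theorem sum_sq_norm_inner_eq [FiniteDimensional ℂ E] {A : Submodule ℂ E} {M : ℕ}
    (hA : Module.finrank ℂ A = M) {a a' : Fin M → E} (ha : Orthonormal ℂ a)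
    (ha' : Orthonormal ℂ a') (hm : ∀ i, a i ∈ A) (hm' : ∀ i, a' i ∈ A) (x : E) :
    ∑ i, ‖inner ℂ (a i) x‖ ^ 2 = ∑ i, ‖inner ℂ (a' i) x‖ ^ 2 := by
  have key : ∀ c : Fin M → E, Orthonormal ℂ c → (∀ i, c i ∈ A) →
      ∑ i, ‖inner ℂ (c i) x‖ ^ 2 = ‖A.orthogonalProjectionOnto x‖ ^ 2 := by
    intro c hc hcm
    let c' : Fin M → A := fun i => ⟨c i, hcm i⟩
    have hc' : Orthonormal ℂ c' := by
      constructor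
      · intro i; exact hc.1 i
      · intro i j hij; exact hc.2 hij
    let bs : OrthonormalBasis (Fin M) ℂ A := OrthonormalBasis.mk hc' (by
      rw [hc'.linearIndependent.span_eq_top_of_card_eq_finrank' (by simp [hA])])
    rw [← bs.sum_sq_norm_inner_right (A.orthogonalProjectionOnto x)]
    refine Finset.sum_congr rfl fun i _ => ?_
    have : bs i = c' i := by simp [bs]
    rw [this, Submodule.coe_inner]
    have h2 := Submodule.inner_orthogonalProjectionOnto_eq_of_mem_left (K := A) (c' i) x
    rw [Submodule.coe_inner] at h2
    rw [h2]
  rw [key a ha hm, key a' ha' hm']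

/-- The chordal distance may be computed from any list of principal angles. -/
theorem chordalDist_eq [FiniteDimensional ℂ E] {A B : Submodule ℂ E} {M : ℕ}
    (hA : Module.finrank ℂ A = M) (hB : Module.finrank ℂ B = M) {θ : Fin M → ℝ}
    (hθ : ArePrincipalAngles A B θ) : chordalDist M A B = √(∑ m, Real.sin (θ m) ^ 2) := by
  have hex : ∃ θ : Fin M → ℝ, ArePrincipalAngles A B θ := ⟨θ, hθ⟩
  rw [chordalDist, dif_pos hex]
  obtain ⟨a, b, h⟩ := hθ
  obtain ⟨a', b', h'⟩ := hex.choose_spec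
  have hc : ∑ m, Real.cos (hex.choose m) ^ 2 = ∑ m, Real.cos (θ m) ^ 2 := by
    rw [h'.sum_cos_sq, h.sum_cos_sq, Finset.sum_comm]
    rw [Finset.sum_congr rfl fun j _ => sum_sq_norm_inner_eq hA h'.left_orthonormal
      h.left_orthonormal h'.left_mem h.left_mem (b' j), Finset.sum_comm]
    refine Finset.sum_congr rfl fun i _ => ?_
    have := sum_sq_norm_inner_eq hB h'.symm.left_orthonormal
      h.symm.left_orthonormal h'.right_mem h.right_mem (a i)
    simpa only [norm_inner_symm] using this
  simp only [Real.sin_sq, Finset.sum_sub_distrib, hc]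

end PrincipalAngles

/-!
For a single user, the two interfering channels form a `2M × 2M` Gaussian matrix `G`. Projecting on
the eigenvectors of the `M` smallest eigenvalues of `G Gᴴ` and using the concavity of the logarithm
bounds the minimal rate by `M log₂ (1 + (P / M) * (s / M))`, where `s` is the sum of these
eigenvalues.

The eigenvalues of `G Gᴴ` follow the Laguerre density: both laws satisfy the same loop equations,
obtained by integration by parts, and these equations determine all moments of the power sums. Given
the lower half of the spectrum, the weight of the upper half decreases along rays, so that, by
Chebyshev's correlation inequality in polar coordinates, `s` is stochastically dominated by half the
squared Frobenius norm of an `M × M` Gaussian matrix. Divided by `M`, this bound has the law of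
`‖(1 - Π) W‖² / (2M)`, where `Π` is the projection onto one interfering column space and `W` is the
other channel; its mean given the two column spaces is their squared chordal distance, so Jensen's
inequality compares the means of every nonnegative, nondecreasing, concave rate function, in
particular of the rate truncated at an arbitrary level.

Comparing truncated means at every level is enough to exchange the independent users one at a time,
which yields the minimum over all users.
-/

section LoopEquations

/-- The loop (Dyson–Schwinger) equations for a linear functional `L`: the elements `p k` play the
role of the power sums of `N` eigenvalues, `D k` that of the derivation `∑ xᵢ ^ (k + 1) ∂ᵢ`, and
`t` is the rate of the exponential weight. They determine `L` on all products of the `p k`. -/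
structure SatisfiesLoopEquations {𝕜 A : Type*} [CommRing 𝕜] [CommRing A] [Algebra 𝕜 A] (t : 𝕜)
    (N : ℕ) (p : ℕ → A) (D : ℕ → Derivation 𝕜 A A) (L : A →ₗ[𝕜] 𝕜) : Prop where
  zero : p 0 = (N : A)
  deriv : ∀ k m, D k (p m) = (m : A) * p (m + k)
  loop : ∀ k f, t * L (p (k + 1) * f) =
    L ((∑ j ∈ Finset.range (k + 1), p j * p (k - j)) * f + D k f)

variable {𝕜 A B : Type*} [CommRing 𝕜] [CommRing A] [Algebra 𝕜 A] [CommRing B] [Algebra 𝕜 B]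

theorem map_natCast_mul (L : A →ₗ[𝕜] 𝕜) (n : ℕ) (x : A) : L ((n : A) * x) = n * L x := by
  rw [← nsmul_eq_mul, map_nsmul, nsmul_eq_mul]

namespace SatisfiesLoopEquations

variable {t : 𝕜} {N : ℕ} {p : ℕ → A} {D : ℕ → Derivation 𝕜 A A} {L : A →ₗ[𝕜] 𝕜}
  {q : ℕ → B} {E : ℕ → Derivation 𝕜 B B} {T : B →ₗ[𝕜] 𝕜}

theorem prod_mul_deriv_cons (h : SatisfiesLoopEquations t N p D L) (k a : ℕ) (u l : List ℕ) :
    (u.map p).prod * D k ((a :: l).map p).prod =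
      ((a :: u).map p).prod * D k (l.map p).prod +
        (a : A) * (((a + k) :: (u ++ l)).map p).prod := by
  simp only [List.map_cons, List.prod_cons, List.map_append, List.prod_append,
    Derivation.leibniz, smul_eq_mul, h.deriv]
  ring

theorem map_prod_mul_deriv_eq (h : SatisfiesLoopEquations t N p D L)
    (h' : SatisfiesLoopEquations t N q E T) {n k : ℕ}
    (ih : ∀ l : List ℕ, l.sum < n → L (l.map p).prod = T (l.map q).prod) (l : List ℕ) :
    ∀ u : List ℕ, u.sum + l.sum + k < n →
      L ((u.map p).prod * D k (l.map p).prod) = T ((u.map q).prod * E k (l.map q).prod) := by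
  induction l with
  | nil => intro u _; simp
  | cons a l ihl =>
    intro u hu
    simp only [List.sum_cons] at hu
    rw [h.prod_mul_deriv_cons, h'.prod_mul_deriv_cons, map_add, map_add, map_natCast_mul,
      map_natCast_mul, ihl (a :: u) (by simp only [List.sum_cons]; omega),
      ih _ (by simp only [List.sum_cons, List.sum_append]; omega)]

-- The loop equation trades a factor `p (k + 1)` for products of total degree one less.
theorem map_prod_eq (ht : IsLeftRegular t) (h : SatisfiesLoopEquations t N p D L)
    (h' : SatisfiesLoopEquations t N q E T) (h_one : L 1 = T 1) (l : List ℕ) :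
    L (l.map p).prod = T (l.map q).prod := by
  induction hn : l.sum using Nat.strong_induction_on generalizing l with
  | _ n ih =>
    replace ih : ∀ l : List ℕ, l.sum < n → L (l.map p).prod = T (l.map q).prod :=
      fun l hl => ih _ hl l rfl
    induction l with
    | nil => simpa using h_one
    | cons a l ihl =>
      rw [List.sum_cons] at hn
      rcases a with _ | k
      · simp only [List.map_cons, List.prod_cons, h.zero, h'.zero, map_natCast_mul]
        rw [ihl (by omega)]
      · refine ht (?_ : t * _ = t * _)
        simp only [List.map_cons, List.prod_cons]
        rw [h.loop, h'.loop, map_add, map_add, Finset.sum_mul, Finset.sum_mul, map_sum, map_sum]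
        congr 1
        · refine Finset.sum_congr rfl fun j hj => ?_
          have hjk := Finset.mem_range.1 hj
          simpa only [List.map_cons, List.prod_cons, mul_assoc] using
            ih (j :: (k - j) :: l) (by simp only [List.sum_cons]; omega)
        · simpa using
            map_prod_mul_deriv_eq h h' ih l [] (k := k) (by simp only [List.sum_nil]; omega)

end SatisfiesLoopEquations

end LoopEquations

section MatrixLoop

theorem derivation_map_matrix_mul {R S : Type*} [CommRing R] [CommRing S] [Algebra R S]
    {l m n : Type*} [Fintype m] (D : Derivation R S S) (A : Matrix l m S) (B : Matrix m n S) :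
    (A * B).map D = A.map D * B + A * B.map D := by
  ext i j
  simp only [Matrix.map_apply, Matrix.mul_apply, Matrix.add_apply, map_sum, Derivation.leibniz,
    smul_eq_mul, Finset.sum_add_distrib]
  rw [add_comm]
  congr 1
  exact Finset.sum_congr rfl fun x _ => mul_comm _ _

variable {𝕜 m n S : Type*} [Fintype m] [Fintype n] [DecidableEq m]
  [CommRing 𝕜] [CommRing S] [Algebra 𝕜 S] {Z : Matrix m n S} {Y : Matrix n m S}
  {d : m → n → Derivation 𝕜 S S}

/-- The derivation `∑ (Y (Z Y) ^ k) b a • d a b`, where `d a b` stands for the partial derivative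
along the entry `Y b a`; it plays the role of `D k` in the loop equations of the matrix `Z Y`. -/
noncomputable def gramDeriv (Z : Matrix m n S) (Y : Matrix n m S)
    (d : m → n → Derivation 𝕜 S S) (k : ℕ) : Derivation 𝕜 S S :=
  ∑ a, ∑ b, (Y * (Z * Y) ^ k) b a • d a b

theorem gramDeriv_apply (k : ℕ) (f : S) :
    gramDeriv Z Y d k f = ∑ a, ∑ b, (Y * (Z * Y) ^ k) b a * d a b f := by
  simp only [gramDeriv, ← Derivation.coeFnAddMonoidHom_apply, map_sum, Finset.sum_apply]
  simp

variable [DecidableEq n]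

theorem derivation_map_gram_pow (hZ : ∀ a b, Z.map (d a b) = 0)
    (hY : ∀ a b, Y.map (d a b) = Matrix.single b a 1) (a : m) (b : n) (k : ℕ) :
    ((Z * Y) ^ k).map (d a b) =
      ∑ j ∈ Finset.range k, (Z * Y) ^ j * Z * Matrix.single b a (1 : S) *
        (Z * Y) ^ (k - 1 - j) := by
  induction k with
  | zero =>
    ext i j
    simp only [pow_zero, Matrix.map_apply, Matrix.one_apply, Finset.range_zero, Finset.sum_empty,
      Matrix.zero_apply]
    split_ifs <;> simp
  | succ k ih =>
    rw [pow_succ, derivation_map_matrix_mul, ih, derivation_map_matrix_mul, hZ, hY,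
      Finset.sum_range_succ, Finset.sum_mul, Matrix.zero_mul, zero_add]
    congr 1
    · refine Finset.sum_congr rfl fun j hj => ?_
      rw [mul_assoc, ← pow_succ, show k - 1 - j + 1 = k + 1 - 1 - j by
        have := Finset.mem_range.1 hj; omega]
    · simp [Matrix.mul_assoc]

theorem derivation_trace_gram_pow (hZ : ∀ a b, Z.map (d a b) = 0)
    (hY : ∀ a b, Y.map (d a b) = Matrix.single b a 1) (a : m) (b : n) (k : ℕ) :
    d a b (trace ((Z * Y) ^ k)) = k * ((Z * Y) ^ (k - 1) * Z) a b := by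
  have h_trace : d a b (trace ((Z * Y) ^ k)) = trace (((Z * Y) ^ k).map (d a b)) := by
    simp only [Matrix.trace, map_sum, Matrix.diag_apply, Matrix.map_apply]
  have h_term : ∀ j ∈ Finset.range k, trace ((Z * Y) ^ j * Z * Matrix.single b a (1 : S) *
      (Z * Y) ^ (k - 1 - j)) = ((Z * Y) ^ (k - 1) * Z) a b := by
    intro j hj
    rw [Matrix.trace_mul_comm, ← Matrix.mul_assoc, ← Matrix.mul_assoc, ← pow_add,
      Matrix.trace_mul_single, show k - 1 - j + j = k - 1 by
        have := Finset.mem_range.1 hj; omega]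
    simp only [MulOpposite.op_one, one_smul]
  rw [h_trace, derivation_map_gram_pow hZ hY, Matrix.trace_sum, Finset.sum_congr rfl h_term,
    Finset.sum_const, Finset.card_range, nsmul_eq_mul]

theorem gramDeriv_trace (hZ : ∀ a b, Z.map (d a b) = 0)
    (hY : ∀ a b, Y.map (d a b) = Matrix.single b a 1) (k r : ℕ) :
    gramDeriv Z Y d k (trace ((Z * Y) ^ r)) = r * trace ((Z * Y) ^ (r + k)) := by
  rcases r with _ | r
  · simp
  have h_split : trace ((Z * Y) ^ (r + 1 + k)) =
      trace (((Z * Y) ^ r * Z) * (Y * (Z * Y) ^ k)) := by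
    rw [show r + 1 + k = r + (1 + k) by ring, pow_add, pow_add, pow_one]
    simp only [Matrix.mul_assoc]
  rw [h_split, gramDeriv_apply]
  simp only [derivation_trace_gram_pow hZ hY]
  simp only [Matrix.trace, Matrix.diag_apply, Matrix.mul_apply (M := (Z * Y) ^ r * Z),
    Finset.mul_sum]
  refine Finset.sum_congr rfl fun a _ => Finset.sum_congr rfl fun b _ => ?_
  rw [Nat.add_sub_cancel]
  ring

theorem derivation_mul_gram_pow_apply (hZ : ∀ a b, Z.map (d a b) = 0)
    (hY : ∀ a b, Y.map (d a b) = Matrix.single b a 1) (a : m) (b : n) (k : ℕ) :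
    d a b ((Y * (Z * Y) ^ k) b a) = ((Z * Y) ^ k) a a +
      ∑ j ∈ Finset.range k, (Y * ((Z * Y) ^ j * Z)) b b * ((Z * Y) ^ (k - 1 - j)) a a := by
  rw [← Matrix.map_apply (f := d a b), derivation_map_matrix_mul, hY,
    derivation_map_gram_pow hZ hY, Matrix.add_apply, Matrix.mul_sum, Matrix.sum_apply]
  congr 1
  · simp
  · refine Finset.sum_congr rfl fun j _ => ?_
    rw [← Matrix.mul_assoc, ← Matrix.mul_assoc, Matrix.mul_apply, Finset.sum_eq_single a]
    · simp
    · intro c _ hc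
      rw [Matrix.mul_single_apply_of_ne _ _ _ _ _ hc, zero_mul]
    · simp

theorem sum_derivation_mul_gram_pow (hmn : Fintype.card n = Fintype.card m)
    (hZ : ∀ a b, Z.map (d a b) = 0) (hY : ∀ a b, Y.map (d a b) = Matrix.single b a 1) (k : ℕ) :
    ∑ a : m, ∑ b : n, d a b ((Y * (Z * Y) ^ k) b a) =
      ∑ j ∈ Finset.range (k + 1), trace ((Z * Y) ^ j) * trace ((Z * Y) ^ (k - j)) := by
  simp only [derivation_mul_gram_pow_apply hZ hY, Finset.sum_add_distrib]
  rw [Finset.sum_range_succ', add_comm]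
  congr 1
  · rw [Finset.sum_congr rfl fun a _ => Finset.sum_comm, Finset.sum_comm]
    refine Finset.sum_congr rfl fun j _ => ?_
    rw [pow_succ, show trace ((Z * Y) ^ j * (Z * Y)) = trace (Y * ((Z * Y) ^ j * Z)) by
        rw [Matrix.trace_mul_comm Y]; simp only [Matrix.mul_assoc],
      show k - (j + 1) = k - 1 - j by omega]
    simp only [Matrix.trace, Matrix.diag_apply, Finset.sum_mul, Finset.mul_sum]
  · simp [Matrix.trace, Finset.sum_const, hmn, Finset.mul_sum]

-- `hL` is Gaussian integration by parts: `Z` is the conjugate of `Y`, and `d a b` is `∂/∂(Y b a)`.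
theorem satisfiesLoopEquations_gram (hmn : Fintype.card n = Fintype.card m) {t : 𝕜}
    (hZ : ∀ a b, Z.map (d a b) = 0) (hY : ∀ a b, Y.map (d a b) = Matrix.single b a 1)
    (L : S →ₗ[𝕜] 𝕜) (hL : ∀ a b f, t * L (Z a b * f) = L (d a b f)) :
    SatisfiesLoopEquations t (Fintype.card m) (fun k => trace ((Z * Y) ^ k))
      (gramDeriv Z Y d) L where
  zero := by simp
  deriv k r := gramDeriv_trace hZ hY k r
  loop k f := by
    have h_expand : trace ((Z * Y) ^ (k + 1)) * f = ∑ a, ∑ b, Z a b *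
        ((Y * (Z * Y) ^ k) b a * f) := by
      rw [pow_succ', Matrix.mul_assoc]
      simp only [Matrix.trace, Matrix.diag_apply,
        Matrix.mul_apply (M := Z), Finset.sum_mul, mul_assoc]
    simp only [h_expand, map_sum, Finset.mul_sum, hL, Derivation.leibniz, smul_eq_mul]
    simp only [map_add, Finset.sum_add_distrib, ← map_sum, ← Finset.mul_sum, ← gramDeriv_apply]
    rw [sum_derivation_mul_gram_pow hmn hZ hY, mul_comm f, add_comm]

end MatrixLoop

section LaguerreLoop

open MvPolynomial

theorem derivation_prod_of_dvd {R S ι : Type*} [CommRing R] [CommRing S] [Algebra R S]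
    (D : Derivation R S S) (s : Finset ι) (f h : ι → S) (hf : ∀ i ∈ s, D (f i) = f i * h i) :
    D (∏ i ∈ s, f i) = (∏ i ∈ s, f i) * ∑ i ∈ s, h i := by
  classical
  induction s using Finset.induction_on with
  | empty => simp
  | insert a s ha ih =>
    rw [Finset.prod_insert ha, Finset.sum_insert ha, Derivation.leibniz,
      ih fun i hi => hf i (Finset.mem_insert_of_mem hi), hf a (Finset.mem_insert_self _ _),
      smul_eq_mul, smul_eq_mul]
    ring

theorem sum_sum_eq_two_mul_sum_Ioi_add {ι S : Type*} [Fintype ι] [LinearOrder ι]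
    [LocallyFiniteOrderTop ι] [LocallyFiniteOrderBot ι] [CommSemiring S] (h : ι → ι → S)
    (hsymm : ∀ i j, h i j = h j i) :
    ∑ i, ∑ j, h i j = 2 * (∑ i, ∑ j ∈ Finset.Ioi i, h i j) + ∑ i, h i i := by
  have h_split : ∀ i, ∑ j, h i j =
      ∑ j ∈ Finset.Ioi i, h i j + ∑ j ∈ Finset.Iio i, h i j + h i i := by
    intro i
    have h_disjoint : Disjoint (Finset.Ioi i) (Finset.Iio i) :=
      Finset.disjoint_left.2 fun j hj hj' =>
        lt_asymm (Finset.mem_Ioi.1 hj) (Finset.mem_Iio.1 hj')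
    rw [← Finset.sum_union h_disjoint, ← Finset.sum_erase_add _ _ (Finset.mem_univ i)]
    congr 2
    ext j
    simp only [Finset.mem_erase, Finset.mem_univ, and_true, Finset.mem_union, Finset.mem_Ioi,
      Finset.mem_Iio, ne_iff_lt_or_gt, or_comm]
  have h_reflect : ∑ i, ∑ j ∈ Finset.Iio i, h i j = ∑ i, ∑ j ∈ Finset.Ioi i, h i j := by
    rw [Finset.sum_comm' (t' := Finset.univ) (s' := fun j => Finset.Ioi j)
      (by intro x y; simp)]
    exact Finset.sum_congr rfl fun i _ => Finset.sum_congr rfl fun j _ => hsymm _ _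
  rw [Finset.sum_congr rfl fun i _ => h_split i, Finset.sum_add_distrib, Finset.sum_add_distrib,
    h_reflect, two_mul]

variable {N : ℕ} {R : Type*} [CommRing R]

variable (N R) in
/-- The Vandermonde product `∏_{i < j} (X j - X i)` of the variables. -/
noncomputable def vandermondePoly : MvPolynomial (Fin N) R :=
  ∏ i, ∏ j ∈ Finset.Ioi i, (X j - X i)

variable (N R) in
/-- The derivation `∑ X i ^ (k + 1) ∂ᵢ`, which raises power sums by `k` degrees. -/
noncomputable def powDeriv (k : ℕ) :
    Derivation R (MvPolynomial (Fin N) R) (MvPolynomial (Fin N) R) :=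
  ∑ i, (X i : MvPolynomial (Fin N) R) ^ (k + 1) • pderiv i

theorem powDeriv_apply (k : ℕ) (f : MvPolynomial (Fin N) R) :
    powDeriv N R k f = ∑ i, X i ^ (k + 1) * pderiv i f := by
  simp only [powDeriv, ← Derivation.coeFnAddMonoidHom_apply, map_sum, Finset.sum_apply]
  simp

theorem powDeriv_X (k : ℕ) (i : Fin N) : powDeriv N R k (X i) = X i ^ (k + 1) := by
  rw [powDeriv_apply, Finset.sum_eq_single i]
  · simp
  · intro j _ hj
    simp [pderiv_X_of_ne hj.symm]
  · simp

theorem powDeriv_psum (k r : ℕ) :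
    powDeriv N R k (psum (Fin N) R r) = (r : MvPolynomial (Fin N) R) * psum (Fin N) R (r + k) := by
  rw [psum, psum, map_sum, Finset.mul_sum]
  refine Finset.sum_congr rfl fun i _ => ?_
  rw [Derivation.leibniz_pow, powDeriv_X]
  rcases r with _ | r
  · simp
  · simp only [smul_eq_mul, Nat.add_sub_cancel, nsmul_eq_mul]
    ring

/-- The divided difference `(X j ^ (k + 1) - X i ^ (k + 1)) / (X j - X i)`. -/
noncomputable def powQuotient (R : Type*) [CommRing R] (k : ℕ) (i j : Fin N) :
    MvPolynomial (Fin N) R :=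
  ∑ r ∈ Finset.range (k + 1), X j ^ r * X i ^ (k - r)

theorem powQuotient_comm (k : ℕ) (i j : Fin N) : powQuotient R k i j = powQuotient R k j i := by
  rw [powQuotient, ← Finset.sum_range_reflect]
  refine Finset.sum_congr rfl fun r hr => ?_
  have := Finset.mem_range.1 hr
  rw [mul_comm, show k + 1 - 1 - r = k - r by omega, show k - (k - r) = r by omega]

theorem powQuotient_self (k : ℕ) (i : Fin N) :
    powQuotient R k i i = ((k + 1 : ℕ) : MvPolynomial (Fin N) R) * X i ^ k := by
  have h_term : ∀ r ∈ Finset.range (k + 1),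
      (X i : MvPolynomial (Fin N) R) ^ r * X i ^ (k - r) = X i ^ k := fun r hr => by
    rw [← pow_add, Nat.add_sub_cancel' (Nat.lt_succ_iff.1 (Finset.mem_range.1 hr))]
  rw [powQuotient, Finset.sum_congr rfl h_term, Finset.sum_const, Finset.card_range, nsmul_eq_mul]

theorem powDeriv_vandermondePoly (k : ℕ) :
    powDeriv N R k (vandermondePoly N R) = vandermondePoly N R *
      ∑ i, ∑ j ∈ Finset.Ioi i, powQuotient R k i j := by
  refine derivation_prod_of_dvd _ _ _ _ fun i _ => derivation_prod_of_dvd _ _ _ _ fun j _ => ?_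
  rw [map_sub, powDeriv_X, powDeriv_X, mul_comm]
  exact (Commute.geom_sum₂_mul (Commute.all _ _) (k + 1)).symm

theorem sum_psum_mul_psum (k : ℕ) :
    ∑ j ∈ Finset.range (k + 1), psum (Fin N) R j * psum (Fin N) R (k - j) =
      2 * (∑ i : Fin N, ∑ j ∈ Finset.Ioi i, powQuotient R k i j) +
      ((k + 1 : ℕ) : MvPolynomial (Fin N) R) * psum (Fin N) R k := by
  have h_pairs : ∑ j ∈ Finset.range (k + 1), psum (Fin N) R j * psum (Fin N) R (k - j) =
      ∑ i, ∑ j, powQuotient R k i j := by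
    simp only [powQuotient, psum, Finset.sum_mul_sum]
    rw [Finset.sum_comm, Finset.sum_congr rfl fun i _ => Finset.sum_comm, Finset.sum_comm]
  rw [h_pairs, sum_sum_eq_two_mul_sum_Ioi_add _ (powQuotient_comm k)]
  simp only [powQuotient_self, ← Finset.mul_sum, psum]

-- `hL` is integration by parts against the weight `exp (-t x)` on the positive half-line.
theorem satisfiesLoopEquations_laguerre {t : R} (L : MvPolynomial (Fin N) R →ₗ[R] R)
    (hL : ∀ i f, t * L (X i * f) = L (pderiv i (X i * f))) :
    SatisfiesLoopEquations t N (psum (Fin N) R) (powDeriv N R)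
      (L ∘ₗ LinearMap.mulRight R (vandermondePoly N R ^ 2)) where
  zero := by simp
  deriv k r := powDeriv_psum k r
  loop k f := by
    simp only [LinearMap.comp_apply, LinearMap.mulRight_apply]
    set g := f * vandermondePoly N R ^ 2 with hg
    have h_expand : psum (Fin N) R (k + 1) * f * vandermondePoly N R ^ 2 =
        ∑ i, X i * (X i ^ k * g) := by
      rw [psum, mul_assoc, ← hg, Finset.sum_mul]
      exact Finset.sum_congr rfl fun i _ => by ring
    have h_deriv : ∀ i : Fin N, pderiv i (X i * (X i ^ k * g)) =
        ((k + 1 : ℕ) : MvPolynomial (Fin N) R) * X i ^ k * g + X i ^ (k + 1) * pderiv i g := by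
      intro i
      rw [← mul_assoc, ← pow_succ', Derivation.leibniz, Derivation.leibniz_pow, pderiv_X_self]
      simp only [smul_eq_mul, nsmul_eq_mul, Nat.add_sub_cancel]
      ring
    rw [h_expand, map_sum, Finset.mul_sum, Finset.sum_congr rfl fun i _ => hL i _, ← map_sum]
    congr 1
    rw [Finset.sum_congr rfl fun i _ => h_deriv i, Finset.sum_add_distrib, ← powDeriv_apply,
      ← Finset.sum_mul, ← Finset.mul_sum, ← psum, sum_psum_mul_psum, hg, Derivation.leibniz,
      Derivation.leibniz_pow, powDeriv_vandermondePoly]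
    simp only [smul_eq_mul, nsmul_eq_mul]
    push_cast
    ring

end LaguerreLoop

section ComplexGaussian

theorem gaussianPDF_zero_half (x : ℝ) : gaussianPDF 0 (1 / 2) x =
    ENNReal.ofReal ((√Real.pi)⁻¹ * Real.exp (-x ^ 2)) := by
  rw [gaussianPDF, gaussianPDFReal]
  rw [show (2 * Real.pi * ((1 / 2 : NNReal) : ℝ)) = Real.pi by push_cast; ring]
  congr 3
  simp

theorem stdComplexGaussian_eq_withDensity :
    stdComplexGaussian =
      volume.withDensity (fun z : ℂ => ENNReal.ofReal (Real.pi⁻¹ * Real.exp (-‖z‖ ^ 2))) := by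
  have h_meas : Measurable (fun p : ℝ × ℝ => (⟨p.1, p.2⟩ : ℂ)) :=
    Complex.measurableEquivRealProd.symm.measurable
  refine Measure.ext_of_lintegral _ fun f hf => ?_
  rw [stdComplexGaussian, lintegral_map hf h_meas, gaussianReal_of_var_ne_zero _ (by simp),
    prod_withDensity (measurable_gaussianPDF _ _) (measurable_gaussianPDF _ _),
    lintegral_withDensity_eq_lintegral_mul _ (by fun_prop) (by fun_prop),
    lintegral_withDensity_eq_lintegral_mul _ (by fun_prop) hf, ← Measure.volume_eq_prod,
    ← Complex.volume_preserving_equiv_real_prod.symm.lintegral_comp_emb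
      Complex.measurableEquivRealProd.symm.measurableEmbedding]
  refine lintegral_congr fun p => ?_
  simp only [Pi.mul_apply, gaussianPDF_zero_half, Complex.measurableEquivRealProd_symm_apply]
  rw [← ENNReal.ofReal_mul (by positivity)]
  congr 2
  have h_norm : ‖(⟨p.1, p.2⟩ : ℂ)‖ ^ 2 = p.1 ^ 2 + p.2 ^ 2 := by
    rw [← Complex.normSq_eq_norm_sq, Complex.normSq_mk]; ring
  have h_pi : Real.pi⁻¹ = (√Real.pi)⁻¹ * (√Real.pi)⁻¹ := by
    rw [← mul_inv, Real.mul_self_sqrt Real.pi_pos.le]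
  rw [h_norm, h_pi, neg_add, Real.exp_add]
  ring

instance : IsProbabilityMeasure stdComplexGaussian := by
  rw [stdComplexGaussian]
  exact Measure.isProbabilityMeasure_map
    (Complex.measurableEquivRealProd.symm.measurable).aemeasurable

theorem integral_stdComplexGaussian {E : Type*} [NormedAddCommGroup E] [NormedSpace ℝ E]
    (f : ℂ → E) : ∫ z, f z ∂stdComplexGaussian =
      ∫ z : ℂ, (Real.pi⁻¹ * Real.exp (-‖z‖ ^ 2)) • f z := by
  rw [stdComplexGaussian_eq_withDensity,
    integral_withDensity_eq_integral_toReal_smul (by fun_prop) (by simp)]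
  refine integral_congr_ae (.of_forall fun z => ?_)
  simp only
  rw [ENNReal.toReal_ofReal (by positivity)]

theorem integral_norm_pow_mul_exp_stdComplexGaussian {b : ℝ} (hb : 0 ≤ b) (a : ℕ) :
    ∫ z : ℂ, ‖z‖ ^ (2 * a) * Real.exp (-b * ‖z‖ ^ 2) ∂stdComplexGaussian =
      a.factorial / (1 + b) ^ (a + 1) := by
  have h_gamma := Complex.integral_rpow_mul_exp_neg_mul_rpow (p := 2) (q := (2 * a : ℕ))
    (b := 1 + b) (by norm_num)
    ((neg_lt_zero.2 two_pos).trans_le (Nat.cast_nonneg _)) (by positivity)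
  rw [show ((2 * a : ℕ) + 2 : ℝ) / 2 = a + 1 by push_cast; ring,
    show (-((2 * a : ℕ) + 2 : ℝ)) / 2 = -((a + 1 : ℕ) : ℝ) by push_cast; ring,
    Real.Gamma_nat_eq_factorial, Real.rpow_neg (by positivity), Real.rpow_natCast] at h_gamma
  rw [integral_stdComplexGaussian]
  calc _ = ∫ z : ℂ, Real.pi⁻¹ * (‖z‖ ^ ((2 * a : ℕ) : ℝ) *
        Real.exp (-(1 + b) * ‖z‖ ^ (2 : ℝ))) := by
        refine integral_congr_ae (.of_forall fun z => ?_)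
        simp only [smul_eq_mul]
        rw [Real.rpow_natCast, Real.rpow_two,
          show -(1 + b) * ‖z‖ ^ 2 = -‖z‖ ^ 2 + -b * ‖z‖ ^ 2 by ring, Real.exp_add]
        ring
    _ = _ := by
        rw [integral_const_mul, h_gamma]
        field_simp

theorem integrable_norm_pow_mul_exp_stdComplexGaussian {b : ℝ} (hb : 0 ≤ b) (a : ℕ) :
    Integrable (fun z : ℂ => ‖z‖ ^ a * Real.exp (-b * ‖z‖ ^ 2)) stdComplexGaussian := by
  have h_even : ∀ c : ℕ, Integrable (fun z : ℂ => ‖z‖ ^ (2 * c) * Real.exp (-b * ‖z‖ ^ 2))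
      stdComplexGaussian := fun c => .of_integral_ne_zero (by
    rw [integral_norm_pow_mul_exp_stdComplexGaussian hb]; positivity)
  refine Integrable.mono' ((h_even 0).add (h_even a)) (by fun_prop) (.of_forall fun z => ?_)
  rw [Real.norm_of_nonneg (by positivity)]
  simp only [Pi.add_apply, mul_zero, pow_zero, ← add_mul]
  gcongr
  rcases le_total ‖z‖ 1 with hz | hz
  · have := pow_le_one₀ (n := a) (norm_nonneg z) hz
    have : 0 ≤ ‖z‖ ^ (2 * a) := by positivity
    linarith
  · have := pow_le_pow_right₀ hz (show a ≤ 2 * a by omega)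
    linarith

/-- The mixed moment `E[z ^ α * conj z ^ β * exp (-b |z|²)]` of a standard complex Gaussian; the
damping factor makes these moments separate measures. -/
noncomputable def mixedMoment (b α β : ℕ) : ℂ :=
  ∫ z : ℂ, z ^ α * (starRingEnd ℂ z) ^ β * (Real.exp (-b * ‖z‖ ^ 2) : ℂ) ∂stdComplexGaussian

theorem integrable_mixedMoment (b α β : ℕ) :
    Integrable (fun z : ℂ => z ^ α * (starRingEnd ℂ z) ^ β * (Real.exp (-b * ‖z‖ ^ 2) : ℂ))
      stdComplexGaussian := by
  refine (integrable_norm_pow_mul_exp_stdComplexGaussian b.cast_nonneg (α + β)).mono' ?_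
    (.of_forall fun z => ?_)
  · exact (by fun_prop : Continuous fun z : ℂ => z ^ α * (starRingEnd ℂ z) ^ β *
      (Real.exp (-b * ‖z‖ ^ 2) : ℂ)).aestronglyMeasurable
  · rw [norm_mul, norm_mul, norm_pow, norm_pow, RCLike.norm_conj, Complex.norm_real,
      Real.norm_of_nonneg (Real.exp_pos _).le, pow_add]

theorem mixedMoment_self (b a : ℕ) :
    mixedMoment b a a = a.factorial / (1 + b : ℂ) ^ (a + 1) := by
  have h_ofReal : mixedMoment b a a =
      ((∫ z : ℂ, ‖z‖ ^ (2 * a) * Real.exp (-b * ‖z‖ ^ 2) ∂stdComplexGaussian : ℝ) : ℂ) := by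
    rw [mixedMoment, ← integral_complex_ofReal]
    refine integral_congr_ae (.of_forall fun z => ?_)
    simp only
    rw [← mul_pow, Complex.mul_conj', ← pow_mul]
    push_cast
    rfl
  rw [h_ofReal, integral_norm_pow_mul_exp_stdComplexGaussian b.cast_nonneg]
  push_cast
  rfl

-- The Gaussian is invariant under the rotation by `π / (α - β)`, which changes the sign of
-- `z ^ α * conj z ^ β`.
theorem mixedMoment_of_ne (b : ℕ) {α β : ℕ} (h : α ≠ β) : mixedMoment b α β = 0 := by
  set f : ℂ → ℂ := fun z => ((Real.pi⁻¹ * Real.exp (-‖z‖ ^ 2) : ℝ) : ℂ) * (z ^ α *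
    (starRingEnd ℂ z) ^ β * (Real.exp (-b * ‖z‖ ^ 2) : ℂ)) with hf
  have h_integral : mixedMoment b α β = ∫ z, f z := by
    rw [mixedMoment, integral_stdComplexGaussian]
    simp only [hf, Complex.real_smul]
  have h_sub : ((α : ℂ) - β) ≠ 0 := sub_ne_zero.2 (by exact_mod_cast h)
  set c : Circle := Circle.exp (Real.pi / (α - β)) with hc
  have h_sign : (c : ℂ) ^ α * (starRingEnd ℂ (c : ℂ)) ^ β = -1 := by
    rw [hc, Circle.coe_exp, ← Complex.exp_conj, ← Complex.exp_nat_mul, ← Complex.exp_nat_mul,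
      ← Complex.exp_add, ← Complex.exp_pi_mul_I]
    congr 1
    simp only [map_mul, Complex.conj_ofReal, Complex.conj_I]
    push_cast
    field_simp
    ring
  have h_rotation : ∀ z, f (rotation c z) = -f z := by
    intro z
    simp only [hf, (rotation c).norm_map z]
    simp only [rotation_apply, map_mul, mul_pow]
    linear_combination (((Real.pi⁻¹ * Real.exp (-‖z‖ ^ 2) : ℝ) : ℂ) * z ^ α *
      (starRingEnd ℂ z) ^ β * (Real.exp (-b * ‖z‖ ^ 2) : ℂ)) * h_sign
  have h_neg : ∫ z, f z = -∫ z, f z := by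
    conv_lhs => rw [← (rotation c).measurePreserving.integral_comp
      (rotation c).toHomeomorph.measurableEmbedding]
    simp only [h_rotation, integral_neg]
  rw [h_integral]
  exact self_eq_neg.1 h_neg

theorem mixedMoment_succ (b α β : ℕ) :
    (1 + b : ℂ) * mixedMoment b (α + 1) β = β * mixedMoment b α (β - 1) := by
  have hb : (1 + b : ℂ) ≠ 0 := by
    have : ((1 + b : ℕ) : ℂ) ≠ 0 := Nat.cast_ne_zero.2 (by omega)
    exact_mod_cast this
  rcases β with _ | β
  · rw [mixedMoment_of_ne b (by omega)]; simp
  · by_cases h : α = β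
    · subst h
      rw [Nat.add_sub_cancel, mixedMoment_self, mixedMoment_self, Nat.factorial_succ]
      push_cast
      field_simp
      ring
    · rw [Nat.add_sub_cancel, mixedMoment_of_ne b (by omega), mixedMoment_of_ne b h]; simp

end ComplexGaussian

section GaussianFunctional

open MvPolynomial

variable {ι : Type*} [Fintype ι]

variable (ι) in
/-- The law of a family of independent standard complex Gaussians. -/
noncomputable abbrev gaussPi : Measure (ι → ℂ) := Measure.pi fun _ : ι => stdComplexGaussian

/-- The value at `z` of a polynomial in the variables `z i` (left summand of `ι ⊕ ι`) and their
conjugates (right summand). -/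
noncomputable def conjEval (z : ι → ℂ) (f : MvPolynomial (ι ⊕ ι) ℂ) : ℂ :=
  eval (Sum.elim z fun i => starRingEnd ℂ (z i)) f

theorem conjEval_monomial (b : ℕ) (z : ι → ℂ) (s : ι ⊕ ι →₀ ℕ) (c : ℂ) :
    conjEval z (monomial s c) * (Real.exp (-b * ∑ i, ‖z i‖ ^ 2) : ℂ) =
      c * ∏ i, (z i ^ s (Sum.inl i) * (starRingEnd ℂ (z i)) ^ s (Sum.inr i) *
        (Real.exp (-b * ‖z i‖ ^ 2) : ℂ)) := by
  rw [conjEval, eval_monomial, Finsupp.prod_fintype _ _ (by simp),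
    Fintype.prod_sum_type, Finset.mul_sum, Real.exp_sum, Finset.prod_mul_distrib,
    Finset.prod_mul_distrib]
  push_cast
  simp [mul_assoc]

theorem integrable_conjEval (b : ℕ) (f : MvPolynomial (ι ⊕ ι) ℂ) :
    Integrable (fun z : ι → ℂ => conjEval z f * (Real.exp (-b * ∑ i, ‖z i‖ ^ 2) : ℂ))
      (gaussPi ι) := by
  induction f using MvPolynomial.induction_on' with
  | monomial s c =>
    simp only [conjEval_monomial]
    refine Integrable.const_mul ?_ c
    exact Integrable.fintype_prod (f := fun i z => z ^ s (Sum.inl i) *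
      (starRingEnd ℂ z) ^ s (Sum.inr i) * (Real.exp (-b * ‖z‖ ^ 2) : ℂ))
      fun i => integrable_mixedMoment b _ _
  | add p q hp hq =>
    refine (hp.add hq).congr (.of_forall fun z => ?_)
    simp [conjEval, add_mul]

/-- The functional `f ↦ E[f(z, conj z) * exp (-b ∑ |z i|²)]` on polynomials, for independent
standard complex Gaussians `z i`. -/
noncomputable def gaussFunctional (ι : Type*) [Fintype ι] (b : ℕ) :
    MvPolynomial (ι ⊕ ι) ℂ →ₗ[ℂ] ℂ where
  toFun f := ∫ z, conjEval z f * (Real.exp (-b * ∑ i, ‖z i‖ ^ 2) : ℂ) ∂gaussPi ι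
  map_add' f g := by
    rw [← integral_add (integrable_conjEval b f) (integrable_conjEval b g)]
    simp [conjEval, add_mul]
  map_smul' c f := by
    rw [RingHom.id_apply, smul_eq_mul, ← integral_const_mul]
    simp [conjEval, mul_assoc, smul_eval]

theorem gaussFunctional_monomial (b : ℕ) (s : ι ⊕ ι →₀ ℕ) (c : ℂ) :
    gaussFunctional ι b (monomial s c) =
      c * ∏ i, mixedMoment b (s (Sum.inl i)) (s (Sum.inr i)) := by
  simp only [gaussFunctional, LinearMap.coe_mk, AddHom.coe_mk, conjEval_monomial]
  rw [integral_const_mul, integral_fintype_prod_eq_prod (f := fun i z => z ^ s (Sum.inl i) *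
      (starRingEnd ℂ z) ^ s (Sum.inr i) * (Real.exp (-b * ‖z‖ ^ 2) : ℂ))]
  rfl

theorem gaussFunctional_one (b : ℕ) :
    gaussFunctional ι b 1 = ((1 + b : ℂ)⁻¹) ^ Fintype.card ι := by
  rw [← C_1, ← monomial_zero', gaussFunctional_monomial]
  simp [mixedMoment_self]

theorem gaussFunctional_X_mul (b : ℕ) (i : ι) (f : MvPolynomial (ι ⊕ ι) ℂ) :
    (1 + b : ℂ) * gaussFunctional ι b (X (Sum.inl i) * f) =
      gaussFunctional ι b (pderiv (Sum.inr i) f) := by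
  classical
  induction f using MvPolynomial.induction_on' with
  | add p q hp hq => rw [mul_add, map_add, map_add, map_add, mul_add, hp, hq]
  | monomial s c =>
    let raised : ι ⊕ ι →₀ ℕ := s + Finsupp.single (Sum.inl i) 1
    let lowered : ι ⊕ ι →₀ ℕ := s - Finsupp.single (Sum.inr i) 1
    have h_others : ∏ j ∈ Finset.univ.erase i,
          mixedMoment b (raised (Sum.inl j)) (raised (Sum.inr j)) =
        ∏ j ∈ Finset.univ.erase i,
          mixedMoment b (lowered (Sum.inl j)) (lowered (Sum.inr j)) := by
      refine Finset.prod_congr rfl fun j hj => ?_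
      simp [raised, lowered, (Finset.ne_of_mem_erase hj).symm]
    rw [mul_comm (X _), show monomial s c * X (Sum.inl i) = monomial raised c by
        rw [monomial_add_single, pow_one], pderiv_monomial, gaussFunctional_monomial,
      gaussFunctional_monomial, ← Finset.mul_prod_erase _ _ (Finset.mem_univ i), h_others,
      ← Finset.mul_prod_erase (a := i) (s := Finset.univ)
        (f := fun j => mixedMoment b (lowered (Sum.inl j)) _) (Finset.mem_univ i)]
    rw [show raised (Sum.inl i) = s (Sum.inl i) + 1 by simp [raised],
      show raised (Sum.inr i) = s (Sum.inr i) by simp [raised],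
      show lowered (Sum.inl i) = s (Sum.inl i) by simp [lowered],
      show lowered (Sum.inr i) = s (Sum.inr i) - 1 by simp [lowered]]
    linear_combination c * (∏ j ∈ Finset.univ.erase i,
      mixedMoment b (lowered (Sum.inl j)) (lowered (Sum.inr j))) *
        mixedMoment_succ b (s (Sum.inl i)) (s (Sum.inr i))

end GaussianFunctional

section LaguerreFunctional

open MvPolynomial

theorem integral_pow_mul_exp_Ioi {t : ℝ} (ht : 0 < t) (a : ℕ) :
    ∫ x in Set.Ioi (0 : ℝ), x ^ a * Real.exp (-t * x) = a.factorial / t ^ (a + 1) := by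
  have h_gamma := Real.integral_rpow_mul_exp_neg_mul_Ioi (a := a + 1) (r := t) (by positivity) ht
  rw [Real.Gamma_nat_eq_factorial] at h_gamma
  have h_rpow : ((1 / t) ^ ((a : ℝ) + 1)) = 1 / t ^ (a + 1) := by
    rw [← Nat.cast_add_one, Real.rpow_natCast, div_pow, one_pow]
  rw [h_rpow] at h_gamma
  calc _ = ∫ x in Set.Ioi (0 : ℝ), x ^ ((a : ℝ) + 1 - 1) * Real.exp (-(t * x)) := by
        refine setIntegral_congr_fun measurableSet_Ioi fun x _ => ?_
        simp only [add_sub_cancel_right, Real.rpow_natCast, neg_mul]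
    _ = _ := by rw [h_gamma]; ring

theorem integral_ofReal_pow_mul_exp_Ioi {t : ℝ} (ht : 0 < t) (a : ℕ) :
    ∫ x in Set.Ioi (0 : ℝ), (x : ℂ) ^ a * (Real.exp (-t * x) : ℂ) =
      a.factorial / (t : ℂ) ^ (a + 1) := by
  have := congrArg ((↑) : ℝ → ℂ) (integral_pow_mul_exp_Ioi ht a)
  rw [← integral_complex_ofReal] at this
  push_cast at this ⊢
  exact this

theorem integrable_ofReal_pow_mul_exp_Ioi {t : ℝ} (ht : 0 < t) (a : ℕ) :
    Integrable (fun x : ℝ => (x : ℂ) ^ a * (Real.exp (-t * x) : ℂ))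
      (volume.restrict (Set.Ioi 0)) := by
  refine .of_integral_ne_zero ?_
  rw [integral_ofReal_pow_mul_exp_Ioi ht]
  have : (t : ℂ) ≠ 0 := by exact_mod_cast ht.ne'
  have : (a.factorial : ℂ) ≠ 0 := by exact_mod_cast a.factorial_ne_zero
  positivity

/-- Lebesgue measure on the open positive orthant. -/
noncomputable abbrev orthant (ι : Type*) [Fintype ι] : Measure (ι → ℝ) :=
  Measure.pi fun _ => volume.restrict (Set.Ioi 0)

variable {N : ℕ}

/-- The value of a complex polynomial at a real point. -/
noncomputable def realEval (x : Fin N → ℝ) (f : MvPolynomial (Fin N) ℂ) : ℂ :=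
  eval (fun i => (x i : ℂ)) f

theorem realEval_monomial (t : ℝ) (x : Fin N → ℝ) (s : Fin N →₀ ℕ) (c : ℂ) :
    realEval x (monomial s c) * (Real.exp (-t * ∑ i, x i) : ℂ) =
      c * ∏ i, ((x i : ℂ) ^ s i * (Real.exp (-t * x i) : ℂ)) := by
  rw [realEval, eval_monomial, Finsupp.prod_fintype _ _ (by simp),
    Finset.mul_sum, Real.exp_sum, Finset.prod_mul_distrib]
  push_cast
  simp [mul_assoc]

theorem integrable_realEval {t : ℝ} (ht : 0 < t) (f : MvPolynomial (Fin N) ℂ) :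
    Integrable (fun x : Fin N → ℝ => realEval x f * (Real.exp (-t * ∑ i, x i) : ℂ))
      (orthant (Fin N)) := by
  induction f using MvPolynomial.induction_on' with
  | monomial s c =>
    simp only [realEval_monomial]
    refine Integrable.const_mul ?_ c
    exact Integrable.fintype_prod (f := fun i (x : ℝ) => (x : ℂ) ^ s i *
      (Real.exp (-t * x) : ℂ)) fun i => integrable_ofReal_pow_mul_exp_Ioi ht _
  | add p q hp hq =>
    refine (hp.add hq).congr (.of_forall fun z => ?_)
    simp [realEval, add_mul]

/-- Integration against `exp (-t ∑ x i)` over the positive orthant. -/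
noncomputable def expFunctional (N : ℕ) {t : ℝ} (ht : 0 < t) :
    MvPolynomial (Fin N) ℂ →ₗ[ℂ] ℂ where
  toFun f := ∫ x, realEval x f * (Real.exp (-t * ∑ i, x i) : ℂ) ∂orthant (Fin N)
  map_add' f g := by
    rw [← integral_add (integrable_realEval ht f) (integrable_realEval ht g)]
    simp [realEval, add_mul]
  map_smul' c f := by
    rw [RingHom.id_apply, smul_eq_mul, ← integral_const_mul]
    simp [realEval, mul_assoc, smul_eval]

theorem expFunctional_monomial {t : ℝ} (ht : 0 < t) (s : Fin N →₀ ℕ) (c : ℂ) :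
    expFunctional N ht (monomial s c) =
      c * ∏ i, ((s i).factorial / (t : ℂ) ^ (s i + 1)) := by
  simp only [expFunctional, LinearMap.coe_mk, AddHom.coe_mk, realEval_monomial]
  rw [integral_const_mul, integral_fintype_prod_eq_prod (f := fun i (x : ℝ) => (x : ℂ) ^ s i *
      (Real.exp (-t * x) : ℂ))]
  simp only [integral_ofReal_pow_mul_exp_Ioi ht]

theorem expFunctional_X_mul {t : ℝ} (ht : 0 < t) (i : Fin N) (f : MvPolynomial (Fin N) ℂ) :
    (t : ℂ) * expFunctional N ht (X i * f) = expFunctional N ht (pderiv i (X i * f)) := by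
  have ht' : (t : ℂ) ≠ 0 := by exact_mod_cast ht.ne'
  induction f using MvPolynomial.induction_on' with
  | add p q hp hq => simp only [mul_add, map_add, hp, hq]
  | monomial s c =>
    let raised : Fin N →₀ ℕ := s + Finsupp.single i 1
    let moment : ℕ → ℂ := fun a => a.factorial / (t : ℂ) ^ (a + 1)
    have h_others : ∏ j ∈ Finset.univ.erase i, moment (raised j) =
        ∏ j ∈ Finset.univ.erase i, moment (s j) := by
      refine Finset.prod_congr rfl fun j hj => ?_
      simp [raised, (Finset.ne_of_mem_erase hj).symm]
    have h_moment : (t : ℂ) * moment (s i + 1) = (s i + 1) * moment (s i) := by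
      simp only [moment, Nat.factorial_succ]
      push_cast
      field_simp
      ring
    have h_raised : raised i = s i + 1 := by simp [raised]
    rw [mul_comm (X _), show monomial s c * X i = monomial raised c by
        rw [monomial_add_single, pow_one], pderiv_monomial, add_tsub_cancel_right,
      expFunctional_monomial, expFunctional_monomial]
    change (t : ℂ) * (c * ∏ j, moment (raised j)) = c * (raised i : ℂ) * ∏ j, moment (s j)
    rw [← Finset.mul_prod_erase _ _ (Finset.mem_univ i), h_others,
      ← Finset.mul_prod_erase _ (fun j => moment (s j)) (Finset.mem_univ i), h_raised]
    push_cast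
    linear_combination c * (∏ j ∈ Finset.univ.erase i, moment (s j)) * h_moment

theorem expFunctional_of_isHomogeneous {t : ℝ} (ht : 0 < t) {f : MvPolynomial (Fin N) ℂ} {d : ℕ}
    (hf : f.IsHomogeneous d) :
    (t : ℂ) ^ (d + N) * expFunctional N ht f = expFunctional N one_pos f := by
  have ht' : (t : ℂ) ≠ 0 := by exact_mod_cast ht.ne'
  rw [MvPolynomial.as_sum f, map_sum, map_sum, Finset.mul_sum]
  refine Finset.sum_congr rfl fun s hs => ?_
  have h_degree : s.degree = d := by
    rw [Finsupp.degree_eq_weight_one]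
    exact hf (MvPolynomial.mem_support_iff.1 hs)
  have h_exponent : ∑ i, (s i + 1) = d + N := by
    rw [Finset.sum_add_distrib, ← h_degree, Finsupp.degree_eq_sum]
    simp
  rw [expFunctional_monomial, expFunctional_monomial, Finset.prod_div_distrib,
    Finset.prod_div_distrib, Finset.prod_pow_eq_pow_sum, h_exponent]
  simp only [Complex.ofReal_one, one_pow, Finset.prod_const_one, div_one]
  field_simp

theorem isHomogeneous_vandermondePoly_sq {R : Type*} [CommRing R] :
    (vandermondePoly N R ^ 2).IsHomogeneous (∑ i : Fin N, (Finset.Ioi i).card * 2) := by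
  rw [← Finset.sum_mul]
  refine (IsHomogeneous.prod _ _ _ fun i _ => ?_).pow 2
  have h_factor := IsHomogeneous.prod (Finset.Ioi i)
    (fun j => (X j - X i : MvPolynomial (Fin N) R)) (fun _ => 1)
    fun j _ => (isHomogeneous_X _ _).sub (isHomogeneous_X _ _)
  simpa using h_factor

theorem sum_card_Ioi_mul_two_add : ∑ i : Fin N, (Finset.Ioi i).card * 2 + N = N * N := by
  rw [← Finset.sum_mul]
  simp only [Fin.card_Ioi]
  rw [Fin.sum_univ_eq_sum_range (fun i => N - 1 - i) N, Finset.sum_range_reflect (fun i => i) N,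
    Finset.sum_range_id_mul_two]
  rcases N with _ | N
  · rfl
  · simp; ring

end LaguerreFunctional

section LaguerreEnsemble

variable {N : ℕ}

/-- The squared Vandermonde determinant `∏_{i < j} (x j - x i)²` of a real vector. -/
noncomputable def vandermondeSq (x : Fin N → ℝ) : ℝ :=
  (∏ i, ∏ j ∈ Finset.Ioi i, (x j - x i)) ^ 2

variable (N) in
/-- The total mass `∫ ∏_{i < j} (x j - x i)² exp (-∑ x i)` of the Laguerre density on the
positive orthant. -/
noncomputable def laguerreMass : ℝ :=
  ∫ x, vandermondeSq x * Real.exp (-∑ i, x i) ∂orthant (Fin N)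

theorem realEval_vandermondePoly_sq (x : Fin N → ℝ) :
    realEval x (vandermondePoly N ℂ ^ 2) = (vandermondeSq x : ℂ) := by
  simp [realEval, vandermondePoly, vandermondeSq, map_prod]

theorem integrable_laguerreDensity :
    Integrable (fun x : Fin N → ℝ => vandermondeSq x * Real.exp (-∑ i, x i))
      (orthant (Fin N)) := by
  refine (integrable_realEval one_pos (vandermondePoly N ℂ ^ 2)).re.congr (.of_forall fun x => ?_)
  simp only [realEval_vandermondePoly_sq, neg_mul, one_mul]
  rw [← Complex.ofReal_mul]
  exact Complex.ofReal_re _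

theorem expFunctional_vandermondePoly_sq {t : ℝ} (ht : 0 < t) :
    (t : ℂ) ^ (N * N) * expFunctional N ht (vandermondePoly N ℂ ^ 2) = laguerreMass N := by
  rw [← sum_card_Ioi_mul_two_add,
    expFunctional_of_isHomogeneous ht isHomogeneous_vandermondePoly_sq, laguerreMass,
    ← integral_complex_ofReal]
  simp only [expFunctional, LinearMap.coe_mk, AddHom.coe_mk, realEval_vandermondePoly_sq]
  refine integral_congr_ae (.of_forall fun x => ?_)
  simp

theorem laguerreMass_pos : 0 < laguerreMass N := by
  have h_nonneg : ∀ x : Fin N → ℝ, 0 ≤ vandermondeSq x * Real.exp (-∑ i, x i) := fun x => by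
    unfold vandermondeSq; positivity
  rw [laguerreMass, integral_pos_iff_support_of_nonneg h_nonneg integrable_laguerreDensity]
  have h_separated : (Set.univ.pi fun i : Fin N => Set.Ioo (i : ℝ) (i + 1)) ⊆
      Function.support fun x : Fin N → ℝ => vandermondeSq x * Real.exp (-∑ i, x i) := by
    intro x hx
    have hx' : ∀ i : Fin N, (i : ℝ) < x i ∧ x i < i + 1 := fun i => hx i (Set.mem_univ i)
    rw [Function.mem_support]
    refine (mul_pos (pow_pos (Finset.prod_pos fun i _ => Finset.prod_pos fun j hj => ?_) 2)
      (Real.exp_pos _)).ne'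
    have hij : ((i : ℕ) : ℝ) + 1 ≤ (j : ℕ) := by
      exact_mod_cast Nat.succ_le_of_lt (Fin.lt_def.1 (Finset.mem_Ioi.1 hj))
    linarith [(hx' i).2, (hx' j).1]
  refine lt_of_lt_of_le ?_ (measure_mono h_separated)
  rw [Measure.pi_pi]
  refine pos_iff_ne_zero.2 (Finset.prod_ne_zero_iff.2 fun i _ => ?_)
  have h_pos : Set.Ioo (i : ℝ) (i + 1) ⊆ Set.Ioi 0 := fun y hy =>
    lt_of_le_of_lt (Nat.cast_nonneg _) hy.1
  rw [Measure.restrict_apply measurableSet_Ioo, Set.inter_eq_left.2 h_pos]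
  simp

end LaguerreEnsemble

section GinibreMoments

open MvPolynomial

variable {N : ℕ} {m n : Type*}

/-- The matrix whose `(a, b)` entry is `z (a, b)`; it turns a family of independent Gaussians into
a Gaussian matrix. -/
def matrixOfFamily (z : m × n → ℂ) : Matrix m n ℂ := Matrix.of fun a b => z (a, b)

variable (m n) in
/-- The matrix of the variables that stand for the entries of an `m × n` matrix. -/
noncomputable def entryMatrix : Matrix m n (MvPolynomial ((m × n) ⊕ (m × n)) ℂ) :=
  Matrix.of fun a b => X (Sum.inl (a, b))

variable (m n) in
/-- The conjugate transpose of `entryMatrix`, made of the variables that stand for the conjugates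
of the entries. -/
noncomputable def conjEntryMatrix : Matrix n m (MvPolynomial ((m × n) ⊕ (m × n)) ℂ) :=
  Matrix.of fun b a => X (Sum.inr (a, b))

variable (m n) in
/-- The partial derivative along the conjugate of the `(a, b)` entry. -/
noncomputable abbrev conjEntryDeriv (a : m) (b : n) :
    Derivation ℂ (MvPolynomial ((m × n) ⊕ (m × n)) ℂ) (MvPolynomial ((m × n) ⊕ (m × n)) ℂ) :=
  pderiv (Sum.inr (a, b))

theorem entryMatrix_map_conjEntryDeriv (a : m) (b : n) :
    (entryMatrix m n).map (conjEntryDeriv m n a b) = 0 := by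
  classical
  ext1 i j
  simp [entryMatrix, pderiv_X]

theorem conjEntryMatrix_map_conjEntryDeriv [DecidableEq m] [DecidableEq n] (a : m) (b : n) :
    (conjEntryMatrix m n).map (conjEntryDeriv m n a b) = Matrix.single b a 1 := by
  ext1 i j
  simp only [conjEntryMatrix, Matrix.map_apply, Matrix.of_apply, pderiv_X,
    Matrix.single_apply, Pi.single_apply, Sum.inr.injEq, Prod.mk.injEq]
  exact if_congr ⟨fun h => ⟨h.2.symm, h.1.symm⟩, fun h => ⟨h.2.symm, h.1.symm⟩⟩ rfl rfl

variable [Fintype m] [Fintype n] [DecidableEq m]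

theorem satisfiesLoopEquations_gaussFunctional
    (hmn : Fintype.card n = Fintype.card m) (b : ℕ) (c : ℂ) :
    SatisfiesLoopEquations (1 + b : ℂ) (Fintype.card m)
      (fun k => trace ((entryMatrix m n * conjEntryMatrix m n) ^ k))
      (gramDeriv (entryMatrix m n) (conjEntryMatrix m n) (conjEntryDeriv m n))
      (c • gaussFunctional (m × n) b) := by
  classical
  refine satisfiesLoopEquations_gram hmn entryMatrix_map_conjEntryDeriv
    conjEntryMatrix_map_conjEntryDeriv _ fun i j f => ?_
  rw [LinearMap.smul_apply, LinearMap.smul_apply, ← gaussFunctional_X_mul b (i, j) f,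
    smul_eq_mul, smul_eq_mul, mul_left_comm]
  rfl

theorem conjEval_trace_entryMatrix (z : m × n → ℂ) (k : ℕ) :
    conjEval z (trace ((entryMatrix m n * conjEntryMatrix m n) ^ k)) =
      trace ((matrixOfFamily z * (matrixOfFamily z)ᴴ) ^ k) := by
  set φ : MvPolynomial ((m × n) ⊕ (m × n)) ℂ →+* ℂ :=
    eval (Sum.elim z fun i => starRingEnd ℂ (z i)) with hφ
  have h_trace : conjEval z (trace ((entryMatrix m n * conjEntryMatrix m n) ^ k)) =
      trace (φ.mapMatrix ((entryMatrix m n * conjEntryMatrix m n) ^ k)) := by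
    simp [conjEval, Matrix.trace, ← hφ, map_sum]
  have h_gram : φ.mapMatrix (entryMatrix m n * conjEntryMatrix m n) =
      matrixOfFamily z * (matrixOfFamily z)ᴴ := by
    ext a c
    simp [Matrix.mul_apply, entryMatrix, conjEntryMatrix, φ, matrixOfFamily]
  rw [h_trace, map_pow, h_gram]

theorem gaussFunctional_prod_trace (b : ℕ) (l : List ℕ) :
    gaussFunctional (m × n) b
        (l.map fun k => trace ((entryMatrix m n * conjEntryMatrix m n) ^ k)).prod =
      ∫ z : m × n → ℂ, (l.map fun k => trace ((matrixOfFamily z * (matrixOfFamily z)ᴴ) ^ k)).prod *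
        (Real.exp (-b * ∑ i, ‖z i‖ ^ 2) : ℂ) ∂gaussPi (m × n) := by
  refine integral_congr_ae (.of_forall fun z => ?_)
  simp only [← conjEval_trace_entryMatrix, conjEval, map_list_prod, List.map_map]
  rfl

theorem expFunctional_prod_psum {t : ℝ} (ht : 0 < t) (l : List ℕ) :
    expFunctional N ht ((l.map (psum (Fin N) ℂ)).prod * vandermondePoly N ℂ ^ 2) =
      ∫ x : Fin N → ℝ, (l.map fun k => ∑ i, (x i : ℂ) ^ k).prod *
        ((vandermondeSq x * Real.exp (-t * ∑ i, x i) : ℝ) : ℂ) ∂orthant (Fin N) := by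
  refine integral_congr_ae (.of_forall fun x => ?_)
  have h_mul : realEval x ((l.map (psum (Fin N) ℂ)).prod * vandermondePoly N ℂ ^ 2) =
      realEval x (l.map (psum (Fin N) ℂ)).prod * realEval x (vandermondePoly N ℂ ^ 2) :=
    map_mul _ _ _
  have h_prod : realEval x (l.map (psum (Fin N) ℂ)).prod =
      (l.map fun k => ∑ i, (x i : ℂ) ^ k).prod := by
    rw [realEval, map_list_prod, List.map_map]
    congr 1
    exact List.map_congr_left fun k _ => by simp [psum]
  simp only [h_mul, h_prod, realEval_vandermondePoly_sq]
  push_cast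
  ring

theorem laguerreMass_mul_integral_trace (hm : Fintype.card m = N) (hn : Fintype.card n = N)
    (b : ℕ) (l : List ℕ) :
    (laguerreMass N : ℂ) * ∫ z : m × n → ℂ,
      (l.map fun k => trace ((matrixOfFamily z * (matrixOfFamily z)ᴴ) ^ k)).prod *
        (Real.exp (-b * ∑ i, ‖z i‖ ^ 2) : ℂ) ∂gaussPi (m × n) =
    ∫ x : Fin N → ℝ, (l.map fun k => ∑ i, (x i : ℂ) ^ k).prod *
      ((vandermondeSq x * Real.exp (-(1 + b) * ∑ i, x i) : ℝ) : ℂ) ∂orthant (Fin N) := by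
  classical
  have hb : (0 : ℝ) < 1 + b := by positivity
  have hb' : (1 + b : ℂ) ≠ 0 := by exact_mod_cast hb.ne'
  have h_matrix := satisfiesLoopEquations_gaussFunctional (hn.trans hm.symm) b (laguerreMass N : ℂ)
  have h_laguerre := satisfiesLoopEquations_laguerre (N := N) (expFunctional N hb)
    (expFunctional_X_mul hb)
  rw [hm] at h_matrix
  rw [Complex.ofReal_add, Complex.ofReal_one, Complex.ofReal_natCast] at h_laguerre
  have h_one : ((laguerreMass N : ℂ) • gaussFunctional (m × n) b) 1 =
      (expFunctional N hb ∘ₗ LinearMap.mulRight ℂ (vandermondePoly N ℂ ^ 2)) 1 := by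
    simp only [LinearMap.smul_apply, gaussFunctional_one, LinearMap.comp_apply,
      LinearMap.mulRight_apply, one_mul, ← expFunctional_vandermondePoly_sq (N := N) hb,
      Fintype.card_prod, hm, hn, smul_eq_mul, inv_pow]
    push_cast
    field_simp
  rw [← gaussFunctional_prod_trace, ← expFunctional_prod_psum hb]
  exact h_matrix.map_prod_eq (IsRegular.of_ne_zero hb').left h_laguerre h_one l

end GinibreMoments

section PowerSums

variable {N : ℕ}

/-- The chamber of nondecreasing tuples of nonnegative reals, in which the sorted spectrum of a
positive semidefinite matrix lives. -/
abbrev Chamber (N : ℕ) : Type := {x : Fin N → ℝ // Monotone x ∧ ∀ i, 0 ≤ x i}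

theorem isClosed_chamber : IsClosed {x : Fin N → ℝ | Monotone x ∧ ∀ i, 0 ≤ x i} := by
  refine IsClosed.inter ?_ ?_
  · have h_inter : {x : Fin N → ℝ | Monotone x} = ⋂ (i : Fin N) (j : Fin N) (_ : i ≤ j),
        {x : Fin N → ℝ | x i ≤ x j} := by
      ext x; simp [Monotone]
    change IsClosed {x : Fin N → ℝ | Monotone x}
    rw [h_inter]
    exact isClosed_iInter fun i => isClosed_iInter fun j => isClosed_iInter fun _ =>
      isClosed_le (continuous_apply i) (continuous_apply j)
  · change IsClosed {x : Fin N → ℝ | ∀ i, 0 ≤ x i}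
    rw [Set.ofPred_forall]
    exact isClosed_iInter fun i => isClosed_le continuous_const (continuous_apply i)

instance : PolishSpace (Chamber N) := isClosed_chamber.polishSpace

theorem sum_eval_eq_of_sum_pow_eq {ι R : Type*} [Fintype ι] [CommSemiring R] {x y : ι → R}
    (h : ∀ k : ℕ, ∑ i, x i ^ k = ∑ i, y i ^ k) (p : Polynomial R) :
    ∑ i, p.eval (x i) = ∑ i, p.eval (y i) := by
  simp only [Polynomial.eval_eq_sum_range]
  rw [Finset.sum_comm, Finset.sum_comm (s := Finset.univ)]
  refine Finset.sum_congr rfl fun k _ => ?_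
  rw [← Finset.mul_sum, ← Finset.mul_sum, h]

-- Summing the Lagrange polynomial of the indicator of `v` counts the occurrences of `v`.
theorem card_fiber_eq_of_sum_pow_eq {ι K : Type*} [Fintype ι] [Field K] [CharZero K]
    [DecidableEq K] {x y : ι → K} (h : ∀ k : ℕ, ∑ i, x i ^ k = ∑ i, y i ^ k) (v : K) :
    Fintype.card {i // x i = v} = Fintype.card {i // y i = v} := by
  set s : Finset K := insert v (Finset.univ.image x ∪ Finset.univ.image y) with hs
  set p : Polynomial K := Lagrange.interpolate s id (fun w => if w = v then 1 else 0)
  have h_eval : ∀ w ∈ s, p.eval w = if w = v then 1 else 0 := fun w hw =>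
    Lagrange.eval_interpolate_at_node (v := id) _ (Set.injOn_id _) hw
  have h_sum := sum_eval_eq_of_sum_pow_eq h p
  have hx : ∀ i, p.eval (x i) = if x i = v then 1 else 0 := fun i => h_eval _ (by simp [hs])
  have hy : ∀ i, p.eval (y i) = if y i = v then 1 else 0 := fun i => h_eval _ (by simp [hs])
  simp only [hx, hy, Finset.sum_boole] at h_sum
  rw [Fintype.card_subtype, Fintype.card_subtype]
  exact_mod_cast h_sum

theorem exists_perm_of_sum_pow_eq {ι K : Type*} [Fintype ι] [Field K] [CharZero K]
    {x y : ι → K} (h : ∀ k : ℕ, ∑ i, x i ^ k = ∑ i, y i ^ k) :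
    ∃ σ : Equiv.Perm ι, y ∘ σ = x := by
  classical
  have e : ∀ v, {i // x i = v} ≃ {i // y i = v} := fun v =>
    Fintype.equivOfCardEq (card_fiber_eq_of_sum_pow_eq h v)
  refine ⟨(Equiv.sigmaFiberEquiv x).symm.trans ((Equiv.sigmaCongrRight e).trans
    (Equiv.sigmaFiberEquiv y)), ?_⟩
  ext i
  simp only [Function.comp_apply, Equiv.trans_apply]
  exact ((e _) ⟨i, rfl⟩).2

/-- The sequence of the power sums `∑ x i ^ k` of a tuple, which coordinatizes the chamber. -/
def psumSeq (x : Fin N → ℝ) (k : ℕ) : ℝ := ∑ i, x i ^ k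

theorem psumSeq_injective : Function.Injective fun x : Chamber N => psumSeq x.1 := by
  intro x y h
  obtain ⟨σ, hσ⟩ := exists_perm_of_sum_pow_eq (fun k => congrFun h k)
  refine Subtype.ext ?_
  have h_sorted := Tuple.unique_monotone (f := y.1) (σ := σ) (τ := 1) (by rw [hσ]; exact x.2.1)
    (by simpa using y.2.1)
  rw [← hσ, h_sorted]
  simp

theorem measurable_psumSeq : Measurable (psumSeq : (Fin N → ℝ) → ℕ → ℝ) := by
  unfold psumSeq
  fun_prop

theorem measurableEmbedding_psumSeq : MeasurableEmbedding fun x : Chamber N => psumSeq x.1 :=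
  (measurable_psumSeq.comp measurable_subtype_coe).measurableEmbedding psumSeq_injective

/-- The point of the chamber obtained by sorting the positive parts of a tuple; truncating makes
the map total. -/
noncomputable def sortChamber (x : Fin N → ℝ) : Chamber N :=
  ⟨(fun i => max (x i) 0) ∘ Tuple.sort fun i => max (x i) 0,
    Tuple.monotone_sort _, fun _ => le_max_right _ _⟩

theorem psumSeq_sortChamber {x : Fin N → ℝ} (hx : ∀ i, 0 ≤ x i) :
    psumSeq (sortChamber x).1 = psumSeq x := by
  ext k
  simp only [psumSeq, sortChamber, Function.comp_apply]
  rw [Equiv.sum_comp (Tuple.sort fun i => max (x i) 0) (fun i => max (x i) 0 ^ k)]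
  simp [hx]

theorem measurable_sortChamber : Measurable (sortChamber : (Fin N → ℝ) → Chamber N) := by
  rw [← measurableEmbedding_psumSeq.measurable_comp_iff]
  have h_comp : (fun x : Chamber N => psumSeq x.1) ∘ sortChamber =
      fun x : Fin N → ℝ => psumSeq fun i => max (x i) 0 := by
    funext x k
    simp only [Function.comp_apply, psumSeq, sortChamber]
    exact Equiv.sum_comp (Tuple.sort fun i => max (x i) 0) (fun i => max (x i) 0 ^ k)
  rw [h_comp]
  exact measurable_psumSeq.comp (by fun_prop)

theorem Chamber.continuous_apply (i : Fin N) : Continuous fun x : Chamber N => x.1 i :=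
  (_root_.continuous_apply i).comp continuous_subtype_val

theorem continuous_psumSeq_mul_exp (k : ℕ) :
    Continuous fun x : Chamber N => psumSeq x.1 k * Real.exp (-∑ i, x.1 i) :=
  (continuous_finsetSum _ fun i _ => (Chamber.continuous_apply i).pow k).mul
    (Real.continuous_exp.comp (continuous_finsetSum _ fun i _ => Chamber.continuous_apply i).neg)

theorem norm_psumSeq_mul_exp_le (k : ℕ) (x : Chamber N) :
    ‖psumSeq x.1 k * Real.exp (-∑ i, x.1 i)‖ ≤ N * k.factorial := by
  have hx := x.2.2
  have h_nonneg : 0 ≤ psumSeq x.1 k := Finset.sum_nonneg fun i _ => pow_nonneg (hx i) _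
  rw [Real.norm_of_nonneg (mul_nonneg h_nonneg (Real.exp_pos _).le), psumSeq, Finset.sum_mul]
  refine (Finset.sum_le_card_nsmul _ _ (k.factorial : ℝ) fun i _ => ?_).trans (by simp)
  have h_exp : Real.exp (-∑ i, x.1 i) ≤ Real.exp (-x.1 i) := Real.exp_le_exp.2
    (neg_le_neg (Finset.single_le_sum (fun j _ => hx j) (Finset.mem_univ i)))
  have h_pow := Real.pow_div_factorial_le_exp _ (hx i) k
  rw [div_le_iff₀ (by positivity)] at h_pow
  have h_pow_nonneg := pow_nonneg (hx i) k
  calc x.1 i ^ k * Real.exp (-∑ i, x.1 i) ≤ x.1 i ^ k * Real.exp (-x.1 i) := by gcongr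
    _ ≤ Real.exp (x.1 i) * k.factorial * Real.exp (-x.1 i) := by gcongr
    _ = k.factorial := by
        rw [mul_right_comm, ← Real.exp_add, add_neg_cancel, Real.exp_zero, one_mul]

/-- The bounded test function `pₖ exp (-p₁)` on the chamber. -/
noncomputable def chamberTest (N k : ℕ) : BoundedContinuousFunction (Chamber N) ℝ :=
  BoundedContinuousFunction.ofNormedAddCommGroup
    (fun x => psumSeq x.1 k * Real.exp (-∑ i, x.1 i)) (continuous_psumSeq_mul_exp k)
    (N * k.factorial) (norm_psumSeq_mul_exp_le k)

theorem chamberTest_apply (k : ℕ) (x : Chamber N) :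
    chamberTest N k x = psumSeq x.1 k * Real.exp (-∑ i, x.1 i) := rfl

/-- The algebra generated by the test functions `pₖ exp (-p₁)`, to which the Stone–Weierstrass
theorem applies. -/
noncomputable def chamberAlgebra (N : ℕ) :
    StarSubalgebra ℝ (BoundedContinuousFunction (Chamber N) ℝ) where
  toSubalgebra := Algebra.adjoin ℝ (Set.range (chamberTest N))
  star_mem' := by
    intro a ha
    rwa [show star a = a by ext x; simp]

-- `p₀ = N` is constant, so the test functions recover `exp (-p₁)` and hence every `pₖ`.
theorem exists_chamberTest_ne {x y : Chamber N} (hxy : x ≠ y) :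
    ∃ k, chamberTest N k x ≠ chamberTest N k y := by
  by_contra! h_eq
  refine hxy (psumSeq_injective (funext fun k => ?_))
  have h_zero := h_eq 0
  have hk := h_eq k
  rw [chamberTest_apply, chamberTest_apply] at h_zero hk
  rcases Nat.eq_zero_or_pos N with rfl | hN
  · simp [psumSeq]
  have hN' : (N : ℝ) ≠ 0 := by exact_mod_cast hN.ne'
  simp only [psumSeq, pow_zero, Finset.sum_const, Finset.card_univ, Fintype.card_fin,
    nsmul_eq_mul, mul_one] at h_zero
  rw [mul_left_cancel₀ hN' h_zero] at hk
  exact mul_right_cancel₀ (Real.exp_pos _).ne' hk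

theorem chamberAlgebra_separatesPoints :
    ((chamberAlgebra N).map
      (BoundedContinuousFunction.toContinuousMapStarₐ ℝ)).SeparatesPoints := by
  intro x y hxy
  obtain ⟨k, hk⟩ := exists_chamberTest_ne hxy
  exact ⟨_, ⟨_, ⟨chamberTest N k, Algebra.subset_adjoin (Set.mem_range_self k), rfl⟩, rfl⟩, hk⟩

end PowerSums

section EigenvalueLaw

variable {N : ℕ}

theorem toSubmodule_chamberAlgebra :
    Subalgebra.toSubmodule (chamberAlgebra N).toSubalgebra =
      Submodule.span ℝ (Set.range fun l : List ℕ => (l.map (chamberTest N)).prod) := by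
  rw [chamberAlgebra, Algebra.adjoin_eq_span, Submonoid.closure_eq_image_prod,
    ← Set.range_list_map, ← Set.range_comp]
  rfl

theorem Chamber.measure_ext {P Q : Measure (Chamber N)} [IsFiniteMeasure P] [IsFiniteMeasure Q]
    (h : ∀ l : List ℕ, ∫ x, (l.map (chamberTest N)).prod x ∂P =
      ∫ x, (l.map (chamberTest N)).prod x ∂Q) : P = Q := by
  refine ext_of_forall_mem_subalgebra_integral_eq_of_polish chamberAlgebra_separatesPoints ?_
  intro g hg
  have hg_span : g ∈ Submodule.span ℝ (Set.range fun l : List ℕ =>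
      (l.map (chamberTest N)).prod) := toSubmodule_chamberAlgebra ▸ hg
  clear hg
  induction hg_span using Submodule.span_induction with
  | zero => simp
  | add f g _ _ hf hg =>
    simp only [BoundedContinuousFunction.coe_add, Pi.add_apply]
    rw [integral_add (f.integrable P) (g.integrable P), integral_add (f.integrable Q)
      (g.integrable Q), hf, hg]
  | smul c f _ hf =>
    simp only [BoundedContinuousFunction.coe_smul, smul_eq_mul, integral_const_mul, hf]
  | mem g hg =>
    obtain ⟨l, rfl⟩ := hg
    exact h l

theorem prod_chamberTest_apply (l : List ℕ) (x : Chamber N) :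
    (l.map (chamberTest N)).prod x =
      (l.map (psumSeq x.1)).prod * Real.exp (-l.length * ∑ i, x.1 i) := by
  induction l with
  | nil => simp
  | cons k l ih =>
    simp only [List.map_cons, List.prod_cons, BoundedContinuousFunction.coe_mul,
      Pi.mul_apply, ih, chamberTest_apply, List.length_cons]
    push_cast
    rw [show -((l.length : ℝ) + 1) * ∑ i, x.1 i =
      -(∑ i, x.1 i) + -l.length * ∑ i, x.1 i by ring, Real.exp_add]
    ring

theorem prod_chamberTest_sortChamber (l : List ℕ) {x : Fin N → ℝ} (hx : ∀ i, 0 ≤ x i) :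
    (l.map (chamberTest N)).prod (sortChamber x) =
      (l.map (psumSeq x)).prod * Real.exp (-l.length * ∑ i, x i) := by
  have h_psum := psumSeq_sortChamber hx
  have h_sum : ∑ i, (sortChamber x).1 i = ∑ i, x i := by
    simpa [psumSeq] using congrFun h_psum 1
  rw [prod_chamberTest_apply, h_psum, h_sum]

theorem eq_unitary_conj_diagonal {m 𝕜 : Type*} [RCLike 𝕜] [Fintype m] [DecidableEq m]
    {A : Matrix m m 𝕜} (hA : A.IsHermitian) :
    A = (hA.eigenvectorUnitary : Matrix m m 𝕜) * diagonal (fun i => (hA.eigenvalues i : 𝕜)) *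
      (star hA.eigenvectorUnitary : Matrix m m 𝕜) := by
  conv_lhs => rw [hA.spectral_theorem]
  rfl

theorem trace_pow_eq_sum_eigenvalues {m 𝕜 : Type*} [RCLike 𝕜] [Fintype m] [DecidableEq m]
    {A : Matrix m m 𝕜} (hA : A.IsHermitian) (k : ℕ) :
    trace (A ^ k) = ∑ i, (hA.eigenvalues i : 𝕜) ^ k := by
  conv_lhs => rw [hA.spectral_theorem, ← map_pow, diagonal_pow, Unitary.conjStarAlgAut_apply]
  rw [Matrix.trace_mul_comm, ← Matrix.mul_assoc, Unitary.coe_star_mul_self, Matrix.one_mul,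
    Matrix.trace_diagonal]
  rfl

variable {m n : Type*}

theorem continuous_matrixOfFamily :
    Continuous (matrixOfFamily : (m × n → ℂ) → Matrix m n ℂ) :=
  continuous_matrix fun i j => continuous_apply (i, j)

variable [Fintype m] [Fintype n]

theorem trace_matrixOfFamily_mul_conjTranspose (z : m × n → ℂ) :
    trace (matrixOfFamily z * (matrixOfFamily z)ᴴ) = ((∑ i, ‖z i‖ ^ 2 : ℝ) : ℂ) := by
  simp only [Matrix.trace, Matrix.diag_apply, Matrix.mul_apply, matrixOfFamily, Matrix.of_apply,
    Matrix.conjTranspose_apply, RCLike.star_def, Complex.mul_conj', Fintype.sum_prod_type]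
  push_cast
  rfl

variable [DecidableEq m]

/-- The sorted spectrum of the Gram matrix `Z Zᴴ` of the matrix `Z` with entries `z`. The
enumeration `e` of the rows only serves to index the eigenvalues by `Fin N`. -/
noncomputable def gramEigs (e : Fin N ≃ m) (z : m × n → ℂ) : Chamber N :=
  sortChamber fun i => (isHermitian_mul_conjTranspose_self (matrixOfFamily z)).eigenvalues (e i)

open scoped ComplexOrder in
theorem psumSeq_gramEigs (e : Fin N ≃ m) (z : m × n → ℂ) (k : ℕ) :
    (psumSeq (gramEigs e z).1 k : ℂ) =
      trace ((matrixOfFamily z * (matrixOfFamily z)ᴴ) ^ k) := by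
  rw [gramEigs, psumSeq_sortChamber fun i =>
      (posSemidef_self_mul_conjTranspose (matrixOfFamily z)).eigenvalues_nonneg (e i),
    trace_pow_eq_sum_eigenvalues (isHermitian_mul_conjTranspose_self (matrixOfFamily z)), psumSeq]
  push_cast
  exact Equiv.sum_comp e (fun i =>
    ((isHermitian_mul_conjTranspose_self (matrixOfFamily z)).eigenvalues i : ℂ) ^ k)

theorem measurable_gramEigs (e : Fin N ≃ m) :
    Measurable (gramEigs e : (m × n → ℂ) → Chamber N) := by
  rw [← measurableEmbedding_psumSeq.measurable_comp_iff]
  have h_trace : (fun x : Chamber N => psumSeq x.1) ∘ gramEigs e =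
      fun (z : m × n → ℂ) k =>
        (trace ((matrixOfFamily z * (matrixOfFamily z)ᴴ) ^ k)).re := by
    funext z k
    rw [← psumSeq_gramEigs e, Complex.ofReal_re]
    rfl
  rw [h_trace, measurable_pi_iff]
  have h_cont := continuous_matrixOfFamily (m := m) (n := n)
  exact fun k => (Complex.continuous_re.comp
    ((h_cont.matrix_mul h_cont.matrix_conjTranspose).pow k).matrix_trace).measurable

theorem sum_gramEigs (e : Fin N ≃ m) (z : m × n → ℂ) :
    ∑ i, (gramEigs e z).1 i = ∑ i, ‖z i‖ ^ 2 := by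
  have h_trace := psumSeq_gramEigs e z 1
  simp only [psumSeq, pow_one, trace_matrixOfFamily_mul_conjTranspose] at h_trace
  exact_mod_cast h_trace

theorem ofReal_prod_chamberTest_gramEigs (e : Fin N ≃ m) (z : m × n → ℂ) (l : List ℕ) :
    (((l.map (chamberTest N)).prod (gramEigs e z) : ℝ) : ℂ) =
      (l.map fun k => trace ((matrixOfFamily z * (matrixOfFamily z)ᴴ) ^ k)).prod *
        (Real.exp (-l.length * ∑ i, ‖z i‖ ^ 2) : ℂ) := by
  rw [prod_chamberTest_apply, sum_gramEigs, Complex.ofReal_mul]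
  congr 1
  rw [← Complex.ofRealHom_eq_coe, map_list_prod, List.map_map]
  congr 1
  exact List.map_congr_left fun k _ => psumSeq_gramEigs e z k

/-- The unnormalized law of the `N` eigenvalues of an `N × N` Gram matrix: density
`∏ (xᵢ - xⱼ)² exp (-∑ xᵢ)` on the positive orthant. Its total mass is `laguerreMass N`. -/
noncomputable def laguerre (N : ℕ) : Measure (Fin N → ℝ) :=
  (orthant (Fin N)).withDensity
    fun x => ENNReal.ofReal (vandermondeSq x * Real.exp (-∑ i, x i))

theorem continuous_vandermondeSq : Continuous (vandermondeSq : (Fin N → ℝ) → ℝ) := by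
  unfold vandermondeSq
  fun_prop

theorem vandermondeSq_nonneg (x : Fin N → ℝ) : 0 ≤ vandermondeSq x := sq_nonneg _

theorem measurable_laguerreDensity : Measurable fun x : Fin N → ℝ =>
    ENNReal.ofReal (vandermondeSq x * Real.exp (-∑ i, x i)) := by
  have h_cont := continuous_vandermondeSq (N := N)
  fun_prop

theorem laguerre_univ : laguerre N Set.univ = ENNReal.ofReal (laguerreMass N) := by
  rw [laguerre, withDensity_apply _ MeasurableSet.univ, Measure.restrict_univ, laguerreMass,
    ofReal_integral_eq_lintegral_ofReal integrable_laguerreDensity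
      (.of_forall fun x => mul_nonneg (vandermondeSq_nonneg x) (Real.exp_pos _).le)]

instance : IsFiniteMeasure (laguerre N) := ⟨by rw [laguerre_univ]; exact ENNReal.ofReal_lt_top⟩

theorem ae_orthant_pos {ι : Type*} [Fintype ι] : ∀ᵐ x ∂orthant ι, ∀ i, 0 < x i := by
  rw [ae_all_iff]
  intro i
  exact (Measure.quasiMeasurePreserving_eval _ i).ae (ae_restrict_mem measurableSet_Ioi)

theorem integral_prod_chamberTest_sortChamber_laguerre (l : List ℕ) :
    ((∫ x, (l.map (chamberTest N)).prod (sortChamber x) ∂laguerre N : ℝ) : ℂ) =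
      ∫ x : Fin N → ℝ, (l.map fun k => ∑ i, (x i : ℂ) ^ k).prod *
        ((vandermondeSq x * Real.exp (-(1 + l.length) * ∑ i, x i) : ℝ) : ℂ)
          ∂orthant (Fin N) := by
  rw [laguerre, integral_withDensity_eq_integral_toReal_smul measurable_laguerreDensity (by simp),
    ← integral_complex_ofReal]
  refine integral_congr_ae ?_
  filter_upwards [ae_orthant_pos] with x hx
  have h_prod : (l.map fun k => ∑ i, (x i : ℂ) ^ k).prod =
      (((l.map (psumSeq x)).prod : ℝ) : ℂ) := by
    rw [← Complex.ofRealHom_eq_coe, map_list_prod, List.map_map]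
    congr 1
    exact List.map_congr_left fun k _ => by simp [psumSeq]
  rw [prod_chamberTest_sortChamber l fun i => (hx i).le, h_prod,
    ENNReal.toReal_ofReal (mul_nonneg (vandermondeSq_nonneg x) (Real.exp_pos _).le),
    show -(1 + (l.length : ℝ)) * ∑ i, x i = -(∑ i, x i) + -l.length * ∑ i, x i by ring,
    Real.exp_add, smul_eq_mul]
  push_cast
  ring

theorem laguerreMass_smul_map_gramEigs (e : Fin N ≃ m) (hn : Fintype.card n = N) :
    ENNReal.ofReal (laguerreMass N) • (gaussPi (m × n)).map (gramEigs e) =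
      (laguerre N).map sortChamber := by
  have : IsProbabilityMeasure ((gaussPi (m × n)).map (gramEigs e)) :=
    Measure.isProbabilityMeasure_map (measurable_gramEigs e).aemeasurable
  have : IsFiniteMeasure (ENNReal.ofReal (laguerreMass N) •
    (gaussPi (m × n)).map (gramEigs e)) := Measure.smul_finite _ ENNReal.ofReal_ne_top
  have hm : Fintype.card m = N := by rw [← Fintype.card_congr e, Fintype.card_fin]
  refine Chamber.measure_ext fun l => Complex.ofReal_injective ?_
  have h_meas {μ : Measure (Chamber N)} :
      AEStronglyMeasurable (l.map (chamberTest N)).prod μ :=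
    (l.map (chamberTest N)).prod.continuous.aestronglyMeasurable
  rw [integral_smul_measure, integral_map (measurable_gramEigs e).aemeasurable h_meas,
    integral_map measurable_sortChamber.aemeasurable h_meas,
    ENNReal.toReal_ofReal laguerreMass_pos.le, smul_eq_mul, Complex.ofReal_mul,
    ← integral_complex_ofReal, integral_prod_chamberTest_sortChamber_laguerre]
  simp only [ofReal_prod_chamberTest_gramEigs]
  exact laguerreMass_mul_integral_trace hm hn l.length l

end EigenvalueLaw

section LaguerreWeight

theorem prod_le_pow_card_of_sum_eq {ι : Type*} [Fintype ι] [Nonempty ι] {y : ι → ℝ} {c : ℝ}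
    (h_nonneg : ∀ i, 0 ≤ y i) (h_sum : ∑ i, y i = c * Fintype.card ι) :
    ∏ i, y i ≤ c ^ Fintype.card ι := by
  have h_card : (0 : ℝ) < Fintype.card ι := by exact_mod_cast Fintype.card_pos
  have h_prod : 0 ≤ ∏ i, y i := Finset.prod_nonneg fun i _ => h_nonneg i
  have h_amgm := Real.geom_mean_le_arith_mean Finset.univ (fun _ : ι => (1 : ℝ)) y (by simp)
    (by simpa using h_card) fun i _ => h_nonneg i
  simp only [Real.rpow_one, Finset.sum_const, Finset.card_univ, nsmul_eq_mul, mul_one, one_mul,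
    h_sum, mul_div_cancel_right₀ _ h_card.ne'] at h_amgm
  calc ∏ i, y i = ((∏ i, y i) ^ ((Fintype.card ι : ℝ)⁻¹)) ^ Fintype.card ι := by
        rw [← Real.rpow_natCast, ← Real.rpow_mul h_prod, inv_mul_cancel₀ h_card.ne', Real.rpow_one]
    _ ≤ c ^ Fintype.card ι := by gcongr

-- Contracting back, each coordinate is a convex combination of the dilated one and the mean.
theorem prod_dilate_le {ι : Type*} [Fintype ι] [Nonempty ι] {x : ι → ℝ} {s c : ℝ} (hs : 1 ≤ s)
    (h_mean : c * Fintype.card ι = ∑ i, x i) (h_nonneg : ∀ i, 0 ≤ s * x i - (s - 1) * c) :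
    ∏ i, (s * x i - (s - 1) * c) ≤ ∏ i, x i := by
  set y := fun i => s * x i - (s - 1) * c with hy
  have h_s_pos : 0 < s := by linarith
  have h_sum : ∑ i, y i = c * Fintype.card ι := by
    simp only [hy, Finset.sum_sub_distrib, ← Finset.mul_sum, ← h_mean, Finset.sum_const,
      Finset.card_univ, nsmul_eq_mul]
    ring
  have h_c : 0 ≤ c := by
    refine nonneg_of_mul_nonneg_left (h_sum ▸ Finset.sum_nonneg fun i _ => h_nonneg i) ?_
    exact_mod_cast Fintype.card_pos
  have h_weight : 0 ≤ 1 - s⁻¹ := sub_nonneg.2 (inv_le_one_of_one_le₀ hs)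
  have h_prod : 0 ≤ ∏ i, y i := Finset.prod_nonneg fun i _ => h_nonneg i
  calc ∏ i, y i = (∏ i, y i) ^ s⁻¹ * (∏ i, y i) ^ (1 - s⁻¹) := by
        rw [← Real.rpow_add_of_nonneg h_prod (inv_nonneg.2 h_s_pos.le) h_weight]; simp
    _ ≤ (∏ i, y i) ^ s⁻¹ * (c ^ Fintype.card ι) ^ (1 - s⁻¹) := by
        gcongr
        exact prod_le_pow_card_of_sum_eq h_nonneg h_sum
    _ = ∏ i, (y i ^ s⁻¹ * c ^ (1 - s⁻¹)) := by
        rw [Finset.prod_mul_distrib, Real.finsetProd_rpow _ _ (fun i _ => h_nonneg i),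
          Finset.prod_const, Finset.card_univ, ← Real.rpow_natCast, ← Real.rpow_mul h_c,
          ← Real.rpow_natCast, ← Real.rpow_mul h_c, mul_comm (1 - s⁻¹)]
    _ ≤ ∏ i, x i := by
        refine Finset.prod_le_prod (fun i _ => mul_nonneg (Real.rpow_nonneg (h_nonneg i) _)
          (Real.rpow_nonneg h_c _)) fun i _ => ?_
        have h_convex : x i = s⁻¹ * y i + (1 - s⁻¹) * c := by
          simp only [hy]
          field_simp
          ring
        rw [h_convex]
        exact Real.geom_mean_le_arith_mean2_weighted (inv_nonneg.2 h_s_pos.le) h_weight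
          (h_nonneg i) h_c (by ring)

theorem lt_of_dilate_lt {ι : Type*} [Fintype ι] [Nonempty ι] {x : ι → ℝ} {s c y : ℝ} (hs : 1 ≤ s)
    (h_mean : c * Fintype.card ι = ∑ i, x i) (h_lt : ∀ i, s * x i < y + (s - 1) * c) (i : ι) :
    x i < y := by
  obtain ⟨i_max, -, h_max⟩ := Finset.exists_max_image Finset.univ x Finset.univ_nonempty
  have h_card : (0 : ℝ) < Fintype.card ι := by exact_mod_cast Fintype.card_pos
  have h_mean_le : c ≤ x i_max := by
    refine le_of_mul_le_mul_right ?_ h_card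
    rw [h_mean, mul_comm]
    simpa using Finset.sum_le_card_nsmul _ _ (x i_max) h_max
  have h_lt_max := h_lt i_max
  have h_le_max := h_max i (Finset.mem_univ i)
  nlinarith

variable {ι κ : Type*} [Fintype ι] [Fintype κ]

/-- The product of the distances `|xᵢ - xⱼ|` over the ordered pairs `i ≠ j`: the squared
Vandermonde determinant, for points indexed by an arbitrary finite type. -/
def pairProd (x : ι → ℝ) : ℝ := ∏ p ∈ (Finset.univ : Finset ι).offDiag, |x p.1 - x p.2|

theorem pairProd_nonneg (x : ι → ℝ) : 0 ≤ pairProd x :=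
  Finset.prod_nonneg fun _ _ => abs_nonneg _

theorem continuous_pairProd : Continuous (pairProd : (ι → ℝ) → ℝ) := by
  unfold pairProd
  fun_prop

theorem pairProd_add_const (x : ι → ℝ) (c : ℝ) : pairProd (x + fun _ => c) = pairProd x := by
  simp [pairProd]

theorem pairProd_smul {a : ℝ} (ha : 0 ≤ a) (x : ι → ℝ) :
    pairProd (a • x) = a ^ (Fintype.card ι * Fintype.card ι - Fintype.card ι) * pairProd x := by
  simp only [pairProd, Pi.smul_apply, smul_eq_mul, ← mul_sub, abs_mul, abs_of_nonneg ha,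
    Finset.prod_mul_distrib, Finset.prod_const, Finset.offDiag_card, Finset.card_univ]

/-- The factors of the Laguerre density that involve the upper points `y`, when the lower points
are `x`; it vanishes unless every `yⱼ` exceeds every `xᵢ`. -/
noncomputable def crossDensity (x : ι → ℝ) (y : κ → ℝ) : ENNReal :=
  Set.indicator {p : (ι → ℝ) × (κ → ℝ) | ∀ i j, p.1 i < p.2 j}
    (fun p => ENNReal.ofReal (pairProd p.2 * (∏ j, ∏ i, (p.2 j - p.1 i)) ^ 2 *
      Real.exp (-∑ j, p.2 j))) (x, y)

theorem crossDensity_of_lt {x : ι → ℝ} {y : κ → ℝ} (h : ∀ i j, x i < y j) :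
    crossDensity x y = ENNReal.ofReal (pairProd y * (∏ j, ∏ i, (y j - x i)) ^ 2 *
      Real.exp (-∑ j, y j)) :=
  Set.indicator_of_mem (by exact h) _

theorem crossDensity_of_not_lt {x : ι → ℝ} {y : κ → ℝ} (h : ¬ ∀ i j, x i < y j) :
    crossDensity x y = 0 :=
  Set.indicator_of_notMem (by exact h) _

theorem measurable_crossDensity :
    Measurable fun p : (ι → ℝ) × (κ → ℝ) => crossDensity p.1 p.2 := by
  refine Measurable.indicator ?_ ?_
  · have h_meas := (continuous_pairProd (ι := κ)).measurable
    fun_prop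
  · simp only [Set.ofPred_forall]
    exact MeasurableSet.iInter fun i => MeasurableSet.iInter fun j =>
      measurableSet_lt (by fun_prop) (by fun_prop)

theorem exp_mul_crossDensity_smul_le [Nonempty ι] (hcard : Fintype.card κ = Fintype.card ι)
    {x : ι → ℝ} {s c : ℝ} (hs : 1 ≤ s) (h_mean : c * Fintype.card ι = ∑ i, x i) (y : κ → ℝ) :
    ENNReal.ofReal (Real.exp (∑ i, (s • x) i)) *
        crossDensity (s • x) (y + fun _ => (s - 1) * c) ≤
      ENNReal.ofReal (Real.exp (∑ i, x i)) * crossDensity x y := by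
  by_cases h_lt : ∀ i j, (s • x) i < (y + fun _ => (s - 1) * c : κ → ℝ) j
  swap
  · simp [crossDensity_of_not_lt h_lt]
  rw [crossDensity_of_lt h_lt,
    crossDensity_of_lt fun i j => lt_of_dilate_lt hs h_mean (fun i => h_lt i j) i,
    pairProd_add_const, ← ENNReal.ofReal_mul (Real.exp_pos _).le,
    ← ENNReal.ofReal_mul (Real.exp_pos _).le]
  refine ENNReal.ofReal_le_ofReal ?_
  simp only [Pi.smul_apply, Pi.add_apply, smul_eq_mul] at h_lt ⊢
  have h_nonneg : ∀ j i, 0 ≤ y j + (s - 1) * c - s * x i := fun j i => (sub_pos.2 (h_lt i j)).le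
  have h_prod_nonneg : 0 ≤ ∏ j, ∏ i, (y j + (s - 1) * c - s * x i) :=
    Finset.prod_nonneg fun j _ => Finset.prod_nonneg fun i _ => h_nonneg j i
  have h_prod : ∏ j, ∏ i, (y j + (s - 1) * c - s * x i) ≤ ∏ j, ∏ i, (y j - x i) := by
    refine Finset.prod_le_prod (fun j _ => Finset.prod_nonneg fun i _ => h_nonneg j i)
      fun j _ => ?_
    have h_dilate : ∀ i, y j + (s - 1) * c - s * x i =
        s * (y j - x i) - (s - 1) * (y j - c) := fun i => by ring
    have h_nonneg_j := h_nonneg j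
    simp only [h_dilate] at h_nonneg_j ⊢
    refine prod_dilate_le hs ?_ h_nonneg_j
    rw [Finset.sum_sub_distrib, ← h_mean, Finset.sum_const, Finset.card_univ, nsmul_eq_mul]
    ring
  have h_exp : Real.exp (∑ i, s * x i) * Real.exp (-∑ j, (y j + (s - 1) * c)) =
      Real.exp (∑ i, x i) * Real.exp (-∑ j, y j) := by
    rw [← Real.exp_add, ← Real.exp_add, ← Finset.mul_sum, Finset.sum_add_distrib,
      Finset.sum_const, Finset.card_univ, nsmul_eq_mul, hcard, ← h_mean]
    congr 1
    ring
  have h_pairProd := pairProd_nonneg y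
  rw [mul_left_comm, h_exp, mul_left_comm (Real.exp _) (_ * _)]
  gcongr

variable (κ) in
/-- The weight left on the lower points when the upper points, indexed by `κ`, are integrated out
of the Laguerre density. The factor `exp (∑ xᵢ)` makes it nonincreasing along rays. -/
noncomputable def radialWeight (x : ι → ℝ) : ENNReal :=
  ENNReal.ofReal (Real.exp (∑ i, x i)) * ∫⁻ y : κ → ℝ, crossDensity x y

theorem measurable_radialWeight : Measurable (radialWeight κ : (ι → ℝ) → ENNReal) :=
  (by fun_prop : Measurable fun x : ι → ℝ => ENNReal.ofReal (Real.exp (∑ i, x i))).mul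
    (measurable_crossDensity.lintegral_prod_right' (ν := volume))

-- Dilating `x` by `s` is compensated by translating `y` by `s - 1` times the mean of `x`.
theorem radialWeight_smul_le [Nonempty ι] (hcard : Fintype.card κ = Fintype.card ι) (x : ι → ℝ)
    {s : ℝ} (hs : 1 ≤ s) : radialWeight κ (s • x) ≤ radialWeight κ x := by
  have h_mean : (∑ i, x i) / Fintype.card ι * Fintype.card ι = ∑ i, x i :=
    div_mul_cancel₀ _ (by exact_mod_cast Fintype.card_ne_zero)
  rw [radialWeight, radialWeight, ← lintegral_add_right_eq_self _
      (fun _ : κ => (s - 1) * ((∑ i, x i) / Fintype.card ι)),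
    ← lintegral_const_mul' _ _ ENNReal.ofReal_ne_top,
    ← lintegral_const_mul' _ _ ENNReal.ofReal_ne_top]
  exact lintegral_mono fun y => exp_mul_crossDensity_smul_le hcard hs h_mean y

end LaguerreWeight

section Polar

theorem mul_add_mul_le_mul_add_mul_of_le {a b c d : ENNReal} (hab : a ≤ b) (hdc : d ≤ c) :
    a * c + b * d ≤ a * d + b * c := by
  obtain ⟨e, rfl⟩ := le_iff_exists_add.1 hab
  obtain ⟨f, rfl⟩ := le_iff_exists_add.1 hdc
  calc a * (d + f) + (a + e) * d ≤ a * (d + f) + (a + e) * d + e * f := le_self_add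
    _ = a * d + (a + e) * (d + f) := by ring

-- Chebyshev: integrate `(F a - F b) (u a - u b) ≤ 0` over `a` and `b`.
theorem lintegral_mul_le_of_monotoneOn_antitoneOn {ρ : Measure ℝ} [SFinite ρ]
    {F u : ℝ → ENNReal} {s : Set ℝ} (hs : ∀ᵐ b ∂ρ, b ∈ s) (hF : Measurable F) (hu : Measurable u)
    (hF_mono : MonotoneOn F s) (hu_anti : AntitoneOn u s) :
    ρ Set.univ * ∫⁻ b, F b * u b ∂ρ ≤ (∫⁻ b, F b ∂ρ) * ∫⁻ b, u b ∂ρ := by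
  have h_diag : ∫⁻ a, ∫⁻ b, (F a * u a + F b * u b) ∂ρ ∂ρ =
      2 * (ρ Set.univ * ∫⁻ b, F b * u b ∂ρ) := by
    simp only [lintegral_add_left measurable_const, lintegral_const]
    rw [lintegral_add_right _ measurable_const, lintegral_mul_const _ (by fun_prop),
      lintegral_const]
    ring
  have h_cross : ∫⁻ a, ∫⁻ b, (F a * u b + F b * u a) ∂ρ ∂ρ =
      2 * ((∫⁻ b, F b ∂ρ) * ∫⁻ b, u b ∂ρ) := by
    simp only [lintegral_add_left (hu.const_mul _), lintegral_const_mul _ hu,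
      lintegral_mul_const _ hF]
    rw [lintegral_add_left (hF.mul_const _), lintegral_mul_const _ hF, lintegral_const_mul _ hu]
    ring
  have h_le : ∫⁻ a, ∫⁻ b, (F a * u a + F b * u b) ∂ρ ∂ρ ≤
      ∫⁻ a, ∫⁻ b, (F a * u b + F b * u a) ∂ρ ∂ρ := by
    refine lintegral_mono_ae ?_
    filter_upwards [hs] with a ha
    refine lintegral_mono_ae ?_
    filter_upwards [hs] with b hb
    rcases le_total a b with hab | hba
    · exact mul_add_mul_le_mul_add_mul_of_le (hF_mono ha hb hab) (hu_anti ha hb hab)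
    · rw [add_comm (F a * u a), add_comm (F a * u b)]
      exact mul_add_mul_le_mul_add_mul_of_le (hF_mono hb ha hba) (hu_anti hb ha hba)
  rw [h_diag, h_cross] at h_le
  exact (ENNReal.mul_le_mul_iff_right (by simp) (by simp)).1 h_le

theorem lintegral_Ioi_comp_mul {a : ℝ} (ha : 0 < a) (f : ℝ → ENNReal) :
    ENNReal.ofReal a * ∫⁻ x in Set.Ioi (0 : ℝ), f (a * x) = ∫⁻ x in Set.Ioi (0 : ℝ), f x := by
  have h_emb : MeasurableEmbedding fun x : ℝ => a * x :=
    (Homeomorph.mulLeft₀ a ha.ne').measurableEmbedding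
  have h_map := Real.smul_map_volume_mul_left ha.ne'
  rw [abs_of_pos ha] at h_map
  have h_indicator : ∀ x : ℝ, (Set.Ioi (0 : ℝ)).indicator (fun x => f (a * x)) x =
      (Set.Ioi (0 : ℝ)).indicator f (a * x) := fun x => by
    simp [Set.indicator_apply, ha]
  rw [← lintegral_indicator measurableSet_Ioi, ← lintegral_indicator measurableSet_Ioi,
    lintegral_congr h_indicator,
    ← h_emb.lintegral_map (μ := volume) ((Set.Ioi (0 : ℝ)).indicator f)]
  conv_rhs => rw [← h_map, lintegral_smul_measure, smul_eq_mul]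

theorem lintegral_eq_lintegral_toSphere {E : Type*} [NormedAddCommGroup E] [NormedSpace ℝ E]
    [FiniteDimensional ℝ E] [Nontrivial E] [MeasurableSpace E] [BorelSpace E] (μ : Measure E)
    [μ.IsAddHaarMeasure] {f : E → ENNReal} (hf : Measurable f) :
    ∫⁻ x, f x ∂μ = ∫⁻ u : Metric.sphere (0 : E) 1, (∫⁻ r in Set.Ioi (0 : ℝ),
      ENNReal.ofReal (r ^ (Module.finrank ℝ E - 1)) * f (r • u.1)) ∂μ.toSphere := by
  have h_polar : ∫⁻ x : ({0}ᶜ : Set E), f x ∂μ.comap (↑) =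
      ∫⁻ p : Metric.sphere (0 : E) 1 × Set.Ioi (0 : ℝ), f (p.2.1 • p.1.1)
        ∂μ.toSphere.prod (.volumeIoiPow (Module.finrank ℝ E - 1)) := by
    rw [← μ.measurePreserving_homeomorphUnitSphereProd.lintegral_comp_emb
      (homeomorphUnitSphereProd E).measurableEmbedding]
    refine lintegral_congr fun x => ?_
    simp [smul_smul, mul_inv_cancel₀ (norm_ne_zero_iff.2 x.2)]
  have h_compl : ∫⁻ x, f x ∂μ = ∫⁻ x in {0}ᶜ, f x ∂μ := by
    rw [restrict_compl_singleton]
  rw [h_compl, ← lintegral_subtype_comap (measurableSet_singleton (0 : E)).compl, h_polar,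
    lintegral_prod _ (by fun_prop)]
  refine lintegral_congr fun u => ?_
  rw [Measure.volumeIoiPow, lintegral_withDensity_eq_lintegral_mul _ (by fun_prop) (by fun_prop),
    ← lintegral_subtype_comap measurableSet_Ioi]
  rfl

variable {ι : Type*} [Fintype ι]

variable (ι) in
/-- The unnormalized Laguerre ensemble at inverse temperature `2` on the points `xᵢ > 0`, whose
law of the sum is the one to which the smallest eigenvalues are compared. -/
noncomputable def pairEnsemble : Measure (ι → ℝ) :=
  (orthant ι).withDensity fun x => ENNReal.ofReal (pairProd x * Real.exp (-2 * ∑ i, x i))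

/-- The radial part of `pairEnsemble` in polar coordinates `x = b u`, `∑ uᵢ = 1`. -/
noncomputable def radialMeasure (n : ℕ) : Measure ℝ :=
  (volume.restrict (Set.Ioi 0)).withDensity
    fun b => ENNReal.ofReal (b ^ (n * n - 1) * Real.exp (-2 * b))

instance (n : ℕ) : SFinite (radialMeasure n) := by unfold radialMeasure; infer_instance

theorem ae_radialMeasure_pos (n : ℕ) : ∀ᵐ b ∂radialMeasure n, b ∈ Set.Ioi (0 : ℝ) :=
  (withDensity_absolutelyContinuous _ _).ae_le (ae_restrict_mem measurableSet_Ioi)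

/-- The weight of the direction of `u` in `pairEnsemble`. -/
noncomputable def angularWeight (u : ι → ℝ) : ENNReal :=
  (Set.univ.pi fun _ => Set.Ioi 0).indicator (fun u => ENNReal.ofReal
    (pairProd u * ((∑ i, u i) ^ (Fintype.card ι * Fintype.card ι))⁻¹)) u

theorem measurable_angularWeight : Measurable (angularWeight : (ι → ℝ) → ENNReal) := by
  have h_meas := (continuous_pairProd (ι := ι)).measurable
  exact Measurable.indicator (by fun_prop) (MeasurableSet.univ_pi fun _ => measurableSet_Ioi)

variable [Nonempty ι]

theorem lintegral_ray_pairEnsemble {f : (ι → ℝ) → ENNReal} (hf : Measurable f) {u : ι → ℝ}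
    (hu : 0 < ∑ i, u i) :
    ∫⁻ r in Set.Ioi (0 : ℝ), ENNReal.ofReal (r ^ (Fintype.card ι - 1)) *
        (ENNReal.ofReal (pairProd (r • u) * Real.exp (-2 * ∑ i, (r • u) i)) * f (r • u)) =
      ENNReal.ofReal (pairProd u * ((∑ i, u i) ^ (Fintype.card ι * Fintype.card ι))⁻¹) *
        ∫⁻ b, f ((b / ∑ i, u i) • u) ∂radialMeasure (Fintype.card ι) := by
  set n := Fintype.card ι with hn
  set σ := ∑ i, u i
  obtain ⟨m, hm⟩ : ∃ m, n = m + 1 := Nat.exists_eq_succ_of_ne_zero Fintype.card_ne_zero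
  rw [radialMeasure, lintegral_withDensity_eq_lintegral_mul _ (by fun_prop) (by fun_prop),
    ← lintegral_Ioi_comp_mul hu (_ * _), ← mul_assoc,
    ← lintegral_const_mul' _ _ (ENNReal.mul_ne_top ENNReal.ofReal_ne_top ENNReal.ofReal_ne_top)]
  refine setLIntegral_congr_fun measurableSet_Ioi fun r (hr : 0 < r) => ?_
  have h_pairProd := pairProd_nonneg u
  have h_sum : ∑ i, (r • u) i = σ * r := by
    simp only [Pi.smul_apply, smul_eq_mul, ← Finset.mul_sum, σ, mul_comm]
  simp only [Pi.mul_apply]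
  rw [mul_div_cancel_left₀ _ hu.ne', ← mul_assoc, ← mul_assoc, pairProd_smul hr.le, h_sum, ← hn,
    ← ENNReal.ofReal_mul (by positivity), ← ENNReal.ofReal_mul (by positivity),
    ← ENNReal.ofReal_mul (by positivity)]
  congr 2
  have h_exponent : n * n - 1 = (n - 1) + (n * n - n) := by
    rw [hm, add_mul, one_mul]; omega
  have h_pow : (σ ^ (n * n))⁻¹ * σ * σ ^ (n * n - 1) = 1 := by
    rw [mul_assoc, ← pow_succ', Nat.sub_add_cancel (by rw [hm]; nlinarith)]
    exact inv_mul_cancel₀ (by positivity)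
  calc r ^ (n - 1) * (r ^ (n * n - n) * pairProd u * Real.exp (-2 * (σ * r)))
      = r ^ (n * n - 1) * pairProd u * Real.exp (-2 * (σ * r)) := by
        rw [h_exponent, pow_add]; ring
    _ = r ^ (n * n - 1) * pairProd u * Real.exp (-2 * (σ * r)) *
          ((σ ^ (n * n))⁻¹ * σ * σ ^ (n * n - 1)) := by rw [h_pow, mul_one]
    _ = _ := by rw [mul_pow]; ring

theorem lintegral_pairEnsemble_polar {f : (ι → ℝ) → ENNReal} (hf : Measurable f) :
    ∫⁻ x, f x ∂pairEnsemble ι = ∫⁻ u, angularWeight u.1 *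
      ∫⁻ b, f ((b / ∑ i, u.1 i) • u.1) ∂radialMeasure (Fintype.card ι)
        ∂(volume : Measure (ι → ℝ)).toSphere := by
  have h_pairProd := (continuous_pairProd (ι := ι)).measurable
  have h_orthant : MeasurableSet (Set.univ.pi fun _ : ι => Set.Ioi (0 : ℝ)) :=
    MeasurableSet.univ_pi fun _ => measurableSet_Ioi
  rw [pairEnsemble, lintegral_withDensity_eq_lintegral_mul _ (by fun_prop) hf, orthant,
    ← Measure.restrict_pi_pi, ← lintegral_indicator h_orthant, ← volume_pi,
    lintegral_eq_lintegral_toSphere _ (Measurable.indicator (by fun_prop) h_orthant)]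
  refine lintegral_congr fun u => ?_
  rw [Module.finrank_fintype_fun_eq_card]
  have h_mem : ∀ r : ℝ, 0 < r → (r • u.1 ∈ Set.univ.pi (fun _ : ι => Set.Ioi (0 : ℝ)) ↔
      u.1 ∈ Set.univ.pi fun _ : ι => Set.Ioi (0 : ℝ)) := fun r hr => by simp [hr]
  by_cases hu : u.1 ∈ Set.univ.pi fun _ : ι => Set.Ioi (0 : ℝ)
  · rw [angularWeight, Set.indicator_of_mem hu, ← lintegral_ray_pairEnsemble hf
      (Finset.sum_pos (fun i _ => hu i trivial) Finset.univ_nonempty)]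
    refine setLIntegral_congr_fun measurableSet_Ioi fun r hr => ?_
    simp only [Set.indicator_of_mem ((h_mem r hr).2 hu), Pi.mul_apply]
  · rw [angularWeight, Set.indicator_of_notMem hu, zero_mul,
      setLIntegral_congr_fun measurableSet_Ioi (g := 0) fun r hr => by
        simp only [Set.indicator_of_notMem (mt (h_mem r hr).1 hu), mul_zero, Pi.zero_apply]]
    simp

theorem radialMeasure_mul_lintegral_ray_le {ι : Type*} {F : ℝ → ENNReal} (hF : Measurable F)
    (hF_mono : Monotone F) {w : (ι → ℝ) → ENNReal} (hw : Measurable w)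
    (hw_anti : ∀ (x : ι → ℝ) (s : ℝ), 1 ≤ s → w (s • x) ≤ w x) (n : ℕ) (u : ι → ℝ) (σ : ℝ) :
    radialMeasure n Set.univ * ∫⁻ b, F b * w ((b / σ) • u) ∂radialMeasure n ≤
      (∫⁻ b, F b ∂radialMeasure n) * ∫⁻ b, w ((b / σ) • u) ∂radialMeasure n := by
  refine lintegral_mul_le_of_monotoneOn_antitoneOn (ae_radialMeasure_pos n) hF
    (hw.comp (by fun_prop)) (hF_mono.monotoneOn _) fun b (hb : 0 < b) c _ hbc => ?_
  have h_ray : (c / σ) • u = (c / b) • ((b / σ) • u) := by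
    rw [smul_smul]
    congr 1
    field_simp
  simp only [h_ray]
  exact hw_anti _ _ ((one_le_div hb).2 hbc)

theorem sum_div_sum_smul {u : ι → ℝ} (hu : angularWeight u ≠ 0) (b : ℝ) :
    ∑ i, ((b / ∑ i, u i) • u) i = b := by
  have h_pos : 0 < ∑ i, u i := Finset.sum_pos
    (fun i _ => Set.mem_of_indicator_ne_zero hu i trivial) Finset.univ_nonempty
  simp only [Pi.smul_apply, smul_eq_mul, ← Finset.mul_sum, div_mul_cancel₀ _ h_pos.ne']

theorem lintegral_sum_mul_le_of_radial_antitone {F : ℝ → ENNReal} (hF : Measurable F)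
    (hF_mono : Monotone F) {w : (ι → ℝ) → ENNReal} (hw : Measurable w)
    (hw_anti : ∀ (x : ι → ℝ) (s : ℝ), 1 ≤ s → w (s • x) ≤ w x) :
    (∫⁻ x, F (∑ i, x i) * w x ∂pairEnsemble ι) * pairEnsemble ι Set.univ ≤
      (∫⁻ x, w x ∂pairEnsemble ι) * ∫⁻ x, F (∑ i, x i) ∂pairEnsemble ι := by
  set ρ := radialMeasure (Fintype.card ι)
  set τ := (volume : Measure (ι → ℝ)).toSphere
  set A := ∫⁻ u, angularWeight u.1 ∂τ
  have h_angular : Measurable fun u : Metric.sphere (0 : ι → ℝ) 1 => angularWeight u.1 :=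
    measurable_angularWeight.comp measurable_subtype_coe
  have h_ray_meas : Measurable fun u : Metric.sphere (0 : ι → ℝ) 1 =>
      ∫⁻ b, w ((b / ∑ i, u.1 i) • u.1) ∂ρ :=
    (hw.comp (by fun_prop : Measurable fun p : Metric.sphere (0 : ι → ℝ) 1 × ℝ =>
      (p.2 / ∑ i, p.1.1 i) • p.1.1)).lintegral_prod_right'
  have h_mass : pairEnsemble ι Set.univ = A * ρ Set.univ := by
    rw [← lintegral_one, lintegral_pairEnsemble_polar measurable_const]
    simp only [lintegral_one, lintegral_mul_const _ h_angular, ρ, τ, A]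
  have h_sum : ∫⁻ x, F (∑ i, x i) ∂pairEnsemble ι = A * ∫⁻ b, F b ∂ρ := by
    rw [lintegral_pairEnsemble_polar (by fun_prop), ← lintegral_mul_const _ h_angular]
    refine lintegral_congr fun u => ?_
    by_cases hu : angularWeight u.1 = 0
    · simp [hu]
    · simp only [sum_div_sum_smul hu, ρ]
  have h_weighted : ρ Set.univ * ∫⁻ x, F (∑ i, x i) * w x ∂pairEnsemble ι ≤
      (∫⁻ b, F b ∂ρ) * ∫⁻ x, w x ∂pairEnsemble ι := by
    rw [lintegral_pairEnsemble_polar (by fun_prop), lintegral_pairEnsemble_polar hw]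
    refine (lintegral_const_mul_le _ _).trans ?_
    rw [← lintegral_const_mul _ (by exact h_angular.mul h_ray_meas)]
    refine lintegral_mono fun u => ?_
    by_cases hu : angularWeight u.1 = 0
    · simp [hu]
    · simp only [sum_div_sum_smul hu]
      rw [mul_left_comm, mul_left_comm _ (angularWeight u.1)]
      exact mul_le_mul_right (radialMeasure_mul_lintegral_ray_le hF hF_mono hw hw_anti _ _ _) _
  calc (∫⁻ x, F (∑ i, x i) * w x ∂pairEnsemble ι) * pairEnsemble ι Set.univ
      = A * (ρ Set.univ * ∫⁻ x, F (∑ i, x i) * w x ∂pairEnsemble ι) := by rw [h_mass]; ring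
    _ ≤ A * ((∫⁻ b, F b ∂ρ) * ∫⁻ x, w x ∂pairEnsemble ι) := by gcongr
    _ = (∫⁻ x, w x ∂pairEnsemble ι) * ∫⁻ x, F (∑ i, x i) ∂pairEnsemble ι := by rw [h_sum]; ring

end Polar

section LowSum

variable {ι κ τ : Type*} [Fintype ι] [Fintype κ] [Fintype τ]

theorem pairProd_eq_prod_ite [DecidableEq ι] (x : ι → ℝ) :
    pairProd x = ∏ i, ∏ j, if i = j then 1 else |x i - x j| := by
  rw [pairProd, ← Finset.prod_product' (f := fun i j => if i = j then 1 else |x i - x j|)]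
  refine (Finset.prod_congr rfl fun p hp => ?_).trans
    (Finset.prod_subset (fun p _ => by simp) fun p _ hp => ?_)
  · rw [if_neg (by simpa using hp)]
  · rw [if_pos (by simpa using hp)]

theorem pairProd_comp_equiv (σ : τ ≃ ι) (x : ι → ℝ) : pairProd (x ∘ σ) = pairProd x := by
  classical
  rw [pairProd_eq_prod_ite, pairProd_eq_prod_ite, ← Equiv.prod_comp σ]
  refine Finset.prod_congr rfl fun i _ => ?_
  rw [← Equiv.prod_comp σ]
  simp

theorem pairProd_sumElim (u : ι → ℝ) (v : κ → ℝ) :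
    pairProd (Sum.elim u v) = pairProd u * pairProd v * (∏ j, ∏ i, (v j - u i)) ^ 2 := by
  classical
  simp only [pairProd_eq_prod_ite, Fintype.prod_sum_type, Sum.elim_inl, Sum.elim_inr,
    Sum.inl.injEq, Sum.inr.injEq, reduceCtorEq, if_false, Finset.prod_mul_distrib]
  have h_symm : ∏ j, ∏ i, |u i - v j| = ∏ j, ∏ i, |v j - u i| := by simp only [abs_sub_comm]
  rw [Finset.prod_comm (f := fun i j => |u i - v j|), h_symm, ← sq_abs (∏ j, ∏ i, (v j - u i))]
  simp only [Finset.abs_prod]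
  ring

theorem vandermondeSq_eq_pairProd {N : ℕ} (x : Fin N → ℝ) : vandermondeSq x = pairProd x := by
  have h_split : ∀ i j, (if i = j then 1 else |x i - x j|) =
      (if i < j then |x j - x i| else 1) * if j < i then |x i - x j| else 1 := by
    intro i j
    rcases lt_trichotomy i j with h_lt | h_eq | h_gt
    · simp [h_lt, h_lt.ne, h_lt.not_gt, abs_sub_comm]
    · simp [h_eq]
    · simp [h_gt, h_gt.ne', h_gt.not_gt]
  rw [pairProd_eq_prod_ite, vandermondeSq, ← sq_abs, sq]
  simp only [h_split, Finset.prod_mul_distrib]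
  rw [Finset.prod_comm (f := fun i j => if j < i then |x i - x j| else 1)]
  simp only [← Finset.prod_filter, Finset.abs_prod]
  congr 1 <;>
  · refine Finset.prod_congr rfl fun i _ => Finset.prod_congr ?_ fun _ _ => rfl
    ext; simp

theorem lintegral_pi_sum {α : Type*} [MeasurableSpace α] (ν : Measure α) [SigmaFinite ν]
    (σ : ι ⊕ κ ≃ τ) {f : (τ → α) → ENNReal} (hf : Measurable f) :
    ∫⁻ x, f x ∂(Measure.pi fun _ : τ => ν) =
      ∫⁻ u, ∫⁻ v, f (Sum.elim u v ∘ σ.symm) ∂(Measure.pi fun _ : κ => ν)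
        ∂(Measure.pi fun _ : ι => ν) := by
  have h_reindex := (measurePreserving_piCongrLeft (α := fun _ : τ => α) (fun _ => ν) σ).comp
    (measurePreserving_sumPiEquivProdPi_symm (ι := ι) (ι' := κ) (X := fun _ => α) fun _ => ν)
  rw [← h_reindex.lintegral_comp hf,
    lintegral_prod (fun p => f _) (hf.comp h_reindex.measurable).aemeasurable]
  refine lintegral_congr fun u => lintegral_congr fun v => ?_
  congr 1
  funext t
  obtain ⟨s, rfl⟩ := σ.surjective t
  simp only [Function.comp_apply, Equiv.symm_apply_apply]
  rw [MeasurableEquiv.coe_piCongrLeft, Equiv.piCongrLeft_apply_apply]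
  cases s <;> rfl

theorem orthant_eq_restrict :
    orthant ι = volume.restrict (Set.univ.pi fun _ : ι => Set.Ioi (0 : ℝ)) :=
  (Measure.restrict_pi_pi (fun _ : ι => (volume : Measure ℝ)) _).symm

theorem lintegral_crossDensity_orthant [Nonempty ι] {u : ι → ℝ} (hu : ∀ i, 0 < u i) :
    ∫⁻ v, crossDensity u v ∂orthant κ = ∫⁻ v : κ → ℝ, crossDensity u v := by
  rw [orthant_eq_restrict, ← lintegral_indicator
    (MeasurableSet.univ_pi fun _ => measurableSet_Ioi)]
  refine lintegral_congr fun v => ?_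
  rw [Set.indicator_eq_self.2]
  intro v hv
  have h_lt : ∀ i j, u i < v j := by
    by_contra h_not_lt
    exact hv (crossDensity_of_not_lt h_not_lt)
  exact fun j _ => (hu (Classical.arbitrary ι)).trans (h_lt _ j)

variable {N M L : ℕ}

/-- The configurations of `N` points whose lowest points are those indexed by `I`. -/
def lowestSet (I : Finset (Fin N)) : Set (Fin N → ℝ) := {x | ∀ i ∈ I, ∀ j ∈ Iᶜ, x i < x j}

theorem measurableSet_lowestSet (I : Finset (Fin N)) : MeasurableSet (lowestSet I) := by
  simp only [lowestSet, Set.ofPred_forall]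
  exact MeasurableSet.iInter fun i => MeasurableSet.iInter fun _ => MeasurableSet.iInter fun j =>
    MeasurableSet.iInter fun _ => measurableSet_lt (by fun_prop) (by fun_prop)

theorem forall_mem_iff_forall_orderEmbOfFin {s : Finset (Fin N)} (hs : s.card = M)
    {p : Fin N → Prop} : (∀ i ∈ s, p i) ↔ ∀ a, p (s.orderEmbOfFin hs a) := by
  rw [← Set.forall_mem_range, Finset.range_orderEmbOfFin]
  rfl

theorem sumElim_mem_lowestSet {I : Finset (Fin N)} (hI : I.card = M) (hIc : Iᶜ.card = L)
    (u : Fin M → ℝ) (v : Fin L → ℝ) :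
    Sum.elim u v ∘ (finSumEquivOfFinset hI hIc).symm ∈ lowestSet I ↔ ∀ i j, u i < v j := by
  simp only [lowestSet, Set.mem_ofPred_eq, forall_mem_iff_forall_orderEmbOfFin hI,
    forall_mem_iff_forall_orderEmbOfFin hIc, ← finSumEquivOfFinset_inl hI hIc,
    ← finSumEquivOfFinset_inr hI hIc, Function.comp_apply, Equiv.symm_apply_apply, Sum.elim_inl,
    Sum.elim_inr]

theorem sum_sumElim_comp_finSumEquivOfFinset {I : Finset (Fin N)} (hI : I.card = M)
    (hIc : Iᶜ.card = L) (u : Fin M → ℝ) (v : Fin L → ℝ) :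
    ∑ i ∈ I, (Sum.elim u v ∘ (finSumEquivOfFinset hI hIc).symm) i = ∑ i, u i := by
  have h_map := Finset.sum_map Finset.univ (I.orderEmbOfFin hI).toEmbedding
    (Sum.elim u v ∘ (finSumEquivOfFinset hI hIc).symm)
  rw [Finset.map_orderEmbOfFin_univ] at h_map
  rw [h_map]
  refine Finset.sum_congr rfl fun i _ => ?_
  rw [RelEmbedding.coe_toEmbedding, ← finSumEquivOfFinset_inl hI hIc, Function.comp_apply,
    Equiv.symm_apply_apply, Sum.elim_inl]

theorem ofReal_laguerreDensity_sumElim (σ : Fin M ⊕ Fin L ≃ Fin N) {u : Fin M → ℝ} {v : Fin L → ℝ}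
    (h_lt : ∀ i j, u i < v j) :
    ENNReal.ofReal (vandermondeSq (Sum.elim u v ∘ σ.symm) *
        Real.exp (-∑ t, (Sum.elim u v ∘ σ.symm) t)) =
      ENNReal.ofReal (pairProd u * Real.exp (-2 * ∑ i, u i)) *
        (ENNReal.ofReal (Real.exp (∑ i, u i)) * crossDensity u v) := by
  have h_sum : ∑ t, (Sum.elim u v ∘ σ.symm) t = ∑ i, u i + ∑ j, v j := by
    simp only [Function.comp_def, Equiv.sum_comp σ.symm (Sum.elim u v), Fintype.sum_sum_type,
      Sum.elim_inl, Sum.elim_inr]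
  have h_exp : Real.exp (-(∑ i, u i + ∑ j, v j)) =
      Real.exp (-2 * ∑ i, u i) * Real.exp (∑ i, u i) * Real.exp (-∑ j, v j) := by
    rw [← Real.exp_add, ← Real.exp_add]
    congr 1
    ring
  have h_nonneg := pairProd_nonneg u
  rw [crossDensity_of_lt h_lt, vandermondeSq_eq_pairProd, pairProd_comp_equiv, pairProd_sumElim,
    h_sum, h_exp, ← ENNReal.ofReal_mul (by positivity), ← ENNReal.ofReal_mul (by positivity)]
  congr 1
  ring

theorem lintegral_indicator_lowestSet_laguerre (hM : 0 < M) {I : Finset (Fin N)}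
    (hI : I.card = M) (hIc : Iᶜ.card = L) {F : ℝ → ENNReal} (hF : Measurable F) :
    ∫⁻ x, (lowestSet I).indicator (fun x => F (∑ i ∈ I, x i)) x ∂laguerre N =
      ∫⁻ u, F (∑ i, u i) * radialWeight (Fin L) u ∂pairEnsemble (Fin M) := by
  have : Nonempty (Fin M) := ⟨⟨0, hM⟩⟩
  set σ := finSumEquivOfFinset hI hIc
  have h_pairProd := (continuous_pairProd (ι := Fin M)).measurable
  have h_weight := measurable_radialWeight (ι := Fin M) (κ := Fin L)
  have h_indicator : Measurable ((lowestSet I).indicator fun x => F (∑ i ∈ I, x i)) :=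
    Measurable.indicator (by fun_prop) (measurableSet_lowestSet I)
  rw [laguerre, lintegral_withDensity_eq_lintegral_mul _ measurable_laguerreDensity h_indicator,
    lintegral_pi_sum _ σ (measurable_laguerreDensity.mul h_indicator), pairEnsemble,
    lintegral_withDensity_eq_lintegral_mul _ (by fun_prop) (by fun_prop)]
  refine lintegral_congr_ae ?_
  filter_upwards [ae_orthant_pos] with u hu
  have h_pointwise : ∀ v, ENNReal.ofReal (vandermondeSq (Sum.elim u v ∘ σ.symm) *
        Real.exp (-∑ t, (Sum.elim u v ∘ σ.symm) t)) *
        (lowestSet I).indicator (fun x => F (∑ i ∈ I, x i)) (Sum.elim u v ∘ σ.symm) =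
      ENNReal.ofReal (pairProd u * Real.exp (-2 * ∑ i, u i)) *
        (F (∑ i, u i) * ENNReal.ofReal (Real.exp (∑ i, u i))) * crossDensity u v := fun v => by
    by_cases h_lt : ∀ i j, u i < v j
    · rw [Set.indicator_of_mem ((sumElim_mem_lowestSet hI hIc u v).2 h_lt),
        sum_sumElim_comp_finSumEquivOfFinset, ofReal_laguerreDensity_sumElim σ h_lt]
      ring
    · rw [Set.indicator_of_notMem (mt (sumElim_mem_lowestSet hI hIc u v).1 h_lt),
        crossDensity_of_not_lt h_lt, mul_zero, mul_zero]
  simp only [Pi.mul_apply, h_pointwise]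
  rw [lintegral_const_mul _ (by exact measurable_crossDensity.comp measurable_prodMk_left),
    lintegral_crossDensity_orthant hu, radialWeight]
  ring

/-- The sum of the `M` smallest points. -/
def lowSum (M : ℕ) (y : Chamber N) : ℝ := ∑ i with (i : Fin N).1 < M, y.1 i

theorem measurable_lowSum : Measurable (lowSum M : Chamber N → ℝ) :=
  (continuous_finsetSum _ fun i _ => Chamber.continuous_apply i).measurable

theorem ae_laguerre_pos : ∀ᵐ x ∂laguerre N, ∀ i, 0 < x i :=
  (withDensity_absolutelyContinuous _ _).ae_le ae_orthant_pos

theorem ae_laguerre_injective : ∀ᵐ x ∂laguerre N, Function.Injective x := by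
  rw [laguerre, ae_withDensity_iff measurable_laguerreDensity]
  refine .of_forall fun x h_density i j hij => ?_
  by_contra h_ne
  refine h_density ?_
  rw [vandermondeSq_eq_pairProd, pairProd,
    Finset.prod_eq_zero (i := (i, j)) (by simpa using h_ne) (by simp [hij]), zero_mul,
    ENNReal.ofReal_zero]

theorem eq_of_mem_lowestSet {I J : Finset (Fin N)} (h_card : I.card = J.card) {x : Fin N → ℝ}
    (hI : x ∈ lowestSet I) (hJ : x ∈ lowestSet J) : I = J := by
  by_contra h_ne
  obtain ⟨i, hi, hi'⟩ := Finset.not_subset.1 fun h_subset =>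
    h_ne (Finset.eq_of_subset_of_card_le h_subset h_card.ge)
  obtain ⟨j, hj, hj'⟩ := Finset.not_subset.1 fun h_subset =>
    h_ne (Finset.eq_of_subset_of_card_le h_subset h_card.le).symm
  exact lt_asymm (hI i hi j (Finset.mem_compl.2 hj')) (hJ j hj i (Finset.mem_compl.2 hi'))

theorem exists_lowestSet_of_injective (hMN : M ≤ N) {x : Fin N → ℝ} (h_pos : ∀ i, 0 < x i)
    (h_inj : Function.Injective x) : ∃ I : Finset (Fin N), I.card = M ∧ x ∈ lowestSet I ∧
      lowSum M (sortChamber x) = ∑ i ∈ I, x i := by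
  have h_max : (fun i => max (x i) 0) = x := funext fun i => max_eq_left (h_pos i).le
  set τ := Tuple.sort x
  have h_mono : StrictMono (x ∘ τ) :=
    (Tuple.monotone_sort x).strictMono_of_injective (h_inj.comp τ.injective)
  refine ⟨(Finset.univ.filter fun i : Fin N => i.1 < M).map τ.toEmbedding, ?_, ?_, ?_⟩
  · simp [Fin.card_filter_val_lt, hMN]
  · intro i hi j hj
    simp only [Finset.mem_compl, Finset.mem_map_equiv, Finset.mem_filter, Finset.mem_univ,
      true_and] at hi hj
    have h_lt : τ.symm i < τ.symm j := by rw [Fin.lt_def]; omega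
    simpa using h_mono h_lt
  · simp only [Finset.sum_map, lowSum, sortChamber, h_max]
    rfl

theorem lowSum_sortChamber_eq (hMN : M ≤ N) (F : ℝ → ENNReal) {x : Fin N → ℝ}
    (h_pos : ∀ i, 0 < x i) (h_inj : Function.Injective x) :
    F (lowSum M (sortChamber x)) = ∑ I ∈ (Finset.univ : Finset (Fin N)).powersetCard M,
      (lowestSet I).indicator (fun x => F (∑ i ∈ I, x i)) x := by
  obtain ⟨I, hI_card, hI, h_lowSum⟩ := exists_lowestSet_of_injective hMN h_pos h_inj
  rw [Finset.sum_eq_single I, Set.indicator_of_mem hI, h_lowSum]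
  · intro J hJ h_ne
    refine Set.indicator_of_notMem (fun hJ' => h_ne (eq_of_mem_lowestSet ?_ hJ' hI)) _
    rw [hI_card, (Finset.mem_powersetCard.1 hJ).2]
  · exact fun hI' => absurd (Finset.mem_powersetCard.2 ⟨Finset.subset_univ _, hI_card⟩) hI'

theorem lintegral_lowSum_laguerre (hM : 0 < M) (hN : M + L = N) {F : ℝ → ENNReal}
    (hF : Measurable F) :
    ∫⁻ x, F (lowSum M (sortChamber x)) ∂laguerre N = (N.choose M : ENNReal) *
      ∫⁻ u, F (∑ i, u i) * radialWeight (Fin L) u ∂pairEnsemble (Fin M) := by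
  have h_decomp : ∀ᵐ x ∂laguerre N, F (lowSum M (sortChamber x)) =
      ∑ I ∈ (Finset.univ : Finset (Fin N)).powersetCard M,
        (lowestSet I).indicator (fun x => F (∑ i ∈ I, x i)) x := by
    filter_upwards [ae_laguerre_pos, ae_laguerre_injective] with x h_pos h_inj
    exact lowSum_sortChamber_eq (by omega) F h_pos h_inj
  rw [lintegral_congr_ae h_decomp, lintegral_finsetSum _ fun I _ =>
      Measurable.indicator (by fun_prop) (measurableSet_lowestSet I),
    Finset.sum_congr rfl fun I hI => lintegral_indicator_lowestSet_laguerre hM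
      (Finset.mem_powersetCard.1 hI).2 (L := L) ?_ hF]
  · simp [Finset.card_powersetCard]
  · rw [Finset.card_compl, (Finset.mem_powersetCard.1 hI).2, Fintype.card_fin]
    omega

theorem lintegral_orthant_comp_smul {a : ℝ} (ha : 0 < a) (f : (ι → ℝ) → ENNReal) :
    ∫⁻ x, f (a • x) ∂orthant ι =
      ENNReal.ofReal ((a ^ Fintype.card ι)⁻¹) * ∫⁻ x, f x ∂orthant ι := by
  have h_orthant : MeasurableSet (Set.univ.pi fun _ : ι => Set.Ioi (0 : ℝ)) :=
    MeasurableSet.univ_pi fun _ => measurableSet_Ioi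
  have h_map := Measure.map_addHaar_smul (volume : Measure (ι → ℝ)) ha.ne'
  rw [Module.finrank_fintype_fun_eq_card, abs_of_pos (by positivity)] at h_map
  have h_embedding : MeasurableEmbedding fun x : ι → ℝ => a • x :=
    (Homeomorph.smulOfNeZero a ha.ne').measurableEmbedding
  have h_indicator : ∀ x : ι → ℝ, (Set.univ.pi fun _ : ι => Set.Ioi (0 : ℝ)).indicator
      (fun x => f (a • x)) x =
      (Set.univ.pi fun _ : ι => Set.Ioi (0 : ℝ)).indicator f (a • x) := fun x => by
    classical
    simp [Set.indicator_apply, Set.mem_pi, ha]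
  rw [orthant_eq_restrict, ← lintegral_indicator h_orthant, ← lintegral_indicator h_orthant,
    lintegral_congr h_indicator, ← h_embedding.lintegral_map (μ := volume)
      ((Set.univ.pi fun _ : ι => Set.Ioi (0 : ℝ)).indicator f), h_map, lintegral_smul_measure,
    smul_eq_mul]

theorem lintegral_half_sum_laguerre {F : ℝ → ENNReal} (hF : Measurable F) :
    ∫⁻ x, F (1 / 2 * ∑ i, x i) ∂laguerre M = ENNReal.ofReal (2 ^ (M * M)) *
      ∫⁻ u, F (∑ i, u i) ∂pairEnsemble (Fin M) := by
  have h_pairProd := (continuous_pairProd (ι := Fin M)).measurable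
  rw [laguerre, lintegral_withDensity_eq_lintegral_mul _ measurable_laguerreDensity
    (by fun_prop), pairEnsemble, lintegral_withDensity_eq_lintegral_mul _ (by fun_prop)
    (by fun_prop)]
  simp only [Pi.mul_apply, vandermondeSq_eq_pairProd]
  have h_scale := lintegral_orthant_comp_smul (ι := Fin M) two_pos fun x =>
    ENNReal.ofReal (pairProd x * Real.exp (-∑ i, x i)) * F (1 / 2 * ∑ i, x i)
  have h_integrand : ∀ u : Fin M → ℝ,
      ENNReal.ofReal (pairProd ((2 : ℝ) • u) * Real.exp (-∑ i, ((2 : ℝ) • u) i)) *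
        F (1 / 2 * ∑ i, ((2 : ℝ) • u) i) =
      ENNReal.ofReal (2 ^ (M * M - M)) *
        (ENNReal.ofReal (pairProd u * Real.exp (-2 * ∑ i, u i)) * F (∑ i, u i)) := by
    intro u
    have h_sum : ∑ i, ((2 : ℝ) • u) i = 2 * ∑ i, u i := by simp [Finset.mul_sum]
    rw [h_sum, pairProd_smul zero_le_two, Fintype.card_fin, mul_assoc (2 ^ _),
      ENNReal.ofReal_mul (by positivity), ← mul_assoc (1 / 2 : ℝ), one_div,
      inv_mul_cancel₀ two_ne_zero, one_mul, neg_mul, mul_assoc]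
  have h_pow : ENNReal.ofReal (2 ^ (M * M)) =
      ENNReal.ofReal (2 ^ M) * ENNReal.ofReal (2 ^ (M * M - M)) := by
    rw [← ENNReal.ofReal_mul (by positivity), ← pow_add,
      Nat.add_sub_cancel' (Nat.le_mul_self M)]
  rw [lintegral_congr h_integrand, lintegral_const_mul' _ _ ENNReal.ofReal_ne_top,
    Fintype.card_fin] at h_scale
  rw [h_pow, mul_assoc, h_scale, ← mul_assoc, ← ENNReal.ofReal_mul (by positivity),
    mul_inv_cancel₀ (by positivity), ENNReal.ofReal_one, one_mul]

theorem laguerreMass_mul_lintegral_lowSum_le (hM : 0 < M) {F : ℝ → ENNReal} (hF : Measurable F)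
    (hF_mono : Monotone F) :
    ENNReal.ofReal (laguerreMass M) * ∫⁻ x, F (lowSum M (sortChamber x)) ∂laguerre (2 * M) ≤
      ENNReal.ofReal (laguerreMass (2 * M)) * ∫⁻ x, F (1 / 2 * ∑ i, x i) ∂laguerre M := by
  have : Nonempty (Fin M) := ⟨⟨0, hM⟩⟩
  have h_low_mass := lintegral_lowSum_laguerre hM (two_mul M).symm (F := fun _ => 1)
    measurable_const
  have h_half_mass := lintegral_half_sum_laguerre (M := M) (F := fun _ => 1) measurable_const
  simp only [lintegral_one, laguerre_univ, one_mul] at h_low_mass h_half_mass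
  rw [h_low_mass, h_half_mass, lintegral_lowSum_laguerre hM (two_mul M).symm hF,
    lintegral_half_sum_laguerre hF]
  have h_correlation := lintegral_sum_mul_le_of_radial_antitone (ι := Fin M) hF hF_mono
    (measurable_radialWeight (κ := Fin M)) fun x s hs => radialWeight_smul_le rfl x hs
  set c := ENNReal.ofReal (2 ^ (M * M))
  calc _ = c * ((2 * M).choose M : ENNReal) * ((∫⁻ u, F (∑ i, u i) * radialWeight (Fin M) u
          ∂pairEnsemble (Fin M)) * pairEnsemble (Fin M) Set.univ) := by ring
    _ ≤ c * ((2 * M).choose M : ENNReal) * ((∫⁻ u, radialWeight (Fin M) u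
          ∂pairEnsemble (Fin M)) * ∫⁻ u, F (∑ i, u i) ∂pairEnsemble (Fin M)) := by gcongr
    _ = _ := by ring

theorem laguerreMass_mul_lintegral_gramEigs {m n : Type*} [Fintype m] [Fintype n] [DecidableEq m]
    (e : Fin N ≃ m) (hn : Fintype.card n = N) {f : Chamber N → ENNReal} (hf : Measurable f) :
    ENNReal.ofReal (laguerreMass N) * ∫⁻ z, f (gramEigs e z) ∂gaussPi (m × n) =
      ∫⁻ x, f (sortChamber x) ∂laguerre N := by
  rw [← lintegral_map hf (measurable_gramEigs e), ← lintegral_map hf measurable_sortChamber,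
    ← laguerreMass_smul_map_gramEigs e hn, lintegral_smul_measure, smul_eq_mul]

theorem laguerreMass_mul_lintegral_sum_norm_sq {F : ℝ → ENNReal} (hF : Measurable F) :
    ENNReal.ofReal (laguerreMass M) *
        ∫⁻ z, F (1 / 2 * ∑ i, ‖z i‖ ^ 2) ∂gaussPi (Fin M × Fin M) =
      ∫⁻ x, F (1 / 2 * ∑ i, x i) ∂laguerre M := by
  have h_law := laguerreMass_mul_lintegral_gramEigs (n := Fin M) (Equiv.refl (Fin M))
    (Fintype.card_fin M) (f := fun y => F (1 / 2 * ∑ i, y.1 i)) (by fun_prop)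
  simp only [sum_gramEigs] at h_law
  rw [h_law]
  refine lintegral_congr_ae ?_
  filter_upwards [ae_laguerre_pos] with x hx
  have h_sum := congrFun (psumSeq_sortChamber fun i => (hx i).le) 1
  simp only [psumSeq, pow_one] at h_sum
  rw [h_sum]

theorem lintegral_lowSum_gramEigs_le {m n : Type*} [Fintype m] [Fintype n] [DecidableEq m]
    (hM : 0 < M) (e : Fin (2 * M) ≃ m) (hn : Fintype.card n = 2 * M) {F : ℝ → ENNReal}
    (hF : Measurable F) (hF_mono : Monotone F) :
    ∫⁻ z, F (lowSum M (gramEigs e z)) ∂gaussPi (m × n) ≤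
      ∫⁻ z, F (1 / 2 * ∑ i, ‖z i‖ ^ 2) ∂gaussPi (Fin M × Fin M) := by
  have h_le := laguerreMass_mul_lintegral_lowSum_le hM hF hF_mono
  rw [← laguerreMass_mul_lintegral_gramEigs e hn (f := fun y => F (lowSum M y))
      (hF.comp measurable_lowSum), ← laguerreMass_mul_lintegral_sum_norm_sq hF,
    mul_left_comm] at h_le
  have h_mass_ne : ∀ N, ENNReal.ofReal (laguerreMass N) ≠ 0 := fun N => by
    simpa using laguerreMass_pos
  exact (ENNReal.mul_le_mul_iff_right (h_mass_ne M) ENNReal.ofReal_ne_top).1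
    ((ENNReal.mul_le_mul_iff_right (h_mass_ne (2 * M)) ENNReal.ofReal_ne_top).1 h_le)

end LowSum

section UnitaryInvariance

variable {ι : Type*} [Fintype ι]

theorem integrable_gaussianDensity :
    Integrable fun z : ℂ => Real.pi⁻¹ * Real.exp (-‖z‖ ^ 2) := by
  refine .of_integral_ne_zero ?_
  have h_total := integral_stdComplexGaussian (fun _ => (1 : ℝ))
  simp only [integral_const, probReal_univ, smul_eq_mul, mul_one] at h_total
  rw [← h_total]
  exact one_ne_zero

theorem gaussPi_eq_withDensity :
    gaussPi ι = volume.withDensity fun z : ι → ℂ =>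
      ENNReal.ofReal (∏ i, (Real.pi⁻¹ * Real.exp (-‖z i‖ ^ 2))) := by
  rw [gaussPi]
  refine Measure.pi_eq fun s hs => ?_
  have h_restrict : (volume : Measure (ι → ℂ)).restrict (Set.univ.pi s) =
      Measure.pi fun i => (volume : Measure ℂ).restrict (s i) :=
    Measure.restrict_pi_pi (fun _ => volume) s
  rw [withDensity_apply _ (MeasurableSet.univ_pi hs), h_restrict,
    ← ofReal_integral_eq_lintegral_ofReal
      (Integrable.fintype_prod (f := fun _ z => Real.pi⁻¹ * Real.exp (-‖z‖ ^ 2))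
        fun i => integrable_gaussianDensity.mono_measure Measure.restrict_le_self)
      (.of_forall fun z => Finset.prod_nonneg fun i _ => by positivity),
    integral_fintype_prod_eq_prod (f := fun _ z => Real.pi⁻¹ * Real.exp (-‖z‖ ^ 2)),
    ENNReal.ofReal_prod_of_nonneg fun i _ => integral_nonneg fun z => by positivity]
  refine Finset.prod_congr rfl fun i _ => ?_
  rw [stdComplexGaussian_eq_withDensity, withDensity_apply _ (hs i),
    ofReal_integral_eq_lintegral_ofReal
      (integrable_gaussianDensity.mono_measure Measure.restrict_le_self)
      (.of_forall fun z => by positivity)]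

theorem det_restrictScalars_ne_zero {f : (ι → ℂ) →ₗ[ℂ] ι → ℂ}
    (hf : ∀ z, ∑ i, ‖f z i‖ ^ 2 = ∑ i, ‖z i‖ ^ 2) :
    LinearMap.det (f.restrictScalars ℝ) ≠ 0 := by
  refine fun h_det => (LinearMap.bot_lt_ker_of_det_eq_zero h_det).ne' ?_
  rw [LinearMap.ker_eq_bot']
  intro z hz
  have h_sum : ∑ i, ‖z i‖ ^ 2 = 0 := by
    rw [← hf z, show f z = 0 from hz]
    simp
  funext i
  simpa using (Finset.sum_eq_zero_iff_of_nonneg fun i _ => by positivity).1 h_sum i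
    (Finset.mem_univ i)

-- The image of the Gaussian law has a density proportional to the same function of the norm, and
-- both have total mass one.
theorem measurePreserving_gaussPi {f : (ι → ℂ) →ₗ[ℂ] ι → ℂ}
    (hf : ∀ z, ∑ i, ‖f z i‖ ^ 2 = ∑ i, ‖z i‖ ^ 2) :
    MeasurePreserving f (gaussPi ι) (gaussPi ι) := by
  have hf_meas : Measurable f := f.continuous_of_finiteDimensional.measurable
  set c := ENNReal.ofReal |(LinearMap.det (f.restrictScalars ℝ))⁻¹|
  have h_volume : (volume : Measure (ι → ℂ)).map f = c • volume :=
    Measure.map_linearMap_addHaar_eq_smul_addHaar _ (det_restrictScalars_ne_zero hf)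
  set ρ : (ι → ℂ) → ENNReal := fun z =>
    ENNReal.ofReal (∏ i, (Real.pi⁻¹ * Real.exp (-‖z i‖ ^ 2))) with hρ
  have hρ_meas : Measurable ρ := by fun_prop
  have hρ_comp : ∀ z, ρ (f z) = ρ z := fun z => by
    simp only [hρ, Finset.prod_mul_distrib, ← Real.exp_sum, Finset.sum_neg_distrib, hf z]
  have h_map : (gaussPi ι).map f = c • gaussPi ι := by
    rw [gaussPi_eq_withDensity, ← withDensity_smul_measure, ← h_volume]
    refine Measure.ext fun s hs => ?_
    rw [Measure.map_apply hf_meas hs, withDensity_apply _ (hf_meas hs), withDensity_apply _ hs]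
    exact (lintegral_congr fun z => (hρ_comp z).symm).trans
      (setLIntegral_map hs hρ_meas hf_meas).symm
  have h_one : c = 1 := by
    have h_univ := congrArg (· Set.univ) h_map
    simpa [Measure.map_apply hf_meas] using h_univ.symm
  exact ⟨hf_meas, by rw [h_map, h_one, one_smul]⟩

variable {r c : Type*} [Fintype r]

theorem re_trace_mul_conjTranspose [Fintype c] (X : Matrix r c ℂ) :
    (trace (X * Xᴴ)).re = ∑ i, ∑ j, ‖X i j‖ ^ 2 := by
  have h_trace := trace_matrixOfFamily_mul_conjTranspose fun p : r × c => X p.1 p.2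
  rw [show matrixOfFamily (fun p : r × c => X p.1 p.2) = X from rfl] at h_trace
  rw [h_trace, Complex.ofReal_re, Fintype.sum_prod_type]

/-- Multiplication by the matrix `V` from the left, acting on the families of entries on which the
Gaussian law `gaussPi (r × c)` lives. -/
def leftMul (V : Matrix r r ℂ) : (r × c → ℂ) →ₗ[ℂ] r × c → ℂ where
  toFun z p := (V * matrixOfFamily z) p.1 p.2
  map_add' z w := by
    funext p
    simp [matrixOfFamily, mul_apply, mul_add, Finset.sum_add_distrib]
  map_smul' a z := by
    funext p
    simp [matrixOfFamily, mul_apply, Finset.mul_sum, mul_left_comm]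

theorem matrixOfFamily_leftMul (V : Matrix r r ℂ) (z : r × c → ℂ) :
    matrixOfFamily (leftMul V z) = V * matrixOfFamily z := rfl

theorem measurePreserving_leftMul [Fintype c] [DecidableEq r] {V : Matrix r r ℂ}
    (hV : Vᴴ * V = 1) :
    MeasurePreserving (leftMul V) (gaussPi (r × c)) (gaussPi (r × c)) := by
  refine measurePreserving_gaussPi fun z => Complex.ofReal_injective ?_
  rw [← trace_matrixOfFamily_mul_conjTranspose, ← trace_matrixOfFamily_mul_conjTranspose,
    matrixOfFamily_leftMul, conjTranspose_mul, trace_mul_comm, Matrix.mul_assoc,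
    ← Matrix.mul_assoc Vᴴ, hV, Matrix.one_mul, trace_mul_comm]

end UnitaryInvariance

section ColumnProjection

variable {r c m : Type*} [Fintype r] [Fintype c] [DecidableEq c]

/-- The orthogonal projection onto the column space of a matrix of full column rank; the inverse
has the junk value `0` when the rank drops. -/
noncomputable def colProj (A : Matrix r c ℂ) : Matrix r r ℂ := A * (Aᴴ * A)⁻¹ * Aᴴ

open scoped MatrixOrder ComplexOrder Matrix.Norms.L2Operator in
-- The polar decomposition: `Q = A (Aᴴ A)^(-1/2)`.
theorem exists_isometry_of_isUnit {A : Matrix r c ℂ} (hA : IsUnit (Aᴴ * A)) :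
    ∃ Q : Matrix r c ℂ, Qᴴ * Q = 1 ∧ colProj A = Q * Qᴴ ∧ A * Aᴴ = Q * (Aᴴ * A) * Qᴴ := by
  have h_pos : (Aᴴ * A).PosDef :=
    (posSemidef_conjTranspose_mul_self A).posDef_iff_isUnit.2 hA
  set T := CFC.sqrt (Aᴴ * A)⁻¹
  have hT_sq : T * T = (Aᴴ * A)⁻¹ := CFC.sqrt_mul_sqrt_self _ h_pos.inv.posSemidef.nonneg
  have hT : Tᴴ = T := (CFC.sqrt_nonneg (Aᴴ * A)⁻¹).isSelfAdjoint
  have hT_conj : T * (Aᴴ * A) * T = 1 := by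
    rw [mul_eq_one_comm, ← Matrix.mul_assoc, hT_sq]
    exact nonsing_inv_mul _ ((isUnit_iff_isUnit_det _).1 hA)
  refine ⟨A * T, ?_, ?_, ?_⟩
  · rw [conjTranspose_mul, hT, ← hT_conj]
    simp only [Matrix.mul_assoc]
  · rw [colProj, ← hT_sq, conjTranspose_mul, hT]
    simp only [Matrix.mul_assoc]
  · rw [conjTranspose_mul, hT]
    calc A * Aᴴ = A * (T * (Aᴴ * A) * T) * Aᴴ := by rw [hT_conj, Matrix.mul_one]
      _ = A * T * (Aᴴ * A) * (T * Aᴴ) := by simp only [Matrix.mul_assoc]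

variable [DecidableEq r]

theorem colProj_unitary_mul {V : Matrix r r ℂ} (hV : Vᴴ * V = 1) (A : Matrix r c ℂ) :
    colProj (V * A) = V * colProj A * Vᴴ := by
  have h_gram : Aᴴ * Vᴴ * (V * A) = Aᴴ * A := by
    rw [Matrix.mul_assoc, ← Matrix.mul_assoc Vᴴ, hV, Matrix.one_mul]
  rw [colProj, colProj, conjTranspose_mul, h_gram]
  simp only [Matrix.mul_assoc]

theorem trace_one_sub_proj_mul_nonneg {Q : Matrix r c ℂ} (hQ : Qᴴ * Q = 1)
    [Fintype m] (X : Matrix r m ℂ) : 0 ≤ (trace ((1 - Q * Qᴴ) * (X * Xᴴ))).re := by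
  set R : Matrix r r ℂ := 1 - Q * Qᴴ with hR
  have hR_herm : Rᴴ = R := by simp [hR, conjTranspose_sub, conjTranspose_mul]
  have hR_idem : R * R = R := by
    have hQ_idem : Q * Qᴴ * (Q * Qᴴ) = Q * Qᴴ := by
      rw [Matrix.mul_assoc, ← Matrix.mul_assoc Qᴴ, hQ, Matrix.one_mul]
    exact IsIdempotentElem.one_sub hQ_idem
  have h_trace : trace (R * (X * Xᴴ)) = trace (R * X * (R * X)ᴴ) := by
    rw [conjTranspose_mul, hR_herm, ← Matrix.mul_assoc (R * X), trace_mul_comm _ R]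
    simp only [← Matrix.mul_assoc, hR_idem]
  rw [h_trace, re_trace_mul_conjTranspose]
  positivity

end ColumnProjection

section BlockIsometry

variable {r c c' m : Type*} [Fintype r] [DecidableEq r]

/-- The matrix of the isometry onto the coordinates in the first block of a splitting `σ` of the
row index; every isometry of the same size is a unitary multiple of it. -/
def blockIsometry (σ : c ⊕ c' ≃ r) : Matrix r c ℂ :=
  (1 : Matrix r r ℂ).submatrix id (σ ∘ Sum.inl)

variable (σ : c ⊕ c' ≃ r)

theorem mul_blockIsometry (V : Matrix m r ℂ) :
    V * blockIsometry σ = V.submatrix id (σ ∘ Sum.inl) := by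
  ext i j
  simp [blockIsometry, mul_apply, one_apply]

theorem conjTranspose_blockIsometry_mul (W : Matrix r m ℂ) :
    (blockIsometry σ)ᴴ * W = W.submatrix (σ ∘ Sum.inl) id := by
  rw [← conjTranspose_conjTranspose ((blockIsometry σ)ᴴ * W), conjTranspose_mul,
    conjTranspose_conjTranspose, mul_blockIsometry, conjTranspose_submatrix,
    conjTranspose_conjTranspose]

theorem conjTranspose_blockIsometry_mul_self [DecidableEq c] :
    (blockIsometry σ)ᴴ * blockIsometry σ = 1 := by
  rw [conjTranspose_blockIsometry_mul, blockIsometry, submatrix_submatrix]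
  exact submatrix_one _ (σ.injective.comp Sum.inl_injective)

theorem trace_one_sub_blockIsometry_mul [Fintype c] [Fintype c'] [Fintype m] (W : Matrix r m ℂ) :
    (trace ((1 - blockIsometry σ * (blockIsometry σ)ᴴ) * (W * Wᴴ))).re =
      ∑ p : c' × m, ‖W (σ (.inr p.1)) p.2‖ ^ 2 := by
  have h_block : trace (blockIsometry σ * (blockIsometry σ)ᴴ * (W * Wᴴ)) =
      trace ((blockIsometry σ)ᴴ * W * ((blockIsometry σ)ᴴ * W)ᴴ) := by
    rw [conjTranspose_mul, conjTranspose_conjTranspose, Matrix.mul_assoc, trace_mul_comm]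
    simp only [Matrix.mul_assoc]
  rw [Matrix.sub_mul, Matrix.one_mul, trace_sub, Complex.sub_re, h_block,
    re_trace_mul_conjTranspose, re_trace_mul_conjTranspose, conjTranspose_blockIsometry_mul,
    ← Equiv.sum_comp σ, Fintype.sum_sum_type, Fintype.sum_prod_type]
  simp

theorem exists_unitary_mul_blockIsometry [DecidableEq c] {Q : Matrix r c ℂ} (hQ : Qᴴ * Q = 1) :
    ∃ V : Matrix r r ℂ, Vᴴ * V = 1 ∧ V * blockIsometry σ = Q := by
  let v : r → EuclideanSpace ℂ r := fun i => WithLp.toLp 2 fun k =>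
    Sum.elim (fun j => Q k j) (fun _ => 0) (σ.symm i)
  have h_inner : ∀ i j : c, inner ℂ (v (σ (.inl i))) (v (σ (.inl j))) =
      (1 : Matrix c c ℂ) i j := fun i j => by
    rw [← hQ, mul_apply, PiLp.inner_apply]
    simp [v, mul_comm]
  have h_orthonormal : Orthonormal ℂ ((Set.range (σ ∘ Sum.inl)).domRestrict v) := by
    rw [orthonormal_iff_ite]
    rintro ⟨_, i, rfl⟩ ⟨_, j, rfl⟩
    simpa [one_apply] using h_inner i j
  obtain ⟨b, hb⟩ := h_orthonormal.exists_orthonormalBasis_extension_of_card_eq (by simp)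
  refine ⟨Matrix.of fun k i => b i k, ?_, ?_⟩
  · ext i j
    rw [mul_apply, one_apply, ← orthonormal_iff_ite.1 b.orthonormal i j, PiLp.inner_apply]
    simp [mul_comm]
  · rw [mul_blockIsometry]
    ext k j
    simp [hb (σ (.inl j)) ⟨j, rfl⟩, v]

end BlockIsometry

section FullRank

theorem measurePreserving_precomp {ι τ α : Type*} [Fintype ι] [Fintype τ] [MeasurableSpace α]
    (ν : Measure α) [IsProbabilityMeasure ν] {q : ι → τ} (hq : Function.Injective q) :
    MeasurePreserving (fun x : τ → α => x ∘ q) (Measure.pi fun _ => ν) (Measure.pi fun _ => ν) := by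
  have h_indep : iIndepFun (fun i (x : τ → α) => x (q i)) (Measure.pi fun _ => ν) :=
    (iIndepFun_pi (X := fun _ => id) fun _ => aemeasurable_id).precomp hq
  refine ⟨by fun_prop, ?_⟩
  rw [← (h_indep.hasLaw_pi fun i => (measurePreserving_eval (fun _ => ν) (q i)).hasLaw).map_eq]
  rfl

variable {r c c' : Type*} [Fintype r] [Fintype c]

theorem ae_gramEigs_pos [DecidableEq r] {N : ℕ} (e : Fin N ≃ r) (hc : Fintype.card c = N) :
    ∀ᵐ z ∂gaussPi (r × c), ∀ i, 0 < (gramEigs e z).1 i := by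
  have h_meas : MeasurableSet {y : Chamber N | ∀ i, 0 < y.1 i} := by
    simp only [Set.ofPred_forall]
    exact .iInter fun i => measurableSet_lt measurable_const
      (Chamber.continuous_apply i).measurable
  have h_chamber : ∀ᵐ y ∂(laguerre N).map sortChamber, ∀ i, 0 < y.1 i := by
    rw [ae_map_iff measurable_sortChamber.aemeasurable h_meas]
    exact ae_laguerre_pos.mono fun x hx i => lt_max_of_lt_left (hx _)
  rw [← laguerreMass_smul_map_gramEigs e hc,
    Measure.ae_ennreal_smul_measure_iff (by simpa using laguerreMass_pos),
    ae_map_iff (measurable_gramEigs e).aemeasurable h_meas] at h_chamber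
  exact h_chamber

open scoped ComplexOrder in
theorem isUnit_of_gramEigs_pos [DecidableEq r] {N : ℕ} {e : Fin N ≃ r} {z : r × c → ℂ}
    (hz : ∀ i, 0 < (gramEigs e z).1 i) :
    IsUnit (matrixOfFamily z * (matrixOfFamily z)ᴴ) := by
  have h_herm := isHermitian_mul_conjTranspose_self (matrixOfFamily z)
  refine (h_herm.posDef_iff_eigenvalues_pos.2 fun i => ?_).isUnit
  obtain ⟨j, rfl⟩ := e.surjective i
  have h_pos := hz ((Tuple.sort fun i => max (h_herm.eigenvalues (e i)) 0).symm j)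
  simp only [gramEigs, sortChamber, Function.comp_apply, Equiv.apply_symm_apply] at h_pos
  exact (lt_max_iff.1 h_pos).resolve_right (lt_irrefl 0)

open scoped ComplexOrder in
theorem isUnit_gram_submatrix_of_isUnit [DecidableEq r] [DecidableEq c] {Z : Matrix r r ℂ}
    (hZ : IsUnit Z) {q : c → r} (hq : Function.Injective q) :
    IsUnit ((Z.submatrix id q)ᴴ * Z.submatrix id q) := by
  have h_left : Z⁻¹.submatrix q id * Z.submatrix id q = 1 := by
    rw [← submatrix_mul _ _ q id q Function.bijective_id,
      nonsing_inv_mul _ ((isUnit_iff_isUnit_det _).1 hZ), submatrix_one _ hq]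
  have h_inj : Function.Injective (Z.submatrix id q).mulVec :=
    Function.LeftInverse.injective (g := (Z⁻¹.submatrix q id).mulVec) fun x => by
      rw [mulVec_mulVec, h_left, one_mulVec]
  exact (PosDef.conjTranspose_mul_self _ h_inj).isUnit

theorem ae_isUnit_conjTranspose_mul_self [DecidableEq c] (q : c ↪ r) :
    ∀ᵐ z ∂gaussPi (r × c), IsUnit ((matrixOfFamily z)ᴴ * matrixOfFamily z) := by
  classical
  have h_restrict := measurePreserving_precomp (τ := r × r) stdComplexGaussian
    (Function.injective_id.prodMap q.injective)
  have h_meas : MeasurableSet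
      {z : r × c → ℂ | IsUnit ((matrixOfFamily z)ᴴ * matrixOfFamily z)} := by
    simp only [Matrix.isUnit_iff_isUnit_det, isUnit_iff_ne_zero]
    exact (isOpen_ne_fun (continuous_matrixOfFamily.matrix_conjTranspose.matrix_mul
      continuous_matrixOfFamily).matrix_det continuous_const).measurableSet
  rw [gaussPi, ← h_restrict.map_eq, ae_map_iff h_restrict.aemeasurable h_meas]
  filter_upwards [ae_gramEigs_pos (Fintype.equivFin r).symm rfl] with z hz
  have hZ := isUnit_of_mul_isUnit_left (isUnit_of_gramEigs_pos hz)
  exact isUnit_gram_submatrix_of_isUnit hZ q.injective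

end FullRank

section RandomColumnSpace

theorem measurable_mul_apply {α m n k : Type*} [MeasurableSpace α] [Fintype n]
    {A : α → Matrix m n ℂ} {B : α → Matrix n k ℂ} (hA : ∀ i j, Measurable fun a => A a i j)
    (hB : ∀ i j, Measurable fun a => B a i j) (i : m) (j : k) :
    Measurable fun a => (A a * B a) i j := by
  simp only [mul_apply]
  exact Finset.measurable_sum _ fun l _ => (hA i l).mul (hB l j)

variable {r c c' : Type*} [Fintype r] [Fintype c] [DecidableEq c]

theorem measurable_colProj_apply (i j : r) :
    Measurable fun z : r × c → ℂ => colProj (matrixOfFamily z) i j := by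
  have h_gram : Continuous fun z : r × c → ℂ => (matrixOfFamily z)ᴴ * matrixOfFamily z :=
    continuous_matrixOfFamily.matrix_conjTranspose.matrix_mul continuous_matrixOfFamily
  have h_inv : ∀ k l,
      Measurable fun z : r × c → ℂ => ((matrixOfFamily z)ᴴ * matrixOfFamily z)⁻¹ k l :=
    fun k l => by
      simp only [Matrix.inv_def, Matrix.smul_apply, Ring.inverse_eq_inv', smul_eq_mul]
      exact h_gram.matrix_det.measurable.inv.mul
        (h_gram.matrix_adjugate.matrix_elem k l).measurable
  exact measurable_mul_apply (measurable_mul_apply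
    (fun i j => (continuous_matrixOfFamily.matrix_elem i j).measurable) h_inv)
    (fun i j => (continuous_matrixOfFamily.matrix_conjTranspose.matrix_elem i j).measurable) i j

variable [DecidableEq r]

/-- The part of the trace of `B` off the column space of `A`; for `B = X Xᴴ` it is the squared
distance of `X`, column by column, to that space. -/
noncomputable def offTrace (A : Matrix r c ℂ) (B : Matrix r r ℂ) : ℝ :=
  (trace ((1 - colProj A) * B)).re

theorem measurable_offTrace {α : Type*} [MeasurableSpace α] {Z : α → r × c → ℂ}
    (hZ : Measurable Z) {B : α → Matrix r r ℂ} (hB : ∀ i j, Measurable fun a => B a i j) :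
    Measurable fun a => offTrace (matrixOfFamily (Z a)) (B a) :=
  Complex.measurable_re.comp (Finset.measurable_sum _ fun i _ => measurable_mul_apply
    (fun k l => ((measurable_colProj_apply k l).comp hZ).const_sub ((1 : Matrix r r ℂ) k l))
    hB i i)

theorem lintegral_offTrace_swap {B : (r × c → ℂ) → Matrix r r ℂ}
    (hB : ∀ i j, Measurable fun w => B w i j) {E : ℝ → ENNReal} (hE : Measurable E) :
    ∫⁻ z : r × c → ℂ, ∫⁻ w, E (offTrace (matrixOfFamily z) (B w))
        ∂gaussPi (r × c) ∂gaussPi (r × c) =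
      ∫⁻ w, ∫⁻ z : r × c → ℂ, E (offTrace (matrixOfFamily z) (B w))
        ∂gaussPi (r × c) ∂gaussPi (r × c) := by
  have h_meas : Measurable (Function.uncurry fun (z : r × c → ℂ) (w : r × c → ℂ) =>
      E (offTrace (matrixOfFamily z) (B w))) := 
    hE.comp (measurable_offTrace measurable_fst fun i j => (hB i j).comp measurable_snd)
  exact lintegral_lintegral_swap h_meas.aemeasurable

theorem offTrace_unitary_conj {V : Matrix r r ℂ} (hV : Vᴴ * V = 1) (A : Matrix r c ℂ)
    (B : Matrix r r ℂ) : offTrace (V * A) (V * B * Vᴴ) = offTrace A B := by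
  have h_proj : 1 - colProj (V * A) = V * (1 - colProj A) * Vᴴ := by
    rw [colProj_unitary_mul hV, Matrix.mul_sub, Matrix.sub_mul, Matrix.mul_one,
      mul_eq_one_comm.1 hV]
  rw [offTrace, offTrace, h_proj]
  congr 1
  calc trace (V * (1 - colProj A) * Vᴴ * (V * B * Vᴴ))
      = trace (V * ((1 - colProj A) * (Vᴴ * V) * B * Vᴴ)) := by simp only [Matrix.mul_assoc]
    _ = trace ((1 - colProj A) * B * (Vᴴ * V)) := by
        rw [trace_mul_comm, hV]
        simp only [Matrix.mul_assoc, Matrix.mul_one, hV]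
    _ = trace ((1 - colProj A) * B) := by rw [hV, Matrix.mul_one]

theorem lintegral_offTrace_unitary_conj {V : Matrix r r ℂ} (hV : Vᴴ * V = 1) (B : Matrix r r ℂ)
    {E : ℝ → ENNReal} (hE : Measurable E) :
    ∫⁻ z : r × c → ℂ, E (offTrace (matrixOfFamily z) (V * B * Vᴴ)) ∂gaussPi (r × c) =
      ∫⁻ z : r × c → ℂ, E (offTrace (matrixOfFamily z) B) ∂gaussPi (r × c) := by
  have h_meas : Measurable fun z : r × c → ℂ => E (offTrace (matrixOfFamily z) (V * B * Vᴴ)) :=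
    hE.comp (measurable_offTrace measurable_id fun _ _ => measurable_const)
  rw [← (measurePreserving_leftMul hV).lintegral_comp h_meas]
  simp only [matrixOfFamily_leftMul, offTrace_unitary_conj hV]

theorem lintegral_offTrace_isometry_conj (σ : c ⊕ c' ≃ r) {Q : Matrix r c ℂ} (hQ : Qᴴ * Q = 1)
    (S : Matrix c c ℂ) {E : ℝ → ENNReal} (hE : Measurable E) :
    ∫⁻ z : r × c → ℂ, E (offTrace (matrixOfFamily z) (Q * S * Qᴴ)) ∂gaussPi (r × c) =
      ∫⁻ z : r × c → ℂ, E (offTrace (matrixOfFamily z)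
        (blockIsometry σ * S * (blockIsometry σ)ᴴ)) ∂gaussPi (r × c) := by
  obtain ⟨V, hV, rfl⟩ := exists_unitary_mul_blockIsometry σ hQ
  rw [← lintegral_offTrace_unitary_conj hV (blockIsometry σ * S * (blockIsometry σ)ᴴ) hE]
  simp only [conjTranspose_mul, Matrix.mul_assoc]

-- Given `W`, the law of the column space of `Z` does not see the unitary part of `W`.
theorem lintegral_offTrace_gram (σ : c ⊕ c' ≃ r) {E : ℝ → ENNReal} (hE : Measurable E) :
    ∫⁻ z : r × c → ℂ, ∫⁻ w : r × c → ℂ, E (offTrace (matrixOfFamily z)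
        (matrixOfFamily w * (matrixOfFamily w)ᴴ)) ∂gaussPi (r × c) ∂gaussPi (r × c) =
      ∫⁻ z : r × c → ℂ, ∫⁻ w : r × c → ℂ, E (offTrace (matrixOfFamily z)
        (blockIsometry σ * ((matrixOfFamily w)ᴴ * matrixOfFamily w) * (blockIsometry σ)ᴴ))
          ∂gaussPi (r × c) ∂gaussPi (r × c) := by
  have h_cont := continuous_matrixOfFamily (m := r) (n := c)
  rw [lintegral_offTrace_swap (fun i j => ((h_cont.matrix_mul
      h_cont.matrix_conjTranspose).matrix_elem i j).measurable) hE,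
    lintegral_offTrace_swap (fun i j => (((continuous_const.matrix_mul
      (h_cont.matrix_conjTranspose.matrix_mul h_cont)).matrix_mul
      continuous_const).matrix_elem i j).measurable) hE]
  refine lintegral_congr_ae ?_
  filter_upwards [ae_isUnit_conjTranspose_mul_self
    (Function.Embedding.inl.trans σ.toEmbedding)] with w hw
  obtain ⟨Q, hQ, -, hwQ⟩ := exists_isometry_of_isUnit hw
  rw [hwQ, lintegral_offTrace_isometry_conj σ hQ _ hE]

theorem lintegral_offTrace_colProj (σ : c ⊕ c' ≃ r) {E : ℝ → ENNReal} (hE : Measurable E) :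
    ∫⁻ z : r × c → ℂ, ∫⁻ w : r × c → ℂ, E (offTrace (matrixOfFamily z)
        (colProj (matrixOfFamily w))) ∂gaussPi (r × c) ∂gaussPi (r × c) =
      ∫⁻ z : r × c → ℂ, E (offTrace (matrixOfFamily z)
        (blockIsometry σ * (blockIsometry σ)ᴴ)) ∂gaussPi (r × c) := by
  rw [lintegral_offTrace_swap measurable_colProj_apply hE]
  refine (lintegral_congr_ae ?_).trans (by rw [lintegral_const, measure_univ, mul_one])
  filter_upwards [ae_isUnit_conjTranspose_mul_self
    (Function.Embedding.inl.trans σ.toEmbedding)] with w hw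
  obtain ⟨Q, hQ, hwQ, -⟩ := exists_isometry_of_isUnit hw
  have h_conj := lintegral_offTrace_isometry_conj σ hQ 1 hE
  rwa [Matrix.mul_one, Matrix.mul_one, ← hwQ] at h_conj

end RandomColumnSpace

section GramMoments

theorem integrable_mul_conj_gaussPi {ι : Type*} [Fintype ι] (p q : ι) :
    Integrable (fun z : ι → ℂ => z q * starRingEnd ℂ (z p)) (gaussPi ι) := by
  have h_int :=
    integrable_conjEval 0 (MvPolynomial.X (Sum.inl q) * MvPolynomial.X (Sum.inr p : ι ⊕ ι))
  simp only [conjEval, map_mul, MvPolynomial.eval_X] at h_int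
  simpa using h_int

theorem integral_mul_conj_gaussPi {ι : Type*} [Fintype ι] [DecidableEq ι] (p q : ι) :
    ∫ z, z q * starRingEnd ℂ (z p) ∂gaussPi ι = if q = p then 1 else 0 := by
  have h_parts := gaussFunctional_X_mul 0 q (MvPolynomial.X (Sum.inr p))
  rw [MvPolynomial.pderiv_X, Nat.cast_zero, add_zero, one_mul] at h_parts
  have h_functional : gaussFunctional ι 0
        (MvPolynomial.X (Sum.inl q) * MvPolynomial.X (Sum.inr p)) =
      ∫ z, z q * starRingEnd ℂ (z p) ∂gaussPi ι := by
    simp [gaussFunctional, conjEval]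
  rw [← h_functional, h_parts]
  by_cases hqp : q = p
  · subst hqp
    simp [gaussFunctional_one]
  · rw [Pi.single_eq_of_ne (by simpa [eq_comm] using hqp), map_zero, if_neg hqp]

variable {r c : Type*} [Fintype r]

theorem gram_matrixOfFamily_apply (w : r × c → ℂ) (i j : c) :
    ((matrixOfFamily w)ᴴ * matrixOfFamily w) i j =
      ∑ k, w (k, j) * starRingEnd ℂ (w (k, i)) := by
  simp [mul_apply, matrixOfFamily, mul_comm]

variable [Fintype c]

theorem integrable_gram_apply (i j : c) :
    Integrable (fun w : r × c → ℂ => ((matrixOfFamily w)ᴴ * matrixOfFamily w) i j)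
      (gaussPi (r × c)) := by
  simp only [gram_matrixOfFamily_apply]
  exact integrable_finsetSum _ fun k _ => integrable_mul_conj_gaussPi _ _

theorem integral_gram_apply [DecidableEq c] (i j : c) :
    ∫ w : r × c → ℂ, ((matrixOfFamily w)ᴴ * matrixOfFamily w) i j ∂gaussPi (r × c) =
      Fintype.card r * (1 : Matrix c c ℂ) i j := by
  classical
  simp only [gram_matrixOfFamily_apply]
  rw [integral_finsetSum _ fun k _ => integrable_mul_conj_gaussPi _ _]
  simp only [integral_mul_conj_gaussPi, Prod.mk.injEq, true_and, one_apply, eq_comm (a := j),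
    Finset.sum_const, Finset.card_univ, nsmul_eq_mul]

theorem integrable_trace_mul_gram (A : Matrix c c ℂ) :
    Integrable (fun w : r × c → ℂ => trace (A * ((matrixOfFamily w)ᴴ * matrixOfFamily w)))
      (gaussPi (r × c)) := by
  simp only [trace, diag_apply, Matrix.mul_apply (M := A)]
  exact integrable_finsetSum _ fun i _ => integrable_finsetSum _ fun j _ =>
    (integrable_gram_apply j i).const_mul _

theorem integral_trace_mul_gram (A : Matrix c c ℂ) :
    ∫ w : r × c → ℂ, trace (A * ((matrixOfFamily w)ᴴ * matrixOfFamily w)) ∂gaussPi (r × c) =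
      Fintype.card r * trace A := by
  classical
  have h_int : ∀ i j, Integrable (fun w : r × c → ℂ =>
      A i j * ((matrixOfFamily w)ᴴ * matrixOfFamily w) j i) (gaussPi (r × c)) := fun i j =>
    (integrable_gram_apply j i).const_mul _
  simp only [trace, diag_apply, Matrix.mul_apply (M := A)]
  rw [integral_finsetSum _ fun i _ => integrable_finsetSum _ fun j _ => h_int i j, Finset.mul_sum]
  refine Finset.sum_congr rfl fun i _ => ?_
  rw [integral_finsetSum _ fun j _ => h_int i j]
  simp only [integral_const_mul, integral_gram_apply]
  rw [Finset.sum_eq_single i (fun j _ hji => by simp [one_apply_ne hji]) (by simp), one_apply_eq]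
  ring

end GramMoments

section ConditionalJensen

variable {r c c' m n : Type*} [Fintype r] [Fintype c] [DecidableEq c]

theorem colProj_of_isometry {Q : Matrix r c ℂ} (hQ : Qᴴ * Q = 1) : colProj Q = Q * Qᴴ := by
  rw [colProj, hQ, inv_one, Matrix.mul_one]

variable [DecidableEq r]

theorem continuous_offTrace_gaussian [Fintype m] (A : Matrix r c ℂ) :
    Continuous fun w : r × m → ℂ => offTrace A (matrixOfFamily w * (matrixOfFamily w)ᴴ) :=
  have h_cont := continuous_matrixOfFamily (m := r) (n := m)
  Complex.continuous_re.comp (continuous_const.matrix_mul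
    (h_cont.matrix_mul h_cont.matrix_conjTranspose)).matrix_trace

theorem lintegral_offTrace_gaussian [Fintype m] [Fintype c'] (σ : c ⊕ c' ≃ r) {A : Matrix r c ℂ}
    (hA : IsUnit (Aᴴ * A)) {E : ℝ → ENNReal} (hE : Measurable E) :
    ∫⁻ w : r × m → ℂ, E (offTrace A (matrixOfFamily w * (matrixOfFamily w)ᴴ)) ∂gaussPi (r × m) =
      ∫⁻ y, E (∑ p, ‖y p‖ ^ 2) ∂gaussPi (c' × m) := by
  obtain ⟨Q, hQ, hAQ, -⟩ := exists_isometry_of_isUnit hA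
  obtain ⟨V, hV, rfl⟩ := exists_unitary_mul_blockIsometry σ hQ
  have h_off : ∀ w : r × m → ℂ, offTrace A (matrixOfFamily (leftMul V w) *
      (matrixOfFamily (leftMul V w))ᴴ) = ∑ p : c' × m, ‖w (σ (.inr p.1), p.2)‖ ^ 2 := fun w => by
    have h_conj : matrixOfFamily (leftMul V w) * (matrixOfFamily (leftMul V w))ᴴ =
        V * (matrixOfFamily w * (matrixOfFamily w)ᴴ) * Vᴴ := by
      simp only [matrixOfFamily_leftMul, conjTranspose_mul, Matrix.mul_assoc]
    rw [offTrace, hAQ, ← colProj_of_isometry hQ, ← offTrace, h_conj, offTrace_unitary_conj hV,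
      offTrace, colProj_of_isometry (conjTranspose_blockIsometry_mul_self σ),
      trace_one_sub_blockIsometry_mul]
    rfl
  have h_inj : Function.Injective fun p : c' × m => (σ (.inr p.1), p.2) :=
    (σ.injective.comp Sum.inr_injective).prodMap Function.injective_id
  have h_meas : Measurable fun w : r × m → ℂ =>
      E (offTrace A (matrixOfFamily w * (matrixOfFamily w)ᴴ)) :=
    hE.comp (continuous_offTrace_gaussian A).measurable
  rw [← (measurePreserving_leftMul hV).lintegral_comp h_meas]
  simp only [h_off]
  exact (measurePreserving_precomp _ h_inj).lintegral_comp
    (f := fun y : c' × m → ℂ => E (∑ p, ‖y p‖ ^ 2)) (by fun_prop)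

variable [Fintype m] [Fintype n] {A : Matrix r c ℂ}

theorem offTrace_mul_conjTranspose_nonneg (hA : IsUnit (Aᴴ * A)) (X : Matrix r m ℂ) :
    0 ≤ offTrace A (X * Xᴴ) := by
  obtain ⟨Q, hQ, hAQ, -⟩ := exists_isometry_of_isUnit hA
  rw [offTrace, hAQ]
  exact trace_one_sub_proj_mul_nonneg hQ X

theorem offTrace_gram_conj_nonneg (hA : IsUnit (Aᴴ * A)) (J : Matrix r m ℂ) (W : Matrix n m ℂ) :
    0 ≤ offTrace A (J * (Wᴴ * W) * Jᴴ) := by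
  have h_nonneg := offTrace_mul_conjTranspose_nonneg hA (J * Wᴴ)
  simpa only [conjTranspose_mul, conjTranspose_conjTranspose, Matrix.mul_assoc] using h_nonneg

theorem offTrace_conj (A : Matrix r c ℂ) (J : Matrix r m ℂ) (S : Matrix m m ℂ) :
    offTrace A (J * S * Jᴴ) = (trace (Jᴴ * (1 - colProj A) * J * S)).re := by
  rw [offTrace, ← Matrix.mul_assoc, trace_mul_comm _ Jᴴ]
  simp only [Matrix.mul_assoc]

theorem integrable_offTrace_gram_conj (A : Matrix r c ℂ) (J : Matrix r m ℂ) :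
    Integrable (fun w : n × m → ℂ => offTrace A (J * ((matrixOfFamily w)ᴴ * matrixOfFamily w) * Jᴴ))
      (gaussPi (n × m)) := by
  simp only [offTrace_conj]
  exact (integrable_trace_mul_gram _).re

theorem integral_offTrace_gram_conj (A : Matrix r c ℂ) (J : Matrix r m ℂ) :
    ∫ w : n × m → ℂ, offTrace A (J * ((matrixOfFamily w)ᴴ * matrixOfFamily w) * Jᴴ)
        ∂gaussPi (n × m) = Fintype.card n * offTrace A (J * Jᴴ) := by
  classical
  have h_one := offTrace_conj A J 1
  rw [Matrix.mul_one, Matrix.mul_one] at h_one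
  simp only [offTrace_conj, h_one]
  have h_re := integral_re (integrable_trace_mul_gram (r := n) (Jᴴ * (1 - colProj A) * J))
  rw [integral_trace_mul_gram, ← Complex.ofReal_natCast] at h_re
  exact h_re.trans (Complex.re_ofReal_mul _ _)

/-- Rates as functions of the signal-to-noise ratio `t ≥ 0`: the class of `φ` for which the means
of `φ` at two random arguments are compared below. It is stable under truncation `min (φ t) b`. -/
structure IsRateFunction (φ : ℝ → ℝ) : Prop where
  measurable : Measurable φ
  concaveOn : ConcaveOn ℝ (Set.Ici 0) φ
  monotoneOn : MonotoneOn φ (Set.Ici 0)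
  continuousOn : ContinuousOn φ (Set.Ici 0)
  nonneg {t : ℝ} : 0 ≤ t → 0 ≤ φ t
  exists_le_mul : ∃ a, ∀ t, 0 ≤ t → φ t ≤ a * t

theorem IsRateFunction.lintegral_le {α : Type*} [MeasurableSpace α] {ν : Measure α}
    [IsProbabilityMeasure ν] {φ : ℝ → ℝ} (hφ : IsRateFunction φ) {X : α → ℝ} (hX : Integrable X ν)
    (hX_nonneg : ∀ w, 0 ≤ X w) :
    ∫⁻ w, ENNReal.ofReal (φ (X w)) ∂ν ≤ ENNReal.ofReal (φ (∫ w, X w ∂ν)) := by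
  obtain ⟨a, ha⟩ := hφ.exists_le_mul
  have h_int : Integrable (fun w => φ (X w)) ν := by
    refine (hX.const_mul a).mono'
      (hφ.measurable.comp_aemeasurable hX.aemeasurable).aestronglyMeasurable
      (.of_forall fun w => ?_)
    rw [Real.norm_of_nonneg (hφ.nonneg (hX_nonneg w))]
    exact ha _ (hX_nonneg w)
  rw [← ofReal_integral_eq_lintegral_ofReal h_int (.of_forall fun w => hφ.nonneg (hX_nonneg w))]
  exact ENNReal.ofReal_le_ofReal (hφ.concaveOn.le_map_integral hφ.continuousOn isClosed_Ici
    (.of_forall hX_nonneg) hX h_int)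

theorem IsRateFunction.lintegral_offTrace_gram_conj_le {φ : ℝ → ℝ} (hφ : IsRateFunction φ)
    (hn : 0 < Fintype.card n) (hA : IsUnit (Aᴴ * A)) (J : Matrix r m ℂ) :
    ∫⁻ w : n × m → ℂ, ENNReal.ofReal (φ (offTrace A
        (J * ((matrixOfFamily w)ᴴ * matrixOfFamily w) * Jᴴ) / Fintype.card n)) ∂gaussPi (n × m) ≤
      ENNReal.ofReal (φ (offTrace A (J * Jᴴ))) := by
  have h_jensen := hφ.lintegral_le
    ((integrable_offTrace_gram_conj (n := n) A J).div_const (Fintype.card n))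
    fun w => div_nonneg (offTrace_gram_conj_nonneg hA J _) (Nat.cast_nonneg _)
  rwa [integral_div, integral_offTrace_gram_conj,
    mul_div_cancel_left₀ _ (Nat.cast_pos.2 hn).ne'] at h_jensen

-- Given the column space of `W`, the mean of the scaled Gram matrix of `W` is the projection onto
-- that space.
theorem IsRateFunction.lintegral_norm_sq_le {φ : ℝ → ℝ} (hφ : IsRateFunction φ) [Fintype c']
    (σ : c ⊕ c' ≃ r) (hr : 0 < Fintype.card r) :
    ∫⁻ y, ENNReal.ofReal (φ ((∑ p, ‖y p‖ ^ 2) / Fintype.card r)) ∂gaussPi (c' × c) ≤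
      ∫⁻ z : r × c → ℂ, ∫⁻ w : r × c → ℂ, ENNReal.ofReal (φ
        (offTrace (matrixOfFamily z) (colProj (matrixOfFamily w))))
          ∂gaussPi (r × c) ∂gaussPi (r × c) := by
  have h_full := ae_isUnit_conjTranspose_mul_self (Function.Embedding.inl.trans σ.toEmbedding)
  have hφ_meas : Measurable fun t => ENNReal.ofReal (φ t) := hφ.measurable.ennreal_ofReal
  have hφ_div_meas : Measurable fun t => ENNReal.ofReal (φ (t / Fintype.card r)) :=
    hφ_meas.comp (measurable_id.div_const _)
  calc ∫⁻ y, ENNReal.ofReal (φ ((∑ p, ‖y p‖ ^ 2) / Fintype.card r)) ∂gaussPi (c' × c)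
      = ∫⁻ z : r × c → ℂ, ∫⁻ w : r × c → ℂ, ENNReal.ofReal (φ (offTrace (matrixOfFamily z)
          (matrixOfFamily w * (matrixOfFamily w)ᴴ) / Fintype.card r))
            ∂gaussPi (r × c) ∂gaussPi (r × c) := by
        rw [lintegral_congr_ae (h_full.mono fun z hz =>
          lintegral_offTrace_gaussian σ hz hφ_div_meas), lintegral_const, measure_univ, mul_one]
    _ = ∫⁻ z : r × c → ℂ, ∫⁻ w : r × c → ℂ, ENNReal.ofReal (φ (offTrace (matrixOfFamily z)
          (blockIsometry σ * ((matrixOfFamily w)ᴴ * matrixOfFamily w) * (blockIsometry σ)ᴴ) /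
            Fintype.card r)) ∂gaussPi (r × c) ∂gaussPi (r × c) :=
        lintegral_offTrace_gram σ hφ_div_meas
    _ ≤ ∫⁻ z : r × c → ℂ, ENNReal.ofReal (φ (offTrace (matrixOfFamily z)
          (blockIsometry σ * (blockIsometry σ)ᴴ))) ∂gaussPi (r × c) :=
        lintegral_mono_ae (h_full.mono fun z hz =>
          hφ.lintegral_offTrace_gram_conj_le hr hz (blockIsometry σ))
    _ = _ := (lintegral_offTrace_colProj σ hφ_meas).symm

end ConditionalJensen

section RateBound

variable {M : ℕ} {P : ℝ}

/-- The rate of `M` parallel channels which share the total gain `M * t` evenly. -/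
noncomputable def rateBound (M : ℕ) (P t : ℝ) : ℝ := M * Real.logb 2 (1 + P / M * t)

theorem rateBound_eq_mul_log (M : ℕ) (P t : ℝ) :
    rateBound M P t = M / Real.log 2 * Real.log (1 + P / M * t) := by
  rw [rateBound, Real.logb]
  ring

theorem measurable_rateBound : Measurable (rateBound M P) := by
  unfold rateBound Real.logb
  fun_prop

theorem one_le_one_add_mul (hP : 0 ≤ P) {t : ℝ} (ht : 0 ≤ t) : 1 ≤ 1 + P / M * t :=
  le_add_of_nonneg_right (by positivity)

theorem rateBound_nonneg (hP : 0 ≤ P) {t : ℝ} (ht : 0 ≤ t) : 0 ≤ rateBound M P t :=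
  mul_nonneg (Nat.cast_nonneg _) (Real.logb_nonneg one_lt_two (one_le_one_add_mul hP ht))

theorem rateBound_mono (hP : 0 ≤ P) {s t : ℝ} (hs : 0 ≤ s) (hst : s ≤ t) :
    rateBound M P s ≤ rateBound M P t := by
  have h_pos := zero_lt_one.trans_le (one_le_one_add_mul (M := M) hP hs)
  refine mul_le_mul_of_nonneg_left (Real.logb_le_logb_of_le one_lt_two h_pos ?_)
    (Nat.cast_nonneg _)
  gcongr

theorem concaveOn_rateBound (hP : 0 ≤ P) : ConcaveOn ℝ (Set.Ici 0) (rateBound M P) := by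
  have h_affine : ∀ t : ℝ, AffineMap.lineMap 1 (1 + P / M) t = 1 + P / M * t := fun t => by
    rw [AffineMap.lineMap_apply_ring']
    ring
  have h_subset : Set.Ici (0 : ℝ) ⊆ AffineMap.lineMap (k := ℝ) 1 (1 + P / M) ⁻¹' Set.Ioi 0 :=
    fun t ht => by
      rw [Set.mem_preimage, h_affine]
      exact zero_lt_one.trans_le (one_le_one_add_mul hP ht)
  have h_concave := (strictConcaveOn_log_Ioi.concaveOn.comp_affineMap
    (AffineMap.lineMap (k := ℝ) 1 (1 + P / M))).subset h_subset (convex_Ici 0)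
  refine (h_concave.smul (c := (M : ℝ) / Real.log 2)
    (div_nonneg (Nat.cast_nonneg _) (Real.log_nonneg one_le_two))).congr fun t _ => ?_
  simp only [rateBound_eq_mul_log, Function.comp_apply, h_affine, smul_eq_mul]

theorem continuousOn_rateBound (hP : 0 ≤ P) : ContinuousOn (rateBound M P) (Set.Ici 0) := by
  simp only [funext (rateBound_eq_mul_log M P)]
  exact ((by fun_prop : ContinuousOn (fun t => 1 + P / M * t) _).log fun t ht =>
    (zero_lt_one.trans_le (one_le_one_add_mul hP ht)).ne').const_mul _

theorem rateBound_le_mul (hM : 0 < M) (hP : 0 ≤ P) {t : ℝ} (ht : 0 ≤ t) :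
    rateBound M P t ≤ P / Real.log 2 * t := by
  have h_log := Real.log_le_sub_one_of_pos
    (zero_lt_one.trans_le (one_le_one_add_mul (M := M) hP ht))
  have hM_pos : (0 : ℝ) < M := Nat.cast_pos.2 hM
  have h_coeff : (0 : ℝ) ≤ M / Real.log 2 := div_nonneg hM_pos.le (Real.log_nonneg one_le_two)
  calc rateBound M P t = M / Real.log 2 * Real.log (1 + P / M * t) := rateBound_eq_mul_log M P t
    _ ≤ M / Real.log 2 * (1 + P / M * t - 1) := mul_le_mul_of_nonneg_left h_log h_coeff
    _ = P / Real.log 2 * t := by field_simp; ring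

theorem isRateFunction_rateBound (hM : 0 < M) (hP : 0 ≤ P) : IsRateFunction (rateBound M P) where
  measurable := measurable_rateBound
  concaveOn := concaveOn_rateBound hP
  monotoneOn _ hs _ _ hst := rateBound_mono hP hs hst
  continuousOn := continuousOn_rateBound hP
  nonneg := rateBound_nonneg hP
  exists_le_mul := ⟨P / Real.log 2, fun _ => rateBound_le_mul hM hP⟩

theorem IsRateFunction.min_const {φ : ℝ → ℝ} (hφ : IsRateFunction φ) {b : ℝ} (hb : 0 ≤ b) :
    IsRateFunction fun t => min (φ t) b where
  measurable := hφ.measurable.min measurable_const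
  concaveOn := hφ.concaveOn.inf (concaveOn_const _ (convex_Ici 0))
  monotoneOn _ hs _ ht hst := min_le_min_right _ (hφ.monotoneOn hs ht hst)
  continuousOn := hφ.continuousOn.inf continuousOn_const
  nonneg ht := le_min (hφ.nonneg ht) hb
  exists_le_mul := hφ.exists_le_mul.imp fun _ ha t ht => (min_le_left _ _).trans (ha t ht)

end RateBound

section HermitianDiagonalization

variable {m k : Type*} [Fintype m] [DecidableEq m] [DecidableEq k] {A : Matrix m m ℂ}

theorem det_one_add_smul_diagonal (t : ℝ) (d : m → ℝ) :
    det (1 + (t : ℂ) • diagonal fun i => (d i : ℂ)) = ((∏ i, (1 + t * d i) : ℝ) : ℂ) := by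
  rw [← diagonal_smul, ← diagonal_one, diagonal_add, det_diagonal]
  simp

theorem det_one_add_smul_eq_prod_eigenvalues (hA : A.IsHermitian) (t : ℝ) :
    det (1 + (t : ℂ) • A) = ((∏ i, (1 + t * hA.eigenvalues i) : ℝ) : ℂ) := by
  conv_lhs => rw [eq_unitary_conj_diagonal hA]
  rw [← Matrix.smul_mul, det_one_add_mul_comm, Matrix.mul_smul, ← Matrix.mul_assoc,
    Unitary.coe_star_mul_self, Matrix.one_mul]
  exact det_one_add_smul_diagonal t hA.eigenvalues

open scoped ComplexOrder in
theorem one_le_re_det_one_add_smul (hA : A.PosSemidef) {t : ℝ} (ht : 0 ≤ t) :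
    1 ≤ (det (1 + (t : ℂ) • A)).re := by
  rw [det_one_add_smul_eq_prod_eigenvalues hA.1, Complex.ofReal_re]
  exact Finset.one_le_prod fun i _ =>
    le_add_of_nonneg_right (mul_nonneg ht (hA.eigenvalues_nonneg i))

theorem exists_coisometry_diagonalizing (hA : A.IsHermitian) {ι : k → m}
    (hι : Function.Injective ι) :
    ∃ F : Matrix k m ℂ, F * Fᴴ = 1 ∧ F * A * Fᴴ = diagonal fun i => (hA.eigenvalues (ι i) : ℂ) := by
  let U : Matrix m m ℂ := hA.eigenvectorUnitary
  have hU : Uᴴ * U = 1 := Unitary.coe_star_mul_self hA.eigenvectorUnitary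
  have h_compress : ∀ X : Matrix m m ℂ,
      Uᴴ.submatrix ι id * X * (Uᴴ.submatrix ι id)ᴴ = (Uᴴ * X * U).submatrix ι ι := fun X => by
    ext i j
    simp [mul_apply]
  have h_one := h_compress 1
  rw [Matrix.mul_one, Matrix.mul_one, hU, submatrix_one _ hι] at h_one
  have h_diag : Uᴴ * A * U = diagonal fun i => (hA.eigenvalues i : ℂ) :=
    calc Uᴴ * A * U = Uᴴ * (U * diagonal (fun i => (hA.eigenvalues i : ℂ)) * Uᴴ) * U :=
          congrArg (fun X => Uᴴ * X * U) (eq_unitary_conj_diagonal hA)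
      _ = (Uᴴ * U) * diagonal (fun i => (hA.eigenvalues i : ℂ)) * (Uᴴ * U) := by
          simp only [Matrix.mul_assoc]
      _ = _ := by rw [hU, Matrix.one_mul, Matrix.mul_one]
  refine ⟨Uᴴ.submatrix ι id, h_one, ?_⟩
  rw [h_compress, h_diag, submatrix_diagonal _ _ hι]
  rfl

end HermitianDiagonalization

section PostProcessing

variable {n : Type*} [Fintype n] {M N : ℕ} {P : ℝ}

/-- The admissible postprocessing matrices. -/
def coisometries (M N : ℕ) : Set (Matrix (Fin M) (Fin N) ℂ) := {F | F * Fᴴ = 1}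

theorem norm_apply_le_one_of_mem_coisometries {F : Matrix (Fin M) (Fin N) ℂ}
    (hF : F ∈ coisometries M N) (i : Fin M) (j : Fin N) : ‖F i j‖ ≤ 1 := by
  have h_row : ∑ l, ‖F i l‖ ^ 2 = 1 := by
    have h_diag := congrFun (congrFun hF i) i
    rw [Matrix.one_apply_eq, Matrix.mul_apply] at h_diag
    refine Complex.ofReal_injective ?_
    rw [Complex.ofReal_one, ← h_diag]
    push_cast
    exact Finset.sum_congr rfl fun l _ => (Complex.mul_conj' _).symm
  rw [← sq_le_one_iff₀ (norm_nonneg _), ← h_row]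
  exact Finset.single_le_sum (f := fun l => ‖F i l‖ ^ 2) (fun l _ => sq_nonneg _)
    (Finset.mem_univ j)

theorem isCompact_coisometries (M N : ℕ) : IsCompact (coisometries M N) := by
  have h_ball : IsCompact (Set.univ.pi fun _ : Fin M => Set.univ.pi fun _ : Fin N =>
      Metric.closedBall (0 : ℂ) 1) :=
    isCompact_univ_pi fun _ => isCompact_univ_pi fun _ => isCompact_closedBall 0 1
  have h_cont : Continuous fun F : Matrix (Fin M) (Fin N) ℂ => F * Fᴴ :=
    continuous_id.matrix_mul continuous_id.matrix_conjTranspose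
  refine h_ball.of_isClosed_subset (isClosed_eq h_cont continuous_const) fun F hF i _ j _ => ?_
  exact mem_closedBall_zero_iff.2 (norm_apply_le_one_of_mem_coisometries hF i j)

theorem coisometries_nonempty (hMN : M ≤ N) : (coisometries M N).Nonempty := by
  obtain ⟨F, hF, -⟩ := exists_coisometry_diagonalizing (A := (1 : Matrix (Fin N) (Fin N) ℂ))
    isHermitian_one (Fin.castLE_injective hMN)
  exact ⟨F, hF⟩

/-- The rate loss as a function of the entries `z` of the joint interference channel. -/
noncomputable def jointRate (P : ℝ) (z : Fin N × n → ℂ) (F : Matrix (Fin M) (Fin N) ℂ) : ℝ :=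
  Real.logb 2
    (det (1 + ((P / M : ℝ) : ℂ) • (F * (matrixOfFamily z * (matrixOfFamily z)ᴴ) * Fᴴ))).re

open scoped ComplexOrder in
theorem one_le_re_det_jointRate (hP : 0 ≤ P) (z : Fin N × n → ℂ) (F : Matrix (Fin M) (Fin N) ℂ) :
    1 ≤ (det (1 + ((P / M : ℝ) : ℂ) •
      (F * (matrixOfFamily z * (matrixOfFamily z)ᴴ) * Fᴴ))).re :=
  one_le_re_det_one_add_smul ((posSemidef_self_mul_conjTranspose
    (matrixOfFamily z)).mul_mul_conjTranspose_same F) (by positivity)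

theorem jointRate_nonneg (hP : 0 ≤ P) (z : Fin N × n → ℂ) (F : Matrix (Fin M) (Fin N) ℂ) :
    0 ≤ jointRate P z F :=
  Real.logb_nonneg one_lt_two (one_le_re_det_jointRate hP z F)

theorem continuous_jointRate (hP : 0 ≤ P) :
    Continuous fun p : (Fin N × n → ℂ) × Matrix (Fin M) (Fin N) ℂ => jointRate P p.1 p.2 := by
  have h_fst : Continuous fun p : (Fin N × n → ℂ) × Matrix (Fin M) (Fin N) ℂ =>
      matrixOfFamily p.1 := continuous_matrixOfFamily.comp continuous_fst
  have h_arg : Continuous fun p : (Fin N × n → ℂ) × Matrix (Fin M) (Fin N) ℂ =>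
      1 + ((P / M : ℝ) : ℂ) • (p.2 * (matrixOfFamily p.1 * (matrixOfFamily p.1)ᴴ) * p.2ᴴ) :=
    continuous_const.add (((continuous_snd.matrix_mul
      (h_fst.matrix_mul h_fst.matrix_conjTranspose)).matrix_mul
        continuous_snd.matrix_conjTranspose).const_smul ((P / M : ℝ) : ℂ))
  exact ((Complex.continuous_re.comp h_arg.matrix_det).log fun p =>
    (zero_lt_one.trans_le (one_le_re_det_jointRate hP p.1 p.2)).ne').div_const _

/-- The smallest rate loss of one user. -/
noncomputable def minRate (M : ℕ) (P : ℝ) (z : Fin N × n → ℂ) : ℝ :=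
  sInf (jointRate P z '' coisometries M N)

theorem continuous_minRate (hP : 0 ≤ P) : Continuous (minRate (N := N) (n := n) M P) :=
  (isCompact_coisometries M N).continuous_sInf (continuous_jointRate hP)

theorem isLeast_minRate (hMN : M ≤ N) (hP : 0 ≤ P) (z : Fin N × n → ℂ) :
    IsLeast (jointRate P z '' coisometries M N) (minRate M P z) :=
  have h_cont : Continuous fun F : Matrix (Fin M) (Fin N) ℂ => jointRate P z F :=
    (continuous_jointRate hP).comp (f := fun F : Matrix (Fin M) (Fin N) ℂ => (z, F))
      (Continuous.prodMk_right z)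
  ((isCompact_coisometries M N).image h_cont).isLeast_sInf ((coisometries_nonempty hMN).image _)

theorem minRate_nonneg (hP : 0 ≤ P) (z : Fin N × n → ℂ) : 0 ≤ minRate M P z :=
  Real.sInf_nonneg (by rintro _ ⟨F, -, rfl⟩; exact jointRate_nonneg hP z F)

-- Concavity of the logarithm: the gains `d i` are replaced by their mean.
theorem jointRate_le_of_diagonal (hM : 0 < M) (hP : 0 ≤ P) {z : Fin N × n → ℂ}
    {F : Matrix (Fin M) (Fin N) ℂ} {d : Fin M → ℝ} (hd : ∀ i, 0 ≤ d i)
    (hF : F * (matrixOfFamily z * (matrixOfFamily z)ᴴ) * Fᴴ = diagonal fun i => (d i : ℂ)) :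
    jointRate P z F ≤ rateBound M P ((∑ i, d i) / M) := by
  have hM_pos : (0 : ℝ) < M := Nat.cast_pos.2 hM
  have h_rate : jointRate P z F = ∑ i, (M : ℝ)⁻¹ • rateBound M P (d i) := by
    rw [jointRate, hF, det_one_add_smul_diagonal, Complex.ofReal_re, Real.logb, Real.log_prod
      fun i _ => (zero_lt_one.trans_le (one_le_one_add_mul hP (hd i))).ne', Finset.sum_div]
    refine Finset.sum_congr rfl fun i _ => ?_
    rw [rateBound, smul_eq_mul, inv_mul_cancel_left₀ hM_pos.ne', Real.logb]
  have h_concave := (concaveOn_rateBound (M := M) hP).le_map_sum (t := Finset.univ)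
    (w := fun _ : Fin M => (M : ℝ)⁻¹) (p := d) (fun _ _ => by positivity)
    (by simp [hM_pos.ne']) fun i _ => hd i
  rwa [← h_rate, ← Finset.smul_sum, smul_eq_mul, inv_mul_eq_div] at h_concave

theorem lowSum_eq_sum_castLE (hMN : M ≤ N) (y : Chamber N) :
    lowSum M y = ∑ i : Fin M, y.1 (Fin.castLE hMN i) := by
  have h_filter : (Finset.univ.filter fun i : Fin N => i.1 < M) =
      Finset.univ.map (Fin.castLEEmb hMN) := by
    ext i
    simp only [Finset.mem_filter, Finset.mem_univ, true_and, Finset.mem_map]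
    exact ⟨fun hi => ⟨⟨i, hi⟩, rfl⟩, by rintro ⟨j, rfl⟩; exact j.2⟩
  rw [lowSum, h_filter, Finset.sum_map]
  rfl

-- The postprocessing matrix projects onto the weakest eigenvectors.
open scoped ComplexOrder in
theorem minRate_le_rateBound_lowSum (hM : 0 < M) (hMN : M ≤ N) (hP : 0 ≤ P) (z : Fin N × n → ℂ) :
    minRate M P z ≤ rateBound M P (lowSum M (gramEigs (Equiv.refl _) z) / M) := by
  have h_herm := isHermitian_mul_conjTranspose_self (matrixOfFamily z)
  have h_nonneg : ∀ i, 0 ≤ h_herm.eigenvalues i :=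
    (posSemidef_self_mul_conjTranspose (matrixOfFamily z)).eigenvalues_nonneg
  let τ := Tuple.sort fun i => max (h_herm.eigenvalues i) 0
  obtain ⟨F, hF, hF_diag⟩ := exists_coisometry_diagonalizing h_herm
    (τ.injective.comp (Fin.castLE_injective hMN))
  have h_low : lowSum M (gramEigs (Equiv.refl _) z) =
      ∑ i, h_herm.eigenvalues (τ (Fin.castLE hMN i)) := by
    rw [lowSum_eq_sum_castLE hMN]
    exact Finset.sum_congr rfl fun i _ => max_eq_left (h_nonneg _)
  rw [h_low]
  exact ((isLeast_minRate hMN hP z).2 ⟨F, hF, rfl⟩).trans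
    (jointRate_le_of_diagonal hM hP (fun i => h_nonneg _) hF_diag)

end PostProcessing

section ChordalDistance

variable {M N : ℕ}

theorem exists_eq_mul_of_colSpan_le {A Q : Matrix (Fin N) (Fin M) ℂ} (h : colSpan A ≤ colSpan Q) :
    ∃ T : Matrix (Fin M) (Fin M) ℂ, A = Q * T := by
  have h_col : ∀ j, ∃ t : Fin M → ℂ,
      ∑ i, t i • (WithLp.toLp 2 fun r => Q r i : EuclideanSpace ℂ (Fin N)) =
        WithLp.toLp 2 fun r => A r j := fun j =>
    (Submodule.mem_span_range_iff_exists_fun ℂ).1 (h (Submodule.subset_span ⟨j, rfl⟩))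
  choose t ht using h_col
  refine ⟨Matrix.of fun i j => t j i, ?_⟩
  ext r j
  have h_entry := congrArg (fun v : EuclideanSpace ℂ (Fin N) => v r) (ht j)
  simp only [WithLp.ofLp_sum, WithLp.ofLp_smul, Finset.sum_apply, Pi.smul_apply,
    smul_eq_mul] at h_entry
  rw [← h_entry, mul_apply]
  exact Finset.sum_congr rfl fun i _ => mul_comm _ _

theorem IsGenerator.colProj_eq {A Q : Matrix (Fin N) (Fin M) ℂ}
    (h : IsGenerator Q (colSpan A)) : colProj A = Q * Qᴴ := by
  obtain ⟨hQ, h_span⟩ := h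
  obtain ⟨T, hT⟩ := exists_eq_mul_of_colSpan_le h_span.ge
  obtain ⟨S, hS⟩ := exists_eq_mul_of_colSpan_le h_span.le
  have h_right : T * S = 1 := by
    calc T * S = (Qᴴ * Q) * T * S := by rw [hQ, Matrix.one_mul]
      _ = Qᴴ * (Q * T * S) := by simp only [Matrix.mul_assoc]
      _ = 1 := by rw [← hT, ← hS, hQ]
  have h_gram : Aᴴ * A = Tᴴ * T := by
    rw [hT, conjTranspose_mul, Matrix.mul_assoc, ← Matrix.mul_assoc Qᴴ, hQ, Matrix.one_mul]
  have h_inv : Aᴴ * A * (S * Sᴴ) = 1 := by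
    calc Aᴴ * A * (S * Sᴴ) = Tᴴ * (T * S) * Sᴴ := by rw [h_gram]; simp only [Matrix.mul_assoc]
      _ = (S * T)ᴴ := by rw [h_right, Matrix.mul_one, conjTranspose_mul]
      _ = 1 := by rw [mul_eq_one_comm.1 h_right, conjTranspose_one]
  calc colProj A = A * (S * Sᴴ) * Aᴴ := by rw [colProj, Matrix.inv_eq_right_inv h_inv]
    _ = (A * S) * (A * S)ᴴ := by rw [conjTranspose_mul]; simp only [Matrix.mul_assoc]
    _ = Q * Qᴴ := by rw [← hS]

theorem inner_toLp_col (Q R : Matrix (Fin N) (Fin M) ℂ) (i j : Fin M) :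
    inner ℂ (WithLp.toLp 2 fun r => Q r i : EuclideanSpace ℂ (Fin N))
      (WithLp.toLp 2 fun r => R r j) = (Qᴴ * R) i j := by
  rw [mul_apply, PiLp.inner_apply]
  simp [mul_comm]

theorem orthonormal_toLp_col {Q : Matrix (Fin N) (Fin M) ℂ} (hQ : Qᴴ * Q = 1) :
    Orthonormal ℂ fun i => (WithLp.toLp 2 fun r => Q r i : EuclideanSpace ℂ (Fin N)) :=
  orthonormal_iff_ite.2 fun i j => by rw [inner_toLp_col, hQ, one_apply]

theorem toLp_col_mem_colSpan (Q : Matrix (Fin N) (Fin M) ℂ) (i : Fin M) :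
    (WithLp.toLp 2 fun r => Q r i : EuclideanSpace ℂ (Fin N)) ∈ colSpan Q :=
  Submodule.subset_span ⟨i, rfl⟩

theorem finrank_colSpan {Q : Matrix (Fin N) (Fin M) ℂ} (hQ : Qᴴ * Q = 1) :
    Module.finrank ℂ (colSpan Q) = M := by
  rw [colSpan, finrank_span_eq_card (orthonormal_toLp_col hQ).linearIndependent, Fintype.card_fin]

-- Both sides are the squared Hilbert–Schmidt norm of the map `colSpan R → colSpan Q` induced by the
-- orthogonal projection, in two pairs of orthonormal bases.
theorem IsPrincipalSystem.sum_cos_sq_eq_sum_norm_sq {Q R : Matrix (Fin N) (Fin M) ℂ}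
    (hQ : Qᴴ * Q = 1) (hR : Rᴴ * R = 1) {a b : Fin M → EuclideanSpace ℂ (Fin N)} {θ : Fin M → ℝ}
    (h : IsPrincipalSystem (colSpan Q) (colSpan R) a b θ) :
    ∑ m, Real.cos (θ m) ^ 2 = ∑ i, ∑ j, ‖(Qᴴ * R) i j‖ ^ 2 := by
  let col (X : Matrix (Fin N) (Fin M) ℂ) (i : Fin M) : EuclideanSpace ℂ (Fin N) :=
    WithLp.toLp 2 fun r => X r i
  have h_left : ∀ v, ∑ m, ‖inner ℂ (a m) v‖ ^ 2 = ∑ i, ‖inner ℂ (col Q i) v‖ ^ 2 :=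
    sum_sq_norm_inner_eq (finrank_colSpan hQ) h.left_orthonormal (orthonormal_toLp_col hQ)
      h.left_mem (toLp_col_mem_colSpan Q)
  have h_right : ∀ v, ∑ m, ‖inner ℂ (b m) v‖ ^ 2 = ∑ j, ‖inner ℂ (col R j) v‖ ^ 2 :=
    sum_sq_norm_inner_eq (finrank_colSpan hR) h.symm.left_orthonormal (orthonormal_toLp_col hR)
      h.right_mem (toLp_col_mem_colSpan R)
  calc ∑ m, Real.cos (θ m) ^ 2 = ∑ l, ∑ m, ‖inner ℂ (a m) (b l)‖ ^ 2 := by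
        rw [h.sum_cos_sq, Finset.sum_comm]
    _ = ∑ i, ∑ l, ‖inner ℂ (col Q i) (b l)‖ ^ 2 := by simp only [h_left]; rw [Finset.sum_comm]
    _ = ∑ i, ∑ j, ‖inner ℂ (col Q i) (col R j)‖ ^ 2 := by
        simp only [norm_inner_symm (col Q _), h_right]
    _ = ∑ i, ∑ j, ‖(Qᴴ * R) i j‖ ^ 2 := by simp only [col, inner_toLp_col]

theorem chordalDist_sq_eq {Q R : Matrix (Fin N) (Fin M) ℂ} (hQ : Qᴴ * Q = 1) (hR : Rᴴ * R = 1) :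
    chordalDist M (colSpan Q) (colSpan R) ^ 2 = M - ∑ i, ∑ j, ‖(Qᴴ * R) i j‖ ^ 2 := by
  obtain ⟨θ, hθ⟩ := exists_principalAngles M _ _ (finrank_colSpan hQ) (finrank_colSpan hR)
  rw [chordalDist_eq (finrank_colSpan hQ) (finrank_colSpan hR) hθ,
    Real.sq_sqrt (Finset.sum_nonneg fun _ _ => sq_nonneg _)]
  obtain ⟨a, b, h⟩ := hθ
  simp only [Real.sin_sq, Finset.sum_sub_distrib, h.sum_cos_sq_eq_sum_norm_sq hQ hR,
    Finset.sum_const, Finset.card_univ, Fintype.card_fin, nsmul_eq_mul, mul_one]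

theorem chordalDist_sq_le {Q R : Matrix (Fin N) (Fin M) ℂ} (hQ : Qᴴ * Q = 1) (hR : Rᴴ * R = 1) :
    chordalDist M (colSpan Q) (colSpan R) ^ 2 ≤ M := by
  rw [chordalDist_sq_eq hQ hR]
  exact sub_le_self _ (by positivity)

theorem re_trace_one_sub_mul {Q R : Matrix (Fin N) (Fin M) ℂ} (hR : Rᴴ * R = 1) :
    (trace ((1 - Q * Qᴴ) * (R * Rᴴ))).re = M - ∑ i, ∑ j, ‖(Qᴴ * R) i j‖ ^ 2 := by
  rw [← re_trace_mul_conjTranspose, Matrix.sub_mul, Matrix.one_mul, trace_sub, Complex.sub_re,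
    trace_mul_comm R, hR, conjTranspose_mul, conjTranspose_conjTranspose, Matrix.mul_assoc Q,
    trace_mul_comm Q]
  simp [Matrix.mul_assoc]

theorem IsGenerator.chordalDist_sq_eq_offTrace {A B Q R : Matrix (Fin N) (Fin M) ℂ}
    (hQ : IsGenerator Q (colSpan A)) (hR : IsGenerator R (colSpan B)) :
    chordalDist M (colSpan Q) (colSpan R) ^ 2 = offTrace A (colProj B) := by
  rw [chordalDist_sq_eq hQ.1 hR.1, offTrace, hQ.colProj_eq, hR.colProj_eq,
    re_trace_one_sub_mul hR.1]

end ChordalDistance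

section OneUser

variable {M : ℕ} {P : ℝ}

/-- The first of two `M`-column blocks placed side by side. -/
def leftBlock (z : Fin (2 * M) × (Fin M ⊕ Fin M) → ℂ) : Fin (2 * M) × Fin M → ℂ :=
  fun p => z (p.1, .inl p.2)

/-- The second of two `M`-column blocks placed side by side. -/
def rightBlock (z : Fin (2 * M) × (Fin M ⊕ Fin M) → ℂ) : Fin (2 * M) × Fin M → ℂ :=
  fun p => z (p.1, .inr p.2)

/-- The squared chordal distance between the column spaces of the two blocks, written so that it
makes sense, as a measurable function, for blocks of any rank. -/
noncomputable def blockDist (z : Fin (2 * M) × (Fin M ⊕ Fin M) → ℂ) : ℝ :=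
  offTrace (matrixOfFamily (leftBlock z)) (colProj (matrixOfFamily (rightBlock z)))

theorem measurable_blockDist : Measurable (blockDist (M := M)) := by
  have h_left : Measurable (leftBlock (M := M)) :=
    measurable_pi_lambda _ fun _ => measurable_pi_apply _
  have h_right : Measurable (rightBlock (M := M)) :=
    measurable_pi_lambda _ fun _ => measurable_pi_apply _
  exact measurable_offTrace h_left fun i j => (measurable_colProj_apply i j).comp h_right

theorem IsRateFunction.lintegral_lowSum_le_blockDist {φ : ℝ → ℝ} (hφ : IsRateFunction φ)
    (hM : 0 < M) :
    ∫⁻ z, ENNReal.ofReal (φ (lowSum M (gramEigs (Equiv.refl _) z) / M))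
        ∂gaussPi (Fin (2 * M) × (Fin M ⊕ Fin M)) ≤
      ∫⁻ z, ENNReal.ofReal (φ (blockDist z)) ∂gaussPi (Fin (2 * M) × (Fin M ⊕ Fin M)) := by
  -- `φ` is only known to be monotone on the half line, hence the truncation at `0`.
  let F : ℝ → ENNReal := fun s => ENNReal.ofReal (φ (max s 0 / M))
  have hF_measurable : Measurable F :=
    (hφ.measurable.comp (by fun_prop : Measurable fun s : ℝ => max s 0 / M)).ennreal_ofReal
  have hF_mono : Monotone F := fun s t hst => ENNReal.ofReal_le_ofReal
    (hφ.monotoneOn (Set.mem_Ici.2 (by positivity)) (Set.mem_Ici.2 (by positivity)) (by gcongr))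
  have hF : ∀ s, 0 ≤ s → F s = ENNReal.ofReal (φ (s / M)) := fun s hs => by
    simp only [F, max_eq_left hs]
  have hF_lowSum : ∀ z : Fin (2 * M) × (Fin M ⊕ Fin M) → ℂ,
      F (lowSum M (gramEigs (Equiv.refl _) z)) =
        ENNReal.ofReal (φ (lowSum M (gramEigs (Equiv.refl _) z) / M)) := fun z =>
    hF _ (Finset.sum_nonneg fun i _ => (gramEigs (Equiv.refl _) z).2.2 i)
  have hF_norm_sq : ∀ y : Fin M × Fin M → ℂ, F (1 / 2 * ∑ p, ‖y p‖ ^ 2) =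
      ENNReal.ofReal (φ ((∑ p, ‖y p‖ ^ 2) / Fintype.card (Fin (2 * M)))) := fun y => by
    rw [hF _ (by positivity), Fintype.card_fin]
    congr 2
    push_cast
    field_simp
  have h_lowSum := lintegral_lowSum_gramEigs_le (n := Fin M ⊕ Fin M) hM
    (Equiv.refl (Fin (2 * M))) (by simp [two_mul]) hF_measurable hF_mono
  simp only [hF_lowSum, hF_norm_sq] at h_lowSum
  have h_jensen := hφ.lintegral_norm_sq_le (finSumFinEquiv.trans (finCongr (two_mul M).symm))
    (by simpa using hM)
  have h_measurable : Measurable fun z : Fin (2 * M) × (Fin M ⊕ Fin M) → ℂ =>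
      ENNReal.ofReal (φ (blockDist z)) := (hφ.measurable.comp measurable_blockDist).ennreal_ofReal
  rw [lintegral_pi_sum _ (Equiv.prodSumDistrib (Fin (2 * M)) (Fin M) (Fin M)).symm h_measurable]
  exact h_lowSum.trans h_jensen

theorem lintegral_min_minRate_le (hM : 0 < M) (hP : 0 ≤ P) (b : ENNReal) :
    ∫⁻ z, min (ENNReal.ofReal (minRate M P z)) b ∂gaussPi (Fin (2 * M) × (Fin M ⊕ Fin M)) ≤
      ∫⁻ z, min (ENNReal.ofReal (rateBound M P (blockDist z))) b
        ∂gaussPi (Fin (2 * M) × (Fin M ⊕ Fin M)) := by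
  have h_rate := isRateFunction_rateBound hM hP
  refine (lintegral_mono fun z => min_le_min_right b (ENNReal.ofReal_le_ofReal
    (minRate_le_rateBound_lowSum hM (Nat.le_mul_of_pos_left M two_pos) hP z))).trans ?_
  induction b with
  | top =>
    simp only [le_top, min_eq_left]
    exact h_rate.lintegral_lowSum_le_blockDist hM
  | coe b =>
    have h_min : ∀ t : ℝ, min (ENNReal.ofReal t) b = ENNReal.ofReal (min t b) := fun t => by
      rw [ENNReal.ofReal_min, ENNReal.ofReal_coe_nnreal]
    simp only [h_min]
    exact (h_rate.min_const b.2).lintegral_lowSum_le_blockDist hM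

end OneUser

section IndependentMinima

theorem iInf_fin_succ {α : Type*} [CompleteLattice α] {K : ℕ} (f : Fin (K + 1) → α) :
    ⨅ k, f k = f 0 ⊓ ⨅ k : Fin K, f k.succ :=
  le_antisymm (le_inf (iInf_le _ _) (le_iInf fun _ => iInf_le _ _))
    (le_iInf fun k => Fin.cases inf_le_left (fun j => inf_le_right.trans (iInf_le _ j)) k)

variable {α : Type*} [MeasurableSpace α]

theorem lintegral_pi_fin_succ (ν : Measure α) [SigmaFinite ν] {K : ℕ}
    {g : α × (Fin K → α) → ENNReal} (hg : Measurable g) :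
    ∫⁻ z, g (z 0, fun k => z k.succ) ∂(Measure.pi fun _ : Fin (K + 1) => ν) =
      ∫⁻ x, ∫⁻ y, g (x, y) ∂(Measure.pi fun _ : Fin K => ν) ∂ν := by
  rw [← lintegral_prod _ hg.aemeasurable]
  exact (measurePreserving_piFinSuccAbove (fun _ : Fin (K + 1) => ν) 0).lintegral_comp hg

-- The users are exchanged one at a time: conditionally on all the others, the minimum over the
-- others acts as one more truncation level.
theorem lintegral_min_iInf_le {ν : Measure α} [SigmaFinite ν] {X D : α → ENNReal}
    (hX : Measurable X) (hD : Measurable D)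
    (h : ∀ b, ∫⁻ x, min (X x) b ∂ν ≤ ∫⁻ x, min (D x) b ∂ν) (K : ℕ) (b : ENNReal) :
    ∫⁻ z, min (⨅ k, X (z k)) b ∂(Measure.pi fun _ : Fin K => ν) ≤
      ∫⁻ z, min (⨅ k, D (z k)) b ∂(Measure.pi fun _ : Fin K => ν) := by
  induction K generalizing b with
  | zero => simp
  | succ K ih =>
    let π : Measure (Fin K → α) := Measure.pi fun _ => ν
    have h_iInf {Y : α → ENNReal} (hY : Measurable Y) :
        Measurable fun y : Fin K → α => ⨅ k, Y (y k) :=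
      .iInf fun k => hY.comp (measurable_pi_apply k)
    have h_joint {Y Y' : α → ENNReal} (hY : Measurable Y) (hY' : Measurable Y') :
        Measurable fun p : α × (Fin K → α) => min (min (Y p.1) (⨅ k, Y' (p.2 k))) b :=
      ((hY.comp measurable_fst).min ((h_iInf hY').comp measurable_snd)).min measurable_const
    simp only [iInf_fin_succ]
    calc ∫⁻ z, min (min (X (z 0)) (⨅ k : Fin K, X (z k.succ))) b ∂(Measure.pi fun _ => ν)
        = ∫⁻ x, ∫⁻ y, min (min (X x) (⨅ k, X (y k))) b ∂π ∂ν :=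
          lintegral_pi_fin_succ ν (h_joint hX hX)
      _ = ∫⁻ y, ∫⁻ x, min (min (X x) (⨅ k, X (y k))) b ∂ν ∂π :=
          lintegral_lintegral_swap (h_joint hX hX).aemeasurable
      _ ≤ ∫⁻ y, ∫⁻ x, min (min (D x) (⨅ k, X (y k))) b ∂ν ∂π := by
          simp only [min_assoc]
          exact lintegral_mono fun y => h _
      _ = ∫⁻ x, ∫⁻ y, min (min (D x) (⨅ k, X (y k))) b ∂π ∂ν :=
          (lintegral_lintegral_swap (h_joint hD hX).aemeasurable).symm
      _ ≤ ∫⁻ x, ∫⁻ y, min (min (D x) (⨅ k, D (y k))) b ∂π ∂ν := by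
          simp only [min_comm (D _), min_assoc]
          exact lintegral_mono fun x => ih _
      _ = ∫⁻ z, min (min (D (z 0)) (⨅ k : Fin K, D (z k.succ))) b ∂(Measure.pi fun _ => ν) :=
          (lintegral_pi_fin_succ ν (h_joint hD hD)).symm

theorem lintegral_pi_iInf_minRate_le {M K : ℕ} [Nonempty (Fin K)] {P : ℝ} (hM : 0 < M)
    (hP : 0 ≤ P) :
    ∫⁻ z, ENNReal.ofReal (⨅ k, minRate M P (z k))
        ∂(Measure.pi fun _ : Fin K => gaussPi (Fin (2 * M) × (Fin M ⊕ Fin M))) ≤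
      ∫⁻ z, ENNReal.ofReal (⨅ k, rateBound M P (blockDist (z k)))
        ∂(Measure.pi fun _ : Fin K => gaussPi (Fin (2 * M) × (Fin M ⊕ Fin M))) := by
  have h_min := lintegral_min_iInf_le
    (continuous_minRate (M := M) (n := Fin M ⊕ Fin M) hP).measurable.ennreal_ofReal
    ((measurable_rateBound (M := M) (P := P)).comp measurable_blockDist).ennreal_ofReal
    (lintegral_min_minRate_le hM hP) K ⊤
  simpa only [le_top, min_eq_left, ← ENNReal.ofReal_iInf, Function.comp_apply] using h_min

end IndependentMinima

section Channel

variable {M : ℕ}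

/-- The entries of the channels of the two interfering users, `H 1` and `H 2`, side by side. -/
def interference (H : Fin 3 → Matrix (Fin (2 * M)) (Fin M) ℂ) :
    Fin (2 * M) × (Fin M ⊕ Fin M) → ℂ :=
  fun p => Sum.elim (H 1 p.1) (H 2 p.1) p.2

theorem rateLoss_eq_jointRate (P : ℝ) (F : Matrix (Fin M) (Fin (2 * M)) ℂ)
    (H : Fin 3 → Matrix (Fin (2 * M)) (Fin M) ℂ) :
    rateLoss P F H = jointRate P (interference H) F := by
  have h_gram : matrixOfFamily (interference H) * (matrixOfFamily (interference H))ᴴ =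
      H 1 * (H 1)ᴴ + H 2 * (H 2)ᴴ := by
    ext i j
    simp [mul_apply, matrixOfFamily, interference, Fintype.sum_sum_type]
  rw [rateLoss, jointRate, h_gram, Finset.sum_pair (by decide), Matrix.mul_add, Matrix.add_mul]
  simp only [Matrix.mul_assoc]

theorem isLeast_rateLossValues {K : ℕ} [Nonempty (Fin K)] {P : ℝ} (hP : 0 ≤ P)
    (H : Fin K → Fin 3 → Matrix (Fin (2 * M)) (Fin M) ℂ) :
    IsLeast (rateLossValues P H) (⨅ k, minRate M P (interference (H k))) := by
  have h_least k := isLeast_minRate (Nat.le_mul_of_pos_left M two_pos) hP (interference (H k))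
  constructor
  · obtain ⟨k, hk⟩ := exists_eq_ciInf_of_finite (f := fun k => minRate M P (interference (H k)))
    obtain ⟨F, hF, hFk⟩ := (h_least k).1
    exact ⟨k, F, hF, by rw [rateLoss_eq_jointRate, hFk, hk]⟩
  · rintro x ⟨k, F, hF, rfl⟩
    rw [rateLoss_eq_jointRate]
    exact (ciInf_le (Set.finite_range _).bddBelow k).trans ((h_least k).2 ⟨F, hF, rfl⟩)

variable {Ω : Type*} [MeasurableSpace Ω] {μ : Measure Ω} {K : ℕ}
  {H : Fin K → Fin 3 → Ω → Matrix (Fin (2 * M)) (Fin M) ℂ}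

theorem IsIIDGaussianChannel.hasLaw_of_injective (hH : IsIIDGaussianChannel μ H) {ι : Type*}
    [Fintype ι] {q : ι → Fin K × Fin 3 × Fin (2 * M) × Fin M} (hq : Function.Injective q) :
    HasLaw (fun ω i => H (q i).1 (q i).2.1 ω (q i).2.2.1 (q i).2.2.2) (gaussPi ι) μ :=
  (hH.indep.precomp hq).hasLaw_pi fun _ => hH.hasLaw _ _ _ _

theorem map_curry_gaussPi {ι κ : Type*} [Fintype ι] [Fintype κ] :
    (gaussPi (ι × κ)).map (MeasurableEquiv.curry ι κ ℂ) =
      Measure.pi fun _ : ι => gaussPi κ := by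
  simpa only [Measure.infinitePi_eq_pi] using
    Measure.infinitePi_map_curry fun (_ : ι) (_ : κ) => stdComplexGaussian

theorem IsIIDGaussianChannel.hasLaw_interference (hH : IsIIDGaussianChannel μ H) :
    HasLaw (fun ω k => interference fun i => H k i ω)
      (Measure.pi fun _ : Fin K => gaussPi (Fin (2 * M) × (Fin M ⊕ Fin M))) μ := by
  let q : Fin K × Fin (2 * M) × (Fin M ⊕ Fin M) → Fin K × Fin 3 × Fin (2 * M) × Fin M :=
    fun p => Sum.elim (fun j => (p.1, 1, p.2.1, j)) (fun j => (p.1, 2, p.2.1, j)) p.2.2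
  have hq : Function.Injective q := by
    rintro ⟨k, r, j | j⟩ ⟨k', r', j' | j'⟩ h <;> simp_all [q]
  let curry := MeasurableEquiv.curry (Fin K) (Fin (2 * M) × (Fin M ⊕ Fin M)) ℂ
  have h_interference : (fun ω k => interference fun i => H k i ω) =
      curry ∘ fun ω p => H (q p).1 (q p).2.1 ω (q p).2.2.1 (q p).2.2.2 := by
    funext ω k p
    obtain ⟨r, j | j⟩ := p <;> rfl
  rw [h_interference]
  exact HasLaw.comp ⟨curry.measurable.aemeasurable, map_curry_gaussPi⟩ (hH.hasLaw_of_injective hq)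

theorem IsIIDGaussianChannel.aemeasurable_interference (hH : IsIIDGaussianChannel μ H) (k : Fin K) :
    AEMeasurable (fun ω => interference fun i => H k i ω) μ :=
  (measurable_pi_apply k).comp_aemeasurable hH.hasLaw_interference.aemeasurable

theorem IsIIDGaussianChannel.lintegral_iInf_minRate_le [Nonempty (Fin K)]
    (hH : IsIIDGaussianChannel μ H) (hM : 0 < M) {P : ℝ} (hP : 0 ≤ P) :
    ∫⁻ ω, ENNReal.ofReal (⨅ k, minRate M P (interference fun i => H k i ω)) ∂μ ≤
      ∫⁻ ω, ENNReal.ofReal (⨅ k, rateBound M P (blockDist (interference fun i => H k i ω))) ∂μ := by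
  have h_minRate : Measurable fun z : Fin K → Fin (2 * M) × (Fin M ⊕ Fin M) → ℂ =>
      ENNReal.ofReal (⨅ k, minRate M P (z k)) :=
    (Measurable.iInf fun k =>
      (continuous_minRate hP).measurable.comp (measurable_pi_apply k)).ennreal_ofReal
  have h_bound : Measurable fun z : Fin K → Fin (2 * M) × (Fin M ⊕ Fin M) → ℂ =>
      ENNReal.ofReal (⨅ k, rateBound M P (blockDist (z k))) :=
    (Measurable.iInf fun k => (measurable_rateBound.comp measurable_blockDist).comp
      (measurable_pi_apply k)).ennreal_ofReal
  have h_law := hH.hasLaw_interference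
  simpa only [← h_law.lintegral_comp h_minRate.aemeasurable,
    ← h_law.lintegral_comp h_bound.aemeasurable] using
    lintegral_pi_iInf_minRate_le (K := K) hM hP

theorem integrable_iInf_rateBound [IsFiniteMeasure μ] [Nonempty (Fin K)] {P c : ℝ} (hP : 0 ≤ P)
    {d : Ω → Fin K → ℝ} (hd : ∀ k, AEMeasurable (d · k) μ)
    (h_bounds : ∀ᵐ ω ∂μ, ∀ k, 0 ≤ d ω k ∧ d ω k ≤ c) :
    Integrable (fun ω => ⨅ k, rateBound M P (d ω k)) μ := by
  have h_measurable : AEMeasurable (fun ω => ⨅ k, rateBound M P (d ω k)) μ :=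
    .iInf fun k => measurable_rateBound.comp_aemeasurable (hd k)
  refine .of_bound h_measurable.aestronglyMeasurable (rateBound M P c) ?_
  filter_upwards [h_bounds] with ω hω
  rw [Real.norm_of_nonneg (le_ciInf fun k => rateBound_nonneg hP (hω k).1)]
  exact (ciInf_le (Set.finite_range _).bddBelow (Classical.arbitrary _)).trans
    (rateBound_mono hP (hω _).1 (hω _).2)

theorem integrable_and_integral_le_of_lintegral_le {f g : Ω → ℝ} (hf : AEStronglyMeasurable f μ)
    (hf_nonneg : 0 ≤ f) (hg : Integrable g μ) (hg_nonneg : 0 ≤ g)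
    (h : ∫⁻ ω, ENNReal.ofReal (f ω) ∂μ ≤ ∫⁻ ω, ENNReal.ofReal (g ω) ∂μ) :
    Integrable f μ ∧ ∫ ω, f ω ∂μ ≤ ∫ ω, g ω ∂μ := by
  have h_finite : ∫⁻ ω, ENNReal.ofReal (g ω) ∂μ < ⊤ :=
    (hasFiniteIntegral_iff_ofReal (.of_forall hg_nonneg)).1 hg.2
  refine ⟨⟨hf, (hasFiniteIntegral_iff_ofReal (.of_forall hf_nonneg)).2 (h.trans_lt h_finite)⟩, ?_⟩
  rw [integral_eq_lintegral_of_nonneg_ae (.of_forall hf_nonneg) hf,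
    integral_eq_lintegral_of_nonneg_ae (.of_forall hg_nonneg) hg.aestronglyMeasurable]
  exact ENNReal.toReal_mono h_finite.ne h

end Channel

theorem lemma3 {Ω : Type*} [MeasurableSpace Ω] (μ : Measure Ω) [IsProbabilityMeasure μ]
    (K M : ℕ) (hK : 0 < K) (hM : 0 < M) (P : ℝ) (hP : 0 ≤ P)
    (H : Fin K → Fin 3 → Ω → Matrix (Fin (2 * M)) (Fin M) ℂ)
    (hH : IsIIDGaussianChannel μ H)
    (Ht : Fin K → Fin 3 → Ω → Matrix (Fin (2 * M)) (Fin M) ℂ)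
    (hHt : ∀ k, ∀ i ∈ ({1, 2} : Finset (Fin 3)),
      ∀ᵐ ω ∂μ, IsGenerator (Ht k i ω) (colSpan (H k i ω))) :
    (∀ ω, IsLeast (rateLossValues P fun k i => H k i ω)
      (sInf (rateLossValues P fun k i => H k i ω))) ∧
    Integrable (fun ω => sInf (rateLossValues P fun k i => H k i ω)) μ ∧
    Integrable (fun ω => ⨅ k : Fin K, (M : ℝ) * Real.logb 2
      (1 + P / M * chordalDist M (colSpan (Ht k 1 ω)) (colSpan (Ht k 2 ω)) ^ 2)) μ ∧
    ∫ ω, sInf (rateLossValues P fun k i => H k i ω) ∂μ ≤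
      ∫ ω, (⨅ k : Fin K, (M : ℝ) * Real.logb 2
        (1 + P / M * chordalDist M (colSpan (Ht k 1 ω)) (colSpan (Ht k 2 ω)) ^ 2)) ∂μ := by
  have : Nonempty (Fin K) := ⟨⟨0, hK⟩⟩
  have h_least ω := isLeast_rateLossValues hP fun k i => H k i ω
  simp only [fun ω => (h_least ω).csInf_eq]
  let dist_sq ω k := chordalDist M (colSpan (Ht k 1 ω)) (colSpan (Ht k 2 ω)) ^ 2
  have h_generator : ∀ᵐ ω ∂μ, ∀ k, IsGenerator (Ht k 1 ω) (colSpan (H k 1 ω)) ∧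
      IsGenerator (Ht k 2 ω) (colSpan (H k 2 ω)) :=
    ae_all_iff.2 fun k => (hHt k 1 (by simp)).and (hHt k 2 (by simp))
  have h_dist : ∀ᵐ ω ∂μ, ∀ k, dist_sq ω k = blockDist (interference fun i => H k i ω) :=
    h_generator.mono fun ω hω k => (hω k).1.chordalDist_sq_eq_offTrace (hω k).2
  have h_bounds : ∀ᵐ ω ∂μ, ∀ k, 0 ≤ dist_sq ω k ∧ dist_sq ω k ≤ M :=
    h_generator.mono fun ω hω k => ⟨sq_nonneg _, chordalDist_sq_le (hω k).1.1 (hω k).2.1⟩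
  have h_dist_measurable k : AEMeasurable (dist_sq · k) μ :=
    (measurable_blockDist.comp_aemeasurable (hH.aemeasurable_interference k)).congr
      (h_dist.mono fun ω hω => (hω k).symm)
  have h_integrable := integrable_iInf_rateBound (M := M) hP h_dist_measurable h_bounds
  have h_lintegral : ∫⁻ ω, ENNReal.ofReal (⨅ k, minRate M P (interference fun i => H k i ω)) ∂μ ≤
      ∫⁻ ω, ENNReal.ofReal (⨅ k, rateBound M P (dist_sq ω k)) ∂μ :=
    (hH.lintegral_iInf_minRate_le hM hP).trans_eq
      (lintegral_congr_ae (h_dist.mono fun ω hω => by simp only [hω]))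
  obtain ⟨h_integrable_min, h_le⟩ := integrable_and_integral_le_of_lintegral_le
    (AEMeasurable.iInf fun k => (continuous_minRate hP).measurable.comp_aemeasurable
      (hH.aemeasurable_interference k)).aestronglyMeasurable
    (fun ω => le_ciInf fun k => minRate_nonneg hP _) h_integrable
    (fun ω => le_ciInf fun k => rateBound_nonneg hP (sq_nonneg _)) h_lintegral
  exact ⟨h_least, h_integrable_min, h_integrable, h_le⟩
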